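/- Let $A$ and $B$ be rings, $M$ an $(A,B)$-bimodule, and let $\mathcal X\subseteq A\text{-Mod}$, $\mathcal Y\subseteq B\text{-Mod}$ be full subcategories closed under isomorphisms and containing the zero module. Let $\mathrm{Rep}_h(A,M,B)$ be the abelian category of triples $(X,Y)_\varphi$ with $X\in A\text{-Mod}$, $Y\in B\text{-Mod}$ and $\varphi\colon Y\to\mathrm{Hom}_A(M,X)$ a $B$-homomorphism, a morphism $(X,Y)_\varphi\to(X_1,Y_1)_{\varphi_1}$ being a pair $(f,g)$, $f\in\mathrm{Hom}_A(X,X_1)$, $g\in\mathrm{Hom}_B(Y,Y_1)$, with $\mathrm{Hom}_A(M,f)\varphi=\varphi_1 g$. Let $\mathcal E=\mathcal E(\mathcal X,M,\mathcal Y)$ be the full subcategory of the $(X,Y)_\varphi$ with $X\in\mathcal X$, $\ker\varphi\in\mathcal Y$ and $\varphi$ surjective. For a full subcategory $\mathcal C$ of an abelian category, short exact sequences in $\mathcal C$ are those of the ambient category with all terms in $\mathcal C$; $\mathcal I(\mathcal C)$ and $\mathcal P(\mathcal C)$ are the injective and projective objects of $\mathcal C$ relative to these sequences; and $\mathcal C$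 is called Frobenius if it contains a zero object, is closed under extensions, has enough projectives and enough injectives relative to these sequences, and $\mathcal I(\mathcal C)=\mathcal P(\mathcal C)$. The stable category $\mathrm{St}\,\mathcal C$ of a Frobenius category $\mathcal C$ has the same objects and the morphisms of $\mathcal C$ modulo those that factor through a projective object. Its standard triangulated structure is the following: the suspension $TX$ is the cokernel of an inflation $X\to I(X)$ with $I(X)\in\mathcal I(\mathcal C)$, and the exact triangles are, up to isomorphism, the images of $X\xrightarrow{f}Y\xrightarrow{g}Z\xrightarrow{h}TX$ for short exact sequences $0\to X\xrightarrow{f}Y\xrightarrow{g}Z\to0$ in $\mathcal C$, where $h$ is induced by an extension $Y\to I(X)$ of $X\to I(X)$. Suppose that $\mathrm{Hom}_A(M,X)\in\mathcal Y$ for all $X\in\mathcal X$, and that $\mathcal E$ is a co-resolving subcategory of $\mathrm{Rep}_h(A,M,B)$, i.e. it contains all injective objects of $\mathrm{Rep}_h(A,M,B)$ and is closed under direct summands, extensions and cokernels of monomorphisms. Suppose moreover that one of the following holds: (1) $\mathcal E$ is a Frobenius category; (2) $\mathcal X$ and $\mathcal Y$ are Frobenius categories and $\mathrm{Hom}_A(M,\mathcal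 I(\mathcal X))\subseteq\mathcal I(\mathcal Y)$; (3) $\mathcal X$ and $\mathcal Y$ are Frobenius categories and $\mathrm{Hom}_A(M,\mathcal P(\mathcal X))\subseteq\mathcal P(\mathcal Y)$. Then $\mathcal X$, $\mathcal Y$ and $\mathcal E$ are Frobenius categories, the functors $$\mathbf Q\colon\mathcal E\to\mathcal Y,\ (X,Y)_\varphi\mapsto Y;\quad \mathbf q\colon\mathcal Y\to\mathcal E,\ Y\mapsto(0,Y)_0;\quad \mathbb Q\colon\mathcal E\to\mathcal Y,\ (X,Y)_\varphi\mapsto\ker\varphi;$$ $$\mathbf P\colon\mathcal E\to\mathcal X,\ (X,Y)_\varphi\mapsto X;\quad \mathbf p\colon\mathcal X\to\mathcal E,\ X\mapsto(X,\mathrm{Hom}_A(M,X))_1$$ (with the natural action on morphisms) induce functors $\overline{\mathbf Q},\overline{\mathbf q},\overline{\mathbb Q},\overline{\mathbf P},\overline{\mathbf p}$ between the stable categories, and there is a functor $\mathbf j\colon\mathrm{St}\,\mathcal X\to\mathrm{St}\,\mathcal E$ such that $\mathrm{St}\,\mathcal Y$ (left), $\mathrm{St}\,\mathcal E$ (middle)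 and $\mathrm{St}\,\mathcal X$ (right), with their standard triangulated structures, form a recollement of triangulated categories with $(i^*,i_*,i^!)=(\overline{\mathbf Q},\overline{\mathbf q},\overline{\mathbb Q})$ and $(j_!,j^*,j_*)=(\mathbf j,\overline{\mathbf P},\overline{\mathbf p})$. That is, all six functors are triangulated; $i^*\dashv i_*\dashv i^!$ and $j_!\dashv j^*\dashv j_*$; $i_*$, $j_!$, $j_*$ are fully faithful; $j^*i_*=0$; and for each object $E$ of $\mathrm{St}\,\mathcal E$ there are exact triangles $j_!j^*E\to E\to i_*i^*E\to Tj_!j^*E$ and $i_*i^!E\to E\to j_*j^*E\to Ti_*i^!E$ whose first two maps are counits and units of these adjunctions. -/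

import Mathlib

open CategoryTheory CategoryTheory.Limits

universe v u v₁ u₁ v₂ u₂ v₃ u₃ w

noncomputable section

namespace StableRecollement

/-! ### Exact structure of a full subcategory of an abelian category -/

section Exact

variable {C : Type u} [Category.{v} C] [Abelian C] (P : ObjectProperty C)

/-- `0 ⟶ X ⟶ Y ⟶ Z ⟶ 0` is a short exact sequence of the ambient abelian category
all of whose terms lie in the full subcategory `P`. -/
def IsConflation {X Y Z : P.FullSubcategory} (f : X ⟶ Y) (g : Y ⟶ Z) : Prop :=
  ∃ zero : f.hom ≫ g.hom = 0, (ShortComplex.mk f.hom g.hom zero).ShortExact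

/-- Projective objects of the exact category `P`. Left exactness of `Hom(Q, -)` being automatic,
the condition is that `Hom(Q, Y) → Hom(Q, Z)` is surjective for every short exact sequence. -/
def IsProjective (Q : P.FullSubcategory) : Prop :=
  ∀ ⦃X Y Z : P.FullSubcategory⦄ (f : X ⟶ Y) (g : Y ⟶ Z), IsConflation P f g →
    ∀ t : Q ⟶ Z, ∃ s : Q ⟶ Y, s ≫ g = t

/-- Injective objects of the exact category `P`. -/
def IsInjective (J : P.FullSubcategory) : Prop :=
  ∀ ⦃X Y Z : P.FullSubcategory⦄ (f : X ⟶ Y) (g : Y ⟶ Z), IsConflation P f g →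
    ∀ t : X ⟶ J, ∃ s : Y ⟶ J, f ≫ s = t

/-- The full subcategory `P` of an abelian category, with the exact structure given by the short
exact sequences with terms in `P`, is a Frobenius category. -/
class IsFrobenius : Prop extends P.ContainsZero, P.IsClosedUnderExtensions where
  enough_projectives (X : P.FullSubcategory) :
    ∃ (K Q : P.FullSubcategory) (f : K ⟶ Q) (g : Q ⟶ X), IsConflation P f g ∧ IsProjective P Q
  enough_injectives (X : P.FullSubcategory) :
    ∃ (J W : P.FullSubcategory) (f : X ⟶ J) (g : J ⟶ W), IsConflation P f g ∧ IsInjective P J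
  projective_iff_injective (X : P.FullSubcategory) : IsProjective P X ↔ IsInjective P X

/-- Co-resolving subcategories. -/
structure IsCoresolving : Prop where
  injective_mem (J : C) : Injective J → P J
  /-- Closed under direct summands. -/
  summand_mem {X Y : C} : Retract X Y → P Y → P X
  extension_mem (S : ShortComplex C) : S.ShortExact → P S.X₁ → P S.X₃ → P S.X₂
  /-- Closed under cokernels of monomorphisms. -/
  cokernel_mem (S : ShortComplex C) : S.ShortExact → P S.X₁ → P S.X₂ → P S.X₃

/-! ### The stable category -/

/-- The morphism `f` factors through a projective object of `P`. -/
def FactorsThroughProjective {X Y : P.FullSubcategory} (f : X ⟶ Y) : Prop :=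
  ∃ (Q : P.FullSubcategory) (a : X ⟶ Q) (b : Q ⟶ Y), IsProjective P Q ∧ a ≫ b = f

/-- Two parallel morphisms are identified in the stable category if their difference factors
through a projective object. -/
def stableRel : HomRel P.FullSubcategory :=
  fun _ _ f g => FactorsThroughProjective P (f - g)

/-- The stable category `St P`: same objects, morphisms modulo those that factor through a
projective object. -/
abbrev St : Type u := CategoryTheory.Quotient (stableRel P)

/-- The canonical functor from `P` to its stable category. -/
abbrev toSt : P.FullSubcategory ⥤ St P := CategoryTheory.Quotient.functor (stableRel P)

variable {P}

lemma FactorsThroughProjective.precomp {X Y Z : P.FullSubcategory} (f : X ⟶ Y) {g : Y ⟶ Z}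
    (hg : FactorsThroughProjective P g) : FactorsThroughProjective P (f ≫ g) := by
  obtain ⟨Q, a, b, hQ, rfl⟩ := hg
  exact ⟨Q, f ≫ a, b, hQ, by simp⟩

lemma FactorsThroughProjective.postcomp {X Y Z : P.FullSubcategory} {f : X ⟶ Y} (g : Y ⟶ Z)
    (hf : FactorsThroughProjective P f) : FactorsThroughProjective P (f ≫ g) := by
  obtain ⟨Q, a, b, hQ, rfl⟩ := hf
  exact ⟨Q, a, b ≫ g, hQ, by simp⟩

lemma FactorsThroughProjective.neg {X Y : P.FullSubcategory} {f : X ⟶ Y}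
    (hf : FactorsThroughProjective P f) : FactorsThroughProjective P (-f) := by
  obtain ⟨Q, a, b, hQ, rfl⟩ := hf
  exact ⟨Q, a, -b, hQ, by simp⟩

lemma FactorsThroughProjective.zero [P.ContainsZero] (X Y : P.FullSubcategory) :
    FactorsThroughProjective P (0 : X ⟶ Y) := by
  obtain ⟨Z, hZ, hP⟩ := P.exists_prop_of_containsZero
  refine ⟨⟨Z, hP⟩, 0, 0, ?_, by simp⟩
  intro _ _ _ f g _ t
  refine ⟨0, ?_⟩
  ext
  exact hZ.eq_of_src _ _

lemma FactorsThroughProjective.add [P.IsClosedUnderExtensions] {X Y : P.FullSubcategory}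
    {f g : X ⟶ Y} (hf : FactorsThroughProjective P f) (hg : FactorsThroughProjective P g) :
    FactorsThroughProjective P (f + g) := by
  obtain ⟨Q, a, b, hQ, rfl⟩ := hf
  obtain ⟨Q', a', b', hQ', rfl⟩ := hg
  refine ⟨⟨Q.obj ⊞ Q'.obj, P.prop_biprod Q.2 Q'.2⟩,
    ObjectProperty.homMk (biprod.lift a.hom a'.hom),
    ObjectProperty.homMk (biprod.desc b.hom b'.hom), ?_, ?_⟩
  · intro U V W f g hfg t
    obtain ⟨s, hs⟩ := hQ f g hfg (ObjectProperty.homMk (biprod.inl ≫ t.hom))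
    obtain ⟨s', hs'⟩ := hQ' f g hfg (ObjectProperty.homMk (biprod.inr ≫ t.hom))
    refine ⟨ObjectProperty.homMk (biprod.desc s.hom s'.hom), ?_⟩
    have h := congrArg InducedCategory.Hom.hom hs
    have h' := congrArg InducedCategory.Hom.hom hs'
    have key : biprod.desc s.hom s'.hom ≫ g.hom = t.hom := by
      apply biprod.hom_ext'
      · simpa using h
      · simpa using h'
    exact ObjectProperty.hom_ext _ key
  · exact ObjectProperty.hom_ext _ biprod.lift_desc

variable (P)

instance stableRel_congruence [P.ContainsZero] [P.IsClosedUnderExtensions] :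
    Congruence (stableRel P) where
  equivalence :=
    { refl := fun f => by
        simpa only [stableRel, sub_self] using FactorsThroughProjective.zero _ _
      symm := fun h => by
        simpa only [stableRel, neg_sub] using FactorsThroughProjective.neg h
      trans := fun h h' => by
        simpa only [stableRel, sub_add_sub_cancel] using FactorsThroughProjective.add h h' }
  comp_left f _ _ h := by
    simpa only [stableRel, Preadditive.comp_sub] using FactorsThroughProjective.precomp f h
  comp_right g h := by
    simpa only [stableRel, Preadditive.sub_comp] using FactorsThroughProjective.postcomp g h

instance stPreadditive [P.ContainsZero] [P.IsClosedUnderExtensions] : Preadditive (St P) :=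
  Quotient.preadditive (stableRel P) (fun _ _ f₁ f₂ g₁ g₂ h h' => by
    simpa only [stableRel, add_sub_add_comm] using FactorsThroughProjective.add h h')

instance stHasZeroObject [P.ContainsZero] [P.IsClosedUnderExtensions] : HasZeroObject (St P) where
  zero := by
    have : (toSt P).Additive := Quotient.functor_additive (stableRel P) _
    obtain ⟨Z, hZ⟩ := HasZeroObject.zero (C := P.FullSubcategory)
    exact ⟨_, (toSt P).map_isZero hZ⟩

/-- The standard triangulated structure of the stable category of a Frobenius category `P`.
The suspension of `X` is the cokernel `W` of any inflation `i : X ⟶ J` into an injective object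
(`susp`), its action on morphisms is given by morphisms of such sequences (`susp_naturality`), and
the distinguished triangles are, up to isomorphism, the images `X ⟶ Y ⟶ Z ⟶ W` of the standard
triangles, i.e. those attached to morphisms of short exact sequences
```
  0 ⟶ X --f-> Y --g-> Z ⟶ 0
      ‖       |b      |h
  0 ⟶ X --i-> J --p-> W ⟶ 0
```
with `J` injective. This determines the structure up to isomorphism. -/
class StableTriangulation [IsFrobenius P] extends HasShift (St P) ℤ where
  shift_additive (n : ℤ) : (shiftFunctor (St P) n).Additive
  pretriangulated : Pretriangulated (St P)
  isTriangulated : CategoryTheory.IsTriangulated (St P)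
  susp {X J W : P.FullSubcategory} (i : X ⟶ J) (p : J ⟶ W) :
    IsConflation P i p → IsInjective P J → ((toSt P).obj W ≅ ((toSt P).obj X)⟦(1 : ℤ)⟧)
  susp_naturality {X J W X' J' W' : P.FullSubcategory} (i : X ⟶ J) (p : J ⟶ W)
    (i' : X' ⟶ J') (p' : J' ⟶ W') (h : IsConflation P i p) (hJ : IsInjective P J)
    (h' : IsConflation P i' p') (hJ' : IsInjective P J')
    (a : X ⟶ X') (b : J ⟶ J') (c : W ⟶ W') :
    i ≫ b = a ≫ i' → p ≫ c = b ≫ p' →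
      (toSt P).map c ≫ (susp i' p' h' hJ').hom =
        (susp i p h hJ).hom ≫ ((toSt P).map a)⟦(1 : ℤ)⟧'
  distinguished_iff (T : Pretriangulated.Triangle (St P)) :
    T ∈ pretriangulated.distinguishedTriangles ↔
      ∃ (X Y Z J W : P.FullSubcategory) (f : X ⟶ Y) (g : Y ⟶ Z) (i : X ⟶ J) (p : J ⟶ W)
        (b : Y ⟶ J) (h : Z ⟶ W) (_ : IsConflation P f g) (hip : IsConflation P i p)
        (hJ : IsInjective P J), f ≫ b = i ∧ g ≫ h = b ≫ p ∧
        Nonempty (T ≅ Pretriangulated.Triangle.mk ((toSt P).map f) ((toSt P).map g)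
          ((toSt P).map h ≫ (susp i p hip hJ).hom))

attribute [reducible] StableTriangulation.pretriangulated

attribute [instance] StableTriangulation.shift_additive StableTriangulation.pretriangulated
  StableTriangulation.isTriangulated

/-- `F'` is the functor between stable categories induced by `F`. -/
def Induces {P : ObjectProperty C} {D : Type u₁} [Category.{v₁} D] [Abelian D] {P' : ObjectProperty D}
    (F : P.FullSubcategory ⥤ P'.FullSubcategory) (F' : St P ⥤ St P') : Prop :=
  toSt P ⋙ F' = F ⋙ toSt P'

end Exact

/-! ### Recollements of triangulated categories -/

section Recollement

/-- `F` is a triangulated functor, for some isomorphisms of commutation with the shifts. -/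
def IsTriangulatedFunctor {C : Type u₁} {D : Type u₂} [Category.{v₁} C] [Category.{v₂} D]
    [HasZeroObject C] [HasZeroObject D] [Preadditive C] [Preadditive D]
    [HasShift C ℤ] [HasShift D ℤ]
    [∀ n : ℤ, (shiftFunctor C n).Additive] [∀ n : ℤ, (shiftFunctor D n).Additive]
    [Pretriangulated C] [Pretriangulated D] (F : C ⥤ D) : Prop :=
  ∃ _ : F.CommShift ℤ, F.IsTriangulated

/-- A recollement of triangulated categories in the sense of Beilinson, Bernstein and Deligne:
`T'` on the left, `T` in the middle, `T''` on the right, with `i^* ⊣ i_* ⊣ i^!` on the left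
side and `j_! ⊣ j^* ⊣ j_*` on the right side. -/
structure Recollement {T' : Type u₁} {T : Type u₂} {T'' : Type u₃}
    [Category.{v₁} T'] [Category.{v₂} T] [Category.{v₃} T'']
    [HasZeroObject T'] [HasZeroObject T] [HasZeroObject T'']
    [Preadditive T'] [Preadditive T] [Preadditive T'']
    [HasShift T' ℤ] [HasShift T ℤ] [HasShift T'' ℤ]
    [∀ n : ℤ, (shiftFunctor T' n).Additive] [∀ n : ℤ, (shiftFunctor T n).Additive]
    [∀ n : ℤ, (shiftFunctor T'' n).Additive]
    [Pretriangulated T'] [Pretriangulated T] [Pretriangulated T'']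
    (iUpperStar : T ⥤ T') (iLowerStar : T' ⥤ T) (iUpperShriek : T ⥤ T')
    (jLowerShriek : T'' ⥤ T) (jUpperStar : T ⥤ T'') (jLowerStar : T'' ⥤ T) where
  iUpperStar_triangulated : IsTriangulatedFunctor iUpperStar
  iLowerStar_triangulated : IsTriangulatedFunctor iLowerStar
  iUpperShriek_triangulated : IsTriangulatedFunctor iUpperShriek
  jLowerShriek_triangulated : IsTriangulatedFunctor jLowerShriek
  jUpperStar_triangulated : IsTriangulatedFunctor jUpperStar
  jLowerStar_triangulated : IsTriangulatedFunctor jLowerStar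
  adj₁ : iUpperStar ⊣ iLowerStar
  adj₂ : iLowerStar ⊣ iUpperShriek
  adj₃ : jLowerShriek ⊣ jUpperStar
  adj₄ : jUpperStar ⊣ jLowerStar
  iLowerStar_fullyFaithful : iLowerStar.Full ∧ iLowerStar.Faithful
  jLowerShriek_fullyFaithful : jLowerShriek.Full ∧ jLowerShriek.Faithful
  jLowerStar_fullyFaithful : jLowerStar.Full ∧ jLowerStar.Faithful
  comp_isZero (X : T') : IsZero (jUpperStar.obj (iLowerStar.obj X))
  /-- The triangle `j_! j^* X ⟶ X ⟶ i_* i^* X ⟶ (j_! j^* X)[1]`. -/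
  triangle₁ (X : T) :
    ∃ δ : iLowerStar.obj (iUpperStar.obj X) ⟶ (jLowerShriek.obj (jUpperStar.obj X))⟦(1 : ℤ)⟧,
      Pretriangulated.Triangle.mk (adj₃.counit.app X) (adj₁.unit.app X) δ ∈
        Pretriangulated.distinguishedTriangles
  /-- The triangle `i_* i^! X ⟶ X ⟶ j_* j^* X ⟶ (i_* i^! X)[1]`. -/
  triangle₂ (X : T) :
    ∃ δ : jLowerStar.obj (jUpperStar.obj X) ⟶ (iLowerStar.obj (iUpperShriek.obj X))⟦(1 : ℤ)⟧,
      Pretriangulated.Triangle.mk (adj₂.counit.app X) (adj₄.unit.app X) δ ∈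
        Pretriangulated.distinguishedTriangles

end Recollement

/-! ### The category of triples `(X, Y)_φ` -/

section Hom

variable (A B M : Type w) [Ring A] [Ring B] [AddCommGroup M] [Module A M] [Module Bᵐᵒᵖ M]
  [SMulCommClass A Bᵐᵒᵖ M]

/-- `Hom_A(M, X)` for an `(A, B)`-bimodule `M` and a left `A`-module `X`. -/
def BimoduleHom (_B : Type w) (X : Type w) [AddCommGroup X] [Module A X] : Type w := M →ₗ[A] X

instance (X : Type w) [AddCommGroup X] [Module A X] : AddCommGroup (BimoduleHom A M B X) :=
  inferInstanceAs (AddCommGroup (M →ₗ[A] X))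

/-- The left `B`-module structure of `Hom_A(M, X)`: `(b • f) m = f (m b)`. -/
instance (X : Type w) [AddCommGroup X] [Module A X] : Module B (BimoduleHom A M B X) where
  smul b f :=
    { toFun := fun m => (show M →ₗ[A] X from f) (MulOpposite.op b • m)
      map_add' := fun m m' => by rw [smul_add, map_add]
      map_smul' := fun a m => by rw [← smul_comm a (MulOpposite.op b) m, map_smul]; rfl }
  one_smul f := LinearMap.ext fun m =>
    congrArg (show M →ₗ[A] X from f) (one_smul Bᵐᵒᵖ m)
  mul_smul b c f := LinearMap.ext fun m =>
    congrArg (show M →ₗ[A] X from f) (mul_smul (MulOpposite.op c) (MulOpposite.op b) m)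
  smul_zero b := LinearMap.ext fun m => rfl
  smul_add b f g := LinearMap.ext fun m => rfl
  add_smul b c f := LinearMap.ext fun m =>
    (congrArg (show M →ₗ[A] X from f)
      (add_smul (MulOpposite.op b) (MulOpposite.op c) m)).trans (map_add _ _ _)
  zero_smul f := LinearMap.ext fun m =>
    (congrArg (show M →ₗ[A] X from f) (zero_smul Bᵐᵒᵖ m)).trans (map_zero _)

/-- The functor `Hom_A(M, -)` from left `A`-modules to left `B`-modules. -/
def homFunctor : ModuleCat.{w} A ⥤ ModuleCat.{w} B where
  obj X := ModuleCat.of B (BimoduleHom A M B X)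
  map {X X'} f := ModuleCat.ofHom
    (X := BimoduleHom A M B X) (Y := BimoduleHom A M B X')
    { toFun := fun g => f.hom.comp (show M →ₗ[A] X from g)
      map_add' := fun g g' => LinearMap.comp_add _ _ _
      map_smul' := fun b g => rfl }

instance homFunctor_additive : (homFunctor A B M).Additive where
  map_add := by
    intros
    rfl

instance homFunctor_preservesFiniteLimits : PreservesFiniteLimits (homFunctor A B M) := by
  have h := ((homFunctor A B M).preservesFiniteLimits_tfae.out 0 3)
  refine h.1 fun S hS => ?_
  have hm : Function.Injective S.f.hom := (ModuleCat.mono_iff_injective _).1 hS.mono_f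
  have he := (ShortComplex.ShortExact.moduleCat_exact_iff_function_exact S).1 hS.exact
  constructor
  · rw [ShortComplex.moduleCat_exact_iff]
    intro (g : M →ₗ[A] S.X₂) hg
    have hr : ∀ m, g m ∈ LinearMap.range S.f.hom := fun m =>
      (he (g m)).1 (LinearMap.congr_fun (show S.g.hom.comp g = 0 from hg) m)
    let e := LinearEquiv.ofInjective S.f.hom hm
    refine ⟨(show M →ₗ[A] S.X₁ from e.symm.toLinearMap.comp (g.codRestrict _ hr)), ?_⟩
    refine LinearMap.ext fun m => ?_
    exact congrArg Subtype.val (e.apply_symm_apply ⟨g m, hr m⟩)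
  · rw [ModuleCat.mono_iff_injective]
    intro (g : M →ₗ[A] S.X₁) (g' : M →ₗ[A] S.X₁) hg
    exact LinearMap.ext fun m =>
      hm (LinearMap.congr_fun (show S.f.hom.comp g = S.f.hom.comp g' from hg) m)

/-- The category of triples `(X, Y)_φ` with `φ : Y ⟶ Hom_A(M, X)`; for `U : RepH A B M` the
components are `X = U.right`, `Y = U.left` and `φ = U.hom`. -/
abbrev RepH := Comma (𝟭 (ModuleCat.{w} B)) (homFunctor A B M)

instance repH_fst_preservesFiniteLimits :
    PreservesFiniteLimits (Comma.fst (𝟭 (ModuleCat.{w} B)) (homFunctor A B M)) where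
  preservesFiniteLimits _ _ _ := ⟨fun {_} => preservesLimit_of_preserves_limit_cone
    (Comma.coneOfPreservesIsLimit _ (limit.isLimit _) (limit.isLimit _)) (limit.isLimit _)⟩

instance repH_snd_preservesFiniteLimits :
    PreservesFiniteLimits (Comma.snd (𝟭 (ModuleCat.{w} B)) (homFunctor A B M)) where
  preservesFiniteLimits _ _ _ := ⟨fun {_} => preservesLimit_of_preserves_limit_cone
    (Comma.coneOfPreservesIsLimit _ (limit.isLimit _) (limit.isLimit _)) (limit.isLimit _)⟩

instance repH_hasFiniteProducts : HasFiniteProducts (RepH A B M) :=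
  hasFiniteProducts_of_hasFiniteLimits _

instance repH_isIso_coimageImageComparison {U V : RepH A B M} (f : U ⟶ V) :
    IsIso (Abelian.coimageImageComparison f) := by
  have h₁ : IsIso ((Comma.fst _ _).map (Abelian.coimageImageComparison f)) :=
    (Arrow.isIso_iff_isIso_of_isIso (Abelian.PreservesCoimageImageComparison.iso
      (Comma.fst _ _) f).hom).2 inferInstance
  have h₂ : IsIso ((Comma.snd _ _).map (Abelian.coimageImageComparison f)) :=
    (Arrow.isIso_iff_isIso_of_isIso (Abelian.PreservesCoimageImageComparison.iso
      (Comma.snd _ _) f).hom).2 inferInstance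
  exact (Comma.isoMk (@asIso _ _ _ _ _ h₁) (@asIso _ _ _ _ _ h₂)
    (Abelian.coimageImageComparison f).w).isIso_hom

/-- The category of triples is abelian. -/
instance repHAbelian : Abelian (RepH A B M) := Abelian.ofCoimageImageComparisonIsIso

end Hom

section Triples

open scoped ZeroObject

variable {A B M : Type w} [Ring A] [Ring B] [AddCommGroup M] [Module A M] [Module Bᵐᵒᵖ M]
  [SMulCommClass A Bᵐᵒᵖ M]

/-- The triple `(X, Y)_φ`. -/
abbrev triple (X : ModuleCat.{w} A) (Y : ModuleCat.{w} B) (φ : Y ⟶ (homFunctor A B M).obj X) :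
    RepH A B M where
  left := Y
  right := X
  hom := φ

variable (M) in
/-- The full subcategory `ℰ(𝒳, M, 𝒴)` of triples `(X, Y)_φ` with `X` in `𝒳`, `Ker φ` in `𝒴` and
`φ` surjective. -/
def tripleProp (𝒳 : ObjectProperty (ModuleCat.{w} A)) (𝒴 : ObjectProperty (ModuleCat.{w} B)) :
    ObjectProperty (RepH A B M) :=
  fun U => 𝒳 U.right ∧ 𝒴 (kernel U.hom) ∧ Function.Surjective U.hom.hom

variable {𝒳 : ObjectProperty (ModuleCat.{w} A)} {𝒴 : ObjectProperty (ModuleCat.{w} B)}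

lemma tripleProp_q [𝒳.IsClosedUnderIsomorphisms] [𝒳.ContainsZero]
    [𝒴.IsClosedUnderIsomorphisms] {Y : ModuleCat.{w} B} (hY : 𝒴 Y) :
    tripleProp M 𝒳 𝒴 (triple 0 Y 0) := by
  have hz : IsZero ((homFunctor A B M).obj 0) := (homFunctor A B M).map_isZero (isZero_zero _)
  refine ⟨𝒳.prop_zero, 𝒴.prop_of_iso kernelZeroIsoSource.symm hY, ?_⟩
  exact (ModuleCat.epi_iff_surjective _).1 ⟨fun _ _ _ => hz.eq_of_src _ _⟩

lemma tripleProp_p [𝒴.IsClosedUnderIsomorphisms] [𝒴.ContainsZero]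
    {X : ModuleCat.{w} A} (hX : 𝒳 X) : tripleProp M 𝒳 𝒴 (triple X _ (𝟙 _)) :=
  ⟨hX, 𝒴.prop_of_isZero (isZero_kernel_of_mono _), Function.surjective_id⟩

lemma tripleProp_left [𝒴.IsClosedUnderExtensions]
    (hHom : ∀ X, 𝒳 X → 𝒴 ((homFunctor A B M).obj X)) {U : RepH A B M}
    (hU : tripleProp M 𝒳 𝒴 U) : 𝒴 U.left := by
  have hepi : Epi U.hom := (ModuleCat.epi_iff_surjective _).2 hU.2.2
  exact 𝒴.prop_X₂_of_shortExact
    (S := ShortComplex.mk (kernel.ι U.hom) U.hom (kernel.condition _))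
    { exact := ShortComplex.exact_kernel _, mono_f := inferInstance, epi_g := hepi } hU.2.1
    (hHom _ hU.1)

variable (M 𝒳 𝒴)

/-- `𝐩 : 𝒳 ⥤ ℰ(𝒳, M, 𝒴)`, `X ↦ (X, Hom_A(M, X))_1`, `f ↦ (f, Hom_A(M, f))`. -/
def functorP [𝒴.IsClosedUnderIsomorphisms] [𝒴.ContainsZero] :
    𝒳.FullSubcategory ⥤ (tripleProp M 𝒳 𝒴).FullSubcategory where
  obj X := ⟨triple X.obj _ (𝟙 _), tripleProp_p X.2⟩
  map f := ObjectProperty.homMk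
    { left := (homFunctor A B M).map f.hom
      right := f.hom }

/-- `𝐪 : 𝒴 ⥤ ℰ(𝒳, M, 𝒴)`, `Y ↦ (0, Y)_0`, `g ↦ (0, g)`. -/
def functorQ [𝒳.IsClosedUnderIsomorphisms] [𝒳.ContainsZero] [𝒴.IsClosedUnderIsomorphisms] :
    𝒴.FullSubcategory ⥤ (tripleProp M 𝒳 𝒴).FullSubcategory where
  obj Y := ⟨triple 0 Y.obj 0, tripleProp_q Y.2⟩
  map g := ObjectProperty.homMk
    { left := g.hom
      right := 𝟙 0 }

/-- `𝐏 : ℰ(𝒳, M, 𝒴) ⥤ 𝒳`, `(X, Y)_φ ↦ X`, `(f, g) ↦ f`. -/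
def projX : (tripleProp M 𝒳 𝒴).FullSubcategory ⥤ 𝒳.FullSubcategory where
  obj U := ⟨U.obj.right, U.2.1⟩
  map f := ObjectProperty.homMk f.hom.right

/-- `𝐐 : ℰ(𝒳, M, 𝒴) ⥤ 𝒴`, `(X, Y)_φ ↦ Y`, `(f, g) ↦ g`; it takes its values in `𝒴` when
`Hom_A(M, 𝒳) ⊆ 𝒴` and `𝒴` is closed under extensions. -/
def projY [𝒴.IsClosedUnderExtensions] (hHom : ∀ X, 𝒳 X → 𝒴 ((homFunctor A B M).obj X)) :
    (tripleProp M 𝒳 𝒴).FullSubcategory ⥤ 𝒴.FullSubcategory where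
  obj U := ⟨U.obj.left, tripleProp_left hHom U.2⟩
  map f := ObjectProperty.homMk f.hom.left

/-- `ℚ : ℰ(𝒳, M, 𝒴) ⥤ 𝒴`, `(X, Y)_φ ↦ Ker φ`, with `(f, g)` sent to the restriction of `g`. -/
def kerY : (tripleProp M 𝒳 𝒴).FullSubcategory ⥤ 𝒴.FullSubcategory where
  obj U := ⟨kernel U.obj.hom, U.2.2.1⟩
  map {U V} f := ObjectProperty.homMk
    (kernel.map U.obj.hom V.obj.hom f.hom.left ((homFunctor A B M).map f.hom.right)
      f.hom.w.symm)
  map_id U := by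
    apply ObjectProperty.hom_ext
    apply (cancel_mono (kernel.ι U.obj.hom)).1
    simp
  map_comp {U V W} f g := by
    apply ObjectProperty.hom_ext
    apply (cancel_mono (kernel.ι W.obj.hom)).1
    simp

end Triples

end StableRecollement

end

/-! Everything rests on the adjunctions 𝐐 ⊣ 𝐪 ⊣ ℚ and 𝐏 ⊣ 𝐩 between exact functors, and on the short
exact sequence 0 → 𝐪ℚU → U → 𝐩𝐏U → 0 (`isConflation_counit_unit`). Exactness of ℚ is a snake
argument using that φ is surjective (`shortExact_kernelMap`). Exactness of 𝐩 comes from the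
co-resolving hypothesis: it makes Hom_A(M, -) exact on short exact sequences whose left term is in 𝒳
(`epi_homFunctor_map`).

Frobenius property. Left adjoints of exact functors preserve projectives, right adjoints preserve
injectives, and in a co-resolving subcategory the relative injectives are the ambient ones
(`IsCoresolving.isInjective_iff`). If ℰ is Frobenius, projective covers of 𝐪Y and 𝐩X therefore
descend to 𝒴 and 𝒳 (`isFrobenius_left`, `isFrobenius_right`). Conversely, every object of ℰ is
covered by some (0, K) ⊕ (X, Hom_A(M, X)) with K and X projective-injective, and this sum is itself
projective and injective (`isFrobenius_tripleProp`).

Stable categories. For a Frobenius category the suspension is an auto-equivalence. It is turned into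
an action of ℤ by passing to sequences of objects on which shifting indices is strictly associative.
The axioms are then checked on short exact sequences, as in Happel's theorem. An exact functor
preserving projectives induces a triangulated functor (`isTriangulatedFunctor_stFunctor`),
adjunctions descend (`stAdjunction`), and the second triangle of the recollement is the image of the
sequence above.

The functor 𝐣 only exists stably. Choose a projective Q with a deflation Q → Hom_A(M, X). Stable
morphisms out of a triple with projective second component are the same as stable morphisms between
first components (`stProjX_map_bijective`), so X ↦ (X, Q) is left adjoint to the functor induced by
𝐏. For W = (𝐏U, Q) and c : W → U over the identity, the sequence 0 → W → U ⊕ 𝐪𝐐W → 𝐪𝐐U → 0 is exact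
with 𝐪𝐐W projective, which gives the first triangle (`exists_distinguished_unit`). -/

open CategoryTheory CategoryTheory.Limits

noncomputable section

namespace StableRecollement

/-! ### The shift by `ℤ` attached to an auto-equivalence -/

section IntChain

/-- A compatible family along a chain of bijections indexed by `ℤ`, with given term of index `0`. -/
def intChain {H : ℤ → Type*} (e : ∀ n, H n ≃ H (n + 1)) (x : H 0) : ∀ n, H n
  | .ofNat n => Nat.rec (motive := fun n => H (.ofNat n)) x (fun n y => e (.ofNat n) y) n
  | .negSucc n => Nat.rec (motive := fun n => H (.negSucc n)) ((e (.negSucc 0)).symm x)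
      (fun n y => (e (.negSucc (n + 1))).symm y) n

lemma intChain_succ {H : ℤ → Type*} (e : ∀ n, H n ≃ H (n + 1)) (x : H 0) (n : ℤ) :
    e n (intChain e x n) = intChain e x (n + 1) := by
  rcases n with n | n
  · rfl
  -- Terms of negative index are defined by inverse bijections. Index -1 is separate because its
  -- successor is the given term of index 0.
  · rcases n with _ | n
    · exact (e (.negSucc 0)).apply_symm_apply x
    · exact (e (.negSucc (n + 1))).apply_symm_apply _

/-- Induction upwards uses the recursion, downwards the injectivity of the bijections. This rigidity
gives both the faithfulness of evaluation on spectra and the additivity of commutation isomorphisms.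
-/
lemma intChain_unique {H : ℤ → Type*} (e : ∀ n, H n ≃ H (n + 1)) (y z : ∀ n, H n)
    (hy : ∀ n, e n (y n) = y (n + 1)) (hz : ∀ n, e n (z n) = z (n + 1)) (h : y 0 = z 0) (n : ℤ) :
    y n = z n := by
  induction n using Int.induction_on with
  | zero => exact h
  | succ n ih => rw [← hy, ← hz, ih]
  | pred n ih =>
    apply (e _).injective
    rw [hy, hz]
    convert ih using 2 <;> omega

end IntChain

section Spectrum

variable {C : Type u} [Category.{v} C]

/-- A sequence of objects indexed by `ℤ`, each identified to the image by `S` of the previous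
one. -/
structure Spectrum (S : C ⥤ C) where
  obj : ℤ → C
  iso : ∀ n m : ℤ, n + 1 = m → (S.obj (obj n) ≅ obj m)

namespace Spectrum

variable {S : C ⥤ C}

/-- Morphisms of spectra. -/
@[ext]
structure Hom (X Y : Spectrum S) where
  app : ∀ n, X.obj n ⟶ Y.obj n
  comm : ∀ n m (h : n + 1 = m), S.map (app n) ≫ (Y.iso n m h).hom = (X.iso n m h).hom ≫ app m

attribute [simp] Hom.comm

@[simp]
lemma Hom.comm_assoc {X Y : Spectrum S} (f : Hom X Y) (n m : ℤ) (h : n + 1 = m) {Z : C}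
    (k : Y.obj m ⟶ Z) :
    S.map (f.app n) ≫ (Y.iso n m h).hom ≫ k = (X.iso n m h).hom ≫ f.app m ≫ k := by
  rw [← Category.assoc, f.comm, Category.assoc]

@[simps]
instance : Category (Spectrum S) where
  Hom := Hom
  id X := { app := fun _ => 𝟙 _, comm := by simp }
  comp f g := { app := fun n => f.app n ≫ g.app n, comm := by simp }

@[ext]
lemma hom_ext {X Y : Spectrum S} (f g : X ⟶ Y) (h : ∀ n, f.app n = g.app n) : f = g :=
  Hom.ext (funext h)

/-- Reindexing of spectra. -/
@[simps]
def reindex (s : ℤ → ℤ) (hs : ∀ n m, n + 1 = m → s n + 1 = s m) : Spectrum S ⥤ Spectrum S where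
  obj X := { obj := fun n => X.obj (s n), iso := fun n m h => X.iso (s n) (s m) (hs n m h) }
  map f := { app := fun n => f.app (s n), comm := fun _ _ _ => f.comm _ _ _ }

/-- Equal index functions give equal functors, so all coherences of the shift become identities
between `eqToHom`. -/
lemma reindex_congr {s s' : ℤ → ℤ} (h : s = s') (hs : ∀ n m, n + 1 = m → s n + 1 = s m)
    (hs' : ∀ n m, n + 1 = m → s' n + 1 = s' m) :
    (reindex s hs : Spectrum S ⥤ _) = reindex s' hs' := by
  subst h
  rfl

/-- The shift of spectra. -/
abbrev shift (a : ℤ) : Spectrum S ⥤ Spectrum S :=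
  reindex (fun n => n + a) (fun _ _ _ => by omega)

lemma shift_zero : (shift 0 : Spectrum S ⥤ _) = 𝟭 _ :=
  (reindex_congr (s' := fun n => n) (funext fun n => add_zero n) _ (fun _ _ h => h)).trans rfl

lemma shift_add (a b : ℤ) : (shift (a + b) : Spectrum S ⥤ _) = shift a ⋙ shift b :=
  (reindex_congr (s' := fun n => n + b + a) (funext fun n => by omega) _
    (fun _ _ _ => by omega)).trans rfl

/-- Translation of indices is additive on the nose, whereas powers of `S` on `C` are so only up to
isomorphism. This is the reason for introducing spectra. -/
instance hasShift : HasShift (Spectrum S) ℤ := hasShiftMk _ _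
  { F := shift
    zero := eqToIso shift_zero
    add a b := eqToIso (shift_add a b)
    assoc_hom_app _ _ _ _ := by simp only [eqToIso.hom, eqToHom_app, eqToHom_map, eqToHom_trans]
    zero_add_hom_app _ _ := by
      simp only [eqToIso.hom, eqToIso.inv, eqToHom_app, eqToHom_map, eqToHom_trans]
    add_zero_hom_app _ _ := by
      simp only [eqToIso.hom, eqToIso.inv, eqToHom_app, eqToHom_trans] }

/-- The term of index `0`. -/
@[simps]
def eval (S : C ⥤ C) : Spectrum S ⥤ C where
  obj X := X.obj 0
  map f := f.app 0

variable [S.IsEquivalence]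

/-- Morphisms between consecutive terms of two spectra correspond. -/
def homEquiv (X Y : Spectrum S) (n : ℤ) :
    (X.obj n ⟶ Y.obj n) ≃ (X.obj (n + 1) ⟶ Y.obj (n + 1)) :=
  (Functor.FullyFaithful.ofFullyFaithful S).homEquiv.trans
    (Iso.homCongr (X.iso n _ rfl) (Y.iso n _ rfl))

lemma homEquiv_apply (X Y : Spectrum S) (n : ℤ) (f : X.obj n ⟶ Y.obj n) :
    homEquiv X Y n f = (X.iso n _ rfl).inv ≫ S.map f ≫ (Y.iso n _ rfl).hom := rfl

/-- A morphism of spectra is a chain compatible with `homEquiv`, hence determined by its term of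
index 0. Fullness extends any such term to a chain. -/
instance : (eval S).Faithful where
  map_injective {X Y f g} h := by
    ext n
    exact intChain_unique (homEquiv X Y) f.app g.app (by simp [homEquiv_apply])
      (by simp [homEquiv_apply]) h n

instance : (eval S).Full where
  map_surjective {X Y} f := by
    refine ⟨{ app := intChain (homEquiv X Y) f, comm := ?_ }, rfl⟩
    rintro n _ rfl
    have h := intChain_succ (homEquiv X Y) f n
    rw [homEquiv_apply, Iso.inv_comp_eq] at h
    exact h

/-- The iterates of an equivalence and of its inverse, applied to an object. -/
def iterate (S : C ⥤ C) [S.IsEquivalence] (X : C) : ℤ → C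
  | .ofNat n => Nat.rec (motive := fun _ => C) X (fun _ Y => S.obj Y) n
  | .negSucc n => Nat.rec (motive := fun _ => C) (S.inv.obj X) (fun _ Y => S.inv.obj Y) n

/-- The identification of consecutive iterates. -/
def iterateIso (X : C) : ∀ n, S.obj (iterate S X n) ≅ iterate S X (n + 1)
  | .ofNat _ => Iso.refl _
  | .negSucc 0 => S.asEquivalence.counitIso.app X
  | .negSucc (n + 1) => S.asEquivalence.counitIso.app (iterate S X (.negSucc n))

instance : (eval S).EssSurj where
  mem_essImage X :=
    ⟨{ obj := iterate S X
       iso := fun n m h => iterateIso X n ≪≫ eqToIso (by rw [h]) }, ⟨Iso.refl _⟩⟩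

instance : (eval S).IsEquivalence where

end Spectrum

variable (S : C ⥤ C) [S.IsEquivalence]

/-- The powers of the equivalence `S`. -/
def shiftPower (a : ℤ) : C ⥤ C :=
  (Spectrum.eval S).inv ⋙ shiftFunctor (Spectrum S) a ⋙ Spectrum.eval S

/-- The shift by `ℤ` on a category attached to an auto-equivalence. -/
@[reducible]
def shiftOfEquivalence : HasShift C ℤ :=
  -- Evaluation at 0 is an equivalence, so the strict shift of spectra is transported along it.
  HasShift.induced (Spectrum.eval S) ℤ (shiftPower S) (fun _ =>
    (Functor.associator _ _ _).symm ≪≫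
      Functor.isoWhiskerRight (Spectrum.eval S).asEquivalence.unitIso.symm _ ≪≫
      Functor.leftUnitor _)

/-- The shift by `1` is the given auto-equivalence. -/
def shiftOfEquivalenceOneIso :
    letI := shiftOfEquivalence S
    S ≅ shiftFunctor C (1 : ℤ) :=
  (Functor.leftUnitor _).symm ≪≫
    Functor.isoWhiskerRight (Spectrum.eval S).asEquivalence.counitIso.symm S ≪≫
    Functor.associator _ _ _ ≪≫
    Functor.isoWhiskerLeft (Spectrum.eval S).inv
      -- The structure isomorphism from the image under `S` of the term of index 0 to the term of
      -- index 1, which is the zeroth term of the shifted spectrum.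
      (NatIso.ofComponents (fun X => X.iso 0 (0 + 1) rfl) (fun f => f.comm _ _ _) :
        Spectrum.eval S ⋙ S ≅ shiftFunctor (Spectrum S) (1 : ℤ) ⋙ Spectrum.eval S)

end Spectrum

/-! ### Functors commuting with the shift by `1` -/

section CommShiftOne

open Functor

variable {C : Type u₁} {D : Type u₂} [Category.{v₁} C] [Category.{v₂} D]
  [HasShift C ℤ] [HasShift D ℤ] {F : C ⥤ D}
  (e : shiftFunctor C (1 : ℤ) ⋙ F ≅ F ⋙ shiftFunctor D (1 : ℤ))

/-- Commutation isomorphisms with the shifts by `n` and by `n + 1` correspond. -/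
def commShiftSuccEquiv {n m : ℤ} (h : n + 1 = m) :
    (shiftFunctor C n ⋙ F ≅ F ⋙ shiftFunctor D n) ≃
      (shiftFunctor C m ⋙ F ≅ F ⋙ shiftFunctor D m) :=
  Equiv.ofBijective (fun x => CommShift.isoAdd' h x e) (by
    -- The assignment shifts the given isomorphism by 1 and composes it with fixed isomorphisms, so
    -- bijectivity is full faithfulness of the shift by 1.
    constructor
    · intro x y hxy
      ext X
      have := congr_app (congrArg Iso.hom hxy) X
      simp only [CommShift.isoAdd'_hom_app] at this
      rw [cancel_epi, cancel_epi, cancel_mono] at this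
      exact (shiftFunctor D (1 : ℤ)).map_injective this
    · intro y
      refine ⟨((FullyFaithful.ofFullyFaithful (shiftFunctor D (1 : ℤ))).whiskeringRight
        C).preimageIso (Functor.associator _ _ _ ≪≫ isoWhiskerLeft _ e.symm ≪≫
          (Functor.associator _ _ _).symm ≪≫ isoWhiskerRight (shiftFunctorAdd' C _ _ _ h).symm F ≪≫
          y ≪≫ isoWhiskerLeft _ (shiftFunctorAdd' D _ _ _ h) ≪≫ (Functor.associator _ _ _).symm), ?_⟩
      ext X
      have key := congr_app (((FullyFaithful.ofFullyFaithful
        (shiftFunctor D (1 : ℤ))).whiskeringRight C).map_preimage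
          (Functor.associator _ _ _ ≪≫ isoWhiskerLeft _ e.symm ≪≫
          (Functor.associator _ _ _).symm ≪≫ isoWhiskerRight (shiftFunctorAdd' C _ _ _ h).symm F ≪≫
          y ≪≫ isoWhiskerLeft _ (shiftFunctorAdd' D _ _ _ h) ≪≫ (Functor.associator _ _ _).symm).hom) X
      dsimp at key
      simp only [CommShift.isoAdd'_hom_app]
      erw [key]
      simp [← F.map_comp_assoc])

lemma commShiftSuccEquiv_apply {n m : ℤ} (h : n + 1 = m)
    (x : shiftFunctor C n ⋙ F ≅ F ⋙ shiftFunctor D n) :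
    commShiftSuccEquiv e h x = CommShift.isoAdd' h x e := rfl

/-- The commutation isomorphisms with all shifts deduced from that with the shift by `1`. -/
def commShiftIsoOfOne (n : ℤ) : shiftFunctor C n ⋙ F ≅ F ⋙ shiftFunctor D n :=
  intChain (H := fun n => shiftFunctor C n ⋙ F ≅ F ⋙ shiftFunctor D n)
    (fun _ => commShiftSuccEquiv e rfl) (CommShift.isoZero F ℤ) n

lemma commShiftIsoOfOne_succ {n m : ℤ} (h : n + 1 = m) :
    CommShift.isoAdd' h (commShiftIsoOfOne e n) e = commShiftIsoOfOne e m := by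
  subst h
  exact intChain_succ (H := fun n => shiftFunctor C n ⋙ F ≅ F ⋙ shiftFunctor D n)
    (fun _ => commShiftSuccEquiv e rfl) (CommShift.isoZero F ℤ) n

/-- The initial term in the induction on the second index which proves additivity. -/
lemma commShiftIsoOfOne_add_zero {a c : ℤ} (h : a + 0 = c) :
    CommShift.isoAdd' h (commShiftIsoOfOne e a) (commShiftIsoOfOne e 0) =
      commShiftIsoOfOne e c := by
  obtain rfl : a = c := by omega
  exact CommShift.isoAdd'_isoZero _

lemma commShiftIsoOfOne_one : commShiftIsoOfOne e 1 = e :=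
  (commShiftIsoOfOne_succ e (zero_add 1)).symm.trans (CommShift.isoZero_isoAdd'_ e)

/-- A functor commuting with the shift by `1` commutes with the shift by `ℤ`. -/
@[reducible]
def commShiftOfOne : F.CommShift ℤ where
  commShiftIso := commShiftIsoOfOne e
  commShiftIso_zero := rfl
  commShiftIso_add a b := by
    -- For fixed `a`, both sides are families in `b` compatible with the same bijections, and they
    -- agree at 0. The associativity of `isoAdd'` gives the compatibility of the composite family.
    refine intChain_unique (H := fun b => shiftFunctor C (a + b) ⋙ F ≅ F ⋙ shiftFunctor D (a + b))
      (fun b => commShiftSuccEquiv e (by omega)) (fun b => commShiftIsoOfOne e (a + b))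
      (fun b => CommShift.isoAdd' rfl (commShiftIsoOfOne e a) (commShiftIsoOfOne e b))
      (fun b => commShiftIsoOfOne_succ e _) (fun b => ?_)
      (commShiftIsoOfOne_add_zero e rfl).symm b
    rw [commShiftSuccEquiv_apply, CommShift.isoAdd'_assoc (hbc := rfl) (h := by omega),
      commShiftIsoOfOne_succ]

end CommShiftOne

/-! ### Short exact sequences in abelian categories -/

section Abelian

variable {C : Type u} [Category.{v} C] [Abelian C]

/-- Exactness tested on generalized elements, up to epimorphic refinement of their source. All
diagram chases below take this form. -/
lemma shortExact_of_refinements {X Y Z : C} (f : X ⟶ Y) (g : Y ⟶ Z) (zero : f ≫ g = 0)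
    (hf : ∀ ⦃T : C⦄ (t : T ⟶ X), t ≫ f = 0 → t = 0)
    (hfg : ∀ ⦃T : C⦄ (t : T ⟶ Y), t ≫ g = 0 →
      ∃ (T' : C) (r : T' ⟶ T) (_ : Epi r) (s : T' ⟶ X), r ≫ t = s ≫ f)
    (hg : ∀ ⦃T : C⦄ (t : T ⟶ Z),
      ∃ (T' : C) (r : T' ⟶ T) (_ : Epi r) (s : T' ⟶ Y), r ≫ t = s ≫ g) :
    (ShortComplex.mk f g zero).ShortExact where
  exact := (ShortComplex.exact_iff_exact_up_to_refinements _).2 hfg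
  mono_f := Preadditive.mono_of_cancel_zero _ (fun t ht => hf t ht)
  epi_g := (epi_iff_surjective_up_to_refinements _).2 hg

lemma shortExact_exists_lift {X Y Z : C} {f : X ⟶ Y} {g : Y ⟶ Z} {zero : f ≫ g = 0}
    (h : (ShortComplex.mk f g zero).ShortExact) {T : C} (t : T ⟶ Y) (ht : t ≫ g = 0) :
    ∃ s : T ⟶ X, s ≫ f = t := by
  have := h.mono_f
  exact ⟨h.exact.lift t ht, h.exact.lift_f t ht⟩

lemma shortExact_exists_desc {X Y Z : C} {f : X ⟶ Y} {g : Y ⟶ Z} {zero : f ≫ g = 0}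
    (h : (ShortComplex.mk f g zero).ShortExact) {T : C} (t : Y ⟶ T) (ht : f ≫ t = 0) :
    ∃ s : Z ⟶ T, g ≫ s = t := by
  have := h.epi_g
  exact ⟨h.exact.desc t ht, h.exact.g_desc t ht⟩

lemma shortExact_surjective {X Y Z : C} {f : X ⟶ Y} {g : Y ⟶ Z} {zero : f ≫ g = 0}
    (h : (ShortComplex.mk f g zero).ShortExact) {T : C} (t : T ⟶ Z) :
    ∃ (T' : C) (r : T' ⟶ T) (_ : Epi r) (s : T' ⟶ Y), r ≫ t = s ≫ g :=
  (epi_iff_surjective_up_to_refinements g).1 h.epi_g t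

/-- A morphism of short exact sequences which is the identity on the left terms gives a short exact
sequence. -/
lemma shortExact_lift_desc {X Y Z J W : C} {f : X ⟶ Y} {g : Y ⟶ Z} {i : X ⟶ J} {p : J ⟶ W}
    {fg : f ≫ g = 0} {ip : i ≫ p = 0} (h : (ShortComplex.mk f g fg).ShortExact)
    (h' : (ShortComplex.mk i p ip).ShortExact) {b : Y ⟶ J} {c : Z ⟶ W} (hb : f ≫ b = i)
    (hc : g ≫ c = b ≫ p) :
    (ShortComplex.mk (biprod.lift g b) (biprod.desc c (-p)) (by simp [hc])).ShortExact := by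
  have := h'.mono_f
  refine shortExact_of_refinements _ _ _ (fun T t ht => ?_) (fun T t ht => ?_) (fun T t => ?_)
  · obtain ⟨s, rfl⟩ := shortExact_exists_lift h t (by simpa using ht =≫ biprod.fst)
    have hs : s ≫ i = 0 := by simpa [hb] using ht =≫ biprod.snd
    rw [zero_of_comp_mono i hs, zero_comp]
  · obtain ⟨T', r, hr, y, hy⟩ := shortExact_surjective h (t ≫ biprod.fst)
    have e : t ≫ biprod.fst ≫ c = t ≫ biprod.snd ≫ p := by
      rw [biprod.desc_eq, Preadditive.comp_add] at ht
      simpa [add_neg_eq_zero] using ht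
    obtain ⟨s, hs⟩ := shortExact_exists_lift h' (r ≫ t ≫ biprod.snd - y ≫ b) (by
      simp only [Preadditive.sub_comp, Category.assoc, ← e, ← hc, ← reassoc_of% hy, sub_self])
    refine ⟨T', r, hr, y + s ≫ f, biprod.hom_ext _ _ ?_ ?_⟩
    · simp [hy, fg]
    · simp [hb, hs]
  · obtain ⟨T', r, hr, j, hj⟩ := shortExact_surjective h' t
    exact ⟨T', r, hr, -j ≫ biprod.inr, by simp [hj]⟩

/-- A morphism of short exact sequences which is the identity on the right terms gives a short
exact sequence. -/
lemma shortExact_lift_desc' {X Y Z K Q : C} {f : X ⟶ Y} {g : Y ⟶ Z} {i : K ⟶ Q} {p : Q ⟶ Z}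
    {fg : f ≫ g = 0} {ip : i ≫ p = 0} (h : (ShortComplex.mk f g fg).ShortExact)
    (h' : (ShortComplex.mk i p ip).ShortExact) {t : K ⟶ X} {s : Q ⟶ Y} (hs : s ≫ g = p)
    (ht : t ≫ f = i ≫ s) :
    (ShortComplex.mk (biprod.lift t i) (biprod.desc f (-s)) (by simp [ht])).ShortExact := by
  have := h'.mono_f
  have := h.mono_f
  refine shortExact_of_refinements _ _ _ (fun T u hu => ?_) (fun T u hu => ?_) (fun T u => ?_)
  · exact zero_of_comp_mono i (by simpa using hu =≫ biprod.snd)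
  · have e : u ≫ biprod.fst ≫ f = u ≫ biprod.snd ≫ s := by
      rw [biprod.desc_eq, Preadditive.comp_add] at hu
      simpa [add_neg_eq_zero] using hu
    obtain ⟨k, hk⟩ := shortExact_exists_lift h' (u ≫ biprod.snd) (by
      rw [← hs, Category.assoc, ← reassoc_of% e, fg, comp_zero, comp_zero])
    refine ⟨T, 𝟙 _, inferInstance, k, biprod.hom_ext _ _ ?_ ?_⟩
    · rw [← cancel_mono f]
      simp [ht, reassoc_of% hk, e]
    · simp [hk]
  · obtain ⟨T', r, hr, q, hq⟩ := shortExact_surjective h' (u ≫ g)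
    obtain ⟨x, hx⟩ := shortExact_exists_lift h (r ≫ u - q ≫ s) (by simp [hq, hs])
    exact ⟨T', r, hr, biprod.lift x (-q), by simp [hx]⟩

/-- The pushout of a short exact sequence. -/
lemma shortExact_pushout {X Y J W E : C} {i : X ⟶ J} {p : J ⟶ W} {ip : i ≫ p = 0}
    (h : (ShortComplex.mk i p ip).ShortExact) (f : X ⟶ Y) {e : Y ⊞ J ⟶ E}
    {we : biprod.lift f i ≫ e = 0} (he : (ShortComplex.mk (biprod.lift f i) e we).ShortExact)
    {q : E ⟶ W} (hq : e ≫ q = biprod.desc 0 p) :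
    (ShortComplex.mk (biprod.inl ≫ e) q (by simp [hq])).ShortExact := by
  have := h.mono_f
  refine shortExact_of_refinements _ _ _ (fun T t ht => ?_) (fun T t ht => ?_) (fun T t => ?_)
  · obtain ⟨x, hx⟩ := shortExact_exists_lift he (t ≫ biprod.inl) (by simpa using ht)
    have hx0 : x = 0 := zero_of_comp_mono i (by simpa using hx =≫ biprod.snd)
    simpa [hx0] using (hx =≫ biprod.fst).symm
  · obtain ⟨T', r, hr, y, hy⟩ := shortExact_surjective he t
    obtain ⟨x, hx⟩ := shortExact_exists_lift h (y ≫ biprod.snd) (by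
      have := hy =≫ q
      rw [Category.assoc, Category.assoc, ht, hq, comp_zero, biprod.desc_eq] at this
      simpa using this.symm)
    refine ⟨T', r, hr, y ≫ biprod.fst - x ≫ f, ?_⟩
    -- The part of `y` coming from `x` dies in `E`, so modulo it `y` lies in the summand `Y`.
    have hy' : y = (y ≫ biprod.fst - x ≫ f) ≫ biprod.inl + x ≫ biprod.lift f i := by
      apply biprod.hom_ext <;> simp [hx]
    exact hy.trans ((hy' =≫ e).trans (by simp [we]))
  · obtain ⟨T', r, hr, j, hj⟩ := shortExact_surjective h t
    exact ⟨T', r, hr, j ≫ biprod.inr ≫ e, by simp [hq, hj]⟩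

/-- The short exact sequence formed by the cokernels of two monomorphisms and of their
composition. -/
lemma shortExact_cokernels {X₁ X₂ X₃ Z₁₂ Z₂₃ Z₁₃ : C} {f : X₁ ⟶ X₂} {g : X₂ ⟶ X₃}
    {v₁₂ : X₂ ⟶ Z₁₂} {v₂₃ : X₃ ⟶ Z₂₃} {v₁₃ : X₃ ⟶ Z₁₃} {w₁₂ : f ≫ v₁₂ = 0} {w₂₃ : g ≫ v₂₃ = 0}
    {w₁₃ : (f ≫ g) ≫ v₁₃ = 0} (h₁₂ : (ShortComplex.mk f v₁₂ w₁₂).ShortExact)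
    (h₂₃ : (ShortComplex.mk g v₂₃ w₂₃).ShortExact)
    (h₁₃ : (ShortComplex.mk (f ≫ g) v₁₃ w₁₃).ShortExact) {m₁ : Z₁₂ ⟶ Z₁₃} {m₃ : Z₁₃ ⟶ Z₂₃}
    (hm₁ : v₁₂ ≫ m₁ = g ≫ v₁₃) (hm₃ : v₁₃ ≫ m₃ = v₂₃) (zero : m₁ ≫ m₃ = 0) :
    (ShortComplex.mk m₁ m₃ zero).ShortExact := by
  have := h₂₃.mono_f
  refine shortExact_of_refinements _ _ _ (fun T t ht => ?_) (fun T t ht => ?_) (fun T t => ?_)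
  · obtain ⟨T', r, hr, y, hy⟩ := shortExact_surjective h₁₂ t
    obtain ⟨x, hx⟩ := shortExact_exists_lift h₁₃ (y ≫ g) (by
      rw [Category.assoc, ← hm₁, ← reassoc_of% hy, ht, comp_zero])
    have hxy : x ≫ f = y := by rw [← cancel_mono g, Category.assoc, hx]
    rw [← cancel_epi r, comp_zero, hy, ← hxy, Category.assoc, w₁₂, comp_zero]
  · obtain ⟨T', r, hr, y, hy⟩ := shortExact_surjective h₁₃ t
    obtain ⟨x, hx⟩ := shortExact_exists_lift h₂₃ y (by
      rw [← hm₃, ← reassoc_of% hy, ht, comp_zero])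
    exact ⟨T', r, hr, x ≫ v₁₂, by rw [hy, ← hx, Category.assoc, Category.assoc, hm₁]⟩
  · obtain ⟨T', r, hr, y, hy⟩ := shortExact_surjective h₂₃ t
    exact ⟨T', r, hr, y ≫ v₁₃, by rw [hy, Category.assoc, hm₃]⟩

end Abelian

/-! ### Short exact sequences in a full subcategory -/

section Conflation

variable {C : Type u} [Category.{v} C] [Abelian C] {P : ObjectProperty C}

namespace IsConflation

variable {X Y Z : P.FullSubcategory} {f : X ⟶ Y} {g : Y ⟶ Z}

lemma w (h : IsConflation P f g) : f ≫ g = 0 :=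
  ObjectProperty.hom_ext _ h.1

lemma mono (h : IsConflation P f g) : Mono f :=
  P.ι.mono_of_mono_map h.2.mono_f

lemma epi (h : IsConflation P f g) : Epi g :=
  P.ι.epi_of_epi_map h.2.epi_g

lemma exists_lift (h : IsConflation P f g) {T : P.FullSubcategory} (t : T ⟶ Y) (ht : t ≫ g = 0) :
    ∃ s : T ⟶ X, s ≫ f = t := by
  obtain ⟨s, hs⟩ := shortExact_exists_lift h.2 t.hom (congrArg InducedCategory.Hom.hom ht)
  exact ⟨ObjectProperty.homMk s, ObjectProperty.hom_ext _ hs⟩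

lemma exists_desc (h : IsConflation P f g) {T : P.FullSubcategory} (t : Y ⟶ T) (ht : f ≫ t = 0) :
    ∃ s : Z ⟶ T, g ≫ s = t := by
  obtain ⟨s, hs⟩ := shortExact_exists_desc h.2 t.hom (congrArg InducedCategory.Hom.hom ht)
  exact ⟨ObjectProperty.homMk s, ObjectProperty.hom_ext _ hs⟩

end IsConflation

/-- The direct sum of two objects of `P`. -/
abbrev biprodObj [P.IsClosedUnderExtensions] (X Y : P.FullSubcategory) : P.FullSubcategory :=
  ⟨X.obj ⊞ Y.obj, P.prop_biprod X.2 Y.2⟩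

/-- The sequence Y → Z ⊕ J → W will represent the rotated triangle: in the stable category `J`
vanishes when injective, and W is then ΣX. -/
lemma isConflation_lift_desc [P.IsClosedUnderExtensions] {X Y Z J W : P.FullSubcategory}
    {f : X ⟶ Y} {g : Y ⟶ Z} {i : X ⟶ J} {p : J ⟶ W} (h : IsConflation P f g)
    (h' : IsConflation P i p) {b : Y ⟶ J} {c : Z ⟶ W} (hb : f ≫ b = i) (hc : g ≫ c = b ≫ p) :
    IsConflation P (Y := biprodObj Z J) (ObjectProperty.homMk (biprod.lift g.hom b.hom))
      (ObjectProperty.homMk (biprod.desc c.hom (-p.hom))) :=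
  ⟨_, shortExact_lift_desc h.2 h'.2 (congrArg InducedCategory.Hom.hom hb)
    (congrArg InducedCategory.Hom.hom hc)⟩

/-- The dual construction, used for the inverse rotation: with `Q` projective, `K` is a desuspension
of `Z`. -/
lemma isConflation_lift_desc' [P.IsClosedUnderExtensions] {X Y Z K Q : P.FullSubcategory}
    {f : X ⟶ Y} {g : Y ⟶ Z} {i : K ⟶ Q} {p : Q ⟶ Z} (h : IsConflation P f g)
    (h' : IsConflation P i p) {t : K ⟶ X} {s : Q ⟶ Y} (hs : s ≫ g = p) (ht : t ≫ f = i ≫ s) :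
    IsConflation P (Y := biprodObj X Q) (ObjectProperty.homMk (biprod.lift t.hom i.hom))
      (ObjectProperty.homMk (biprod.desc f.hom (-s.hom))) :=
  ⟨_, shortExact_lift_desc' h.2 h'.2 (congrArg InducedCategory.Hom.hom hs)
    (congrArg InducedCategory.Hom.hom ht)⟩

/-- The sum of a morphism and of an inflation is an inflation. -/
lemma exists_isConflation_lift [P.IsClosedUnderExtensions] {X Y J W : P.FullSubcategory}
    {i : X ⟶ J} {p : J ⟶ W} (h : IsConflation P i p) (f : X ⟶ Y) :
    ∃ (E : P.FullSubcategory) (e : biprodObj Y J ⟶ E),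
      IsConflation P (Y := biprodObj Y J) (ObjectProperty.homMk (biprod.lift f.hom i.hom)) e := by
  have := h.2.mono_f
  dsimp at this
  have : Mono (biprod.lift f.hom i.hom) :=
    mono_of_mono_fac (biprod.lift_snd (f := f.hom) (g := i.hom))
  have he : (ShortComplex.mk (biprod.lift f.hom i.hom) (cokernel.π _)
      (cokernel.condition _)).ShortExact :=
    { exact := ShortComplex.exact_cokernel _
      mono_f := this
      epi_g := inferInstance }
  -- The cokernel is the pushout of `i` along `f`, an extension of `W` by `Y`, hence an object of
  -- `P`.
  have hE := shortExact_pushout h.2 f.hom he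
    (q := cokernel.desc _ (biprod.desc 0 p.hom) (by simpa using h.1)) (by simp)
  exact ⟨⟨_, P.prop_X₂_of_shortExact hE Y.2 W.2⟩, ObjectProperty.homMk (cokernel.π _), _, he⟩

/-- The composition of two inflations is an inflation. -/
lemma exists_isConflation_comp [P.IsClosedUnderExtensions]
    {X₁ X₂ X₃ Z₁₂ Z₂₃ : P.FullSubcategory} {f : X₁ ⟶ X₂} {g : X₂ ⟶ X₃}
    {v₁₂ : X₂ ⟶ Z₁₂} {v₂₃ : X₃ ⟶ Z₂₃} (h₁₂ : IsConflation P f v₁₂) (h₂₃ : IsConflation P g v₂₃) :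
    ∃ (Z₁₃ : P.FullSubcategory) (v₁₃ : X₃ ⟶ Z₁₃) (m₁ : Z₁₂ ⟶ Z₁₃) (m₃ : Z₁₃ ⟶ Z₂₃),
      IsConflation P (f ≫ g) v₁₃ ∧ IsConflation P m₁ m₃ ∧ v₁₂ ≫ m₁ = g ≫ v₁₃ ∧
        v₁₃ ≫ m₃ = v₂₃ := by
  have := h₁₂.2.mono_f
  have := h₂₃.2.mono_f
  have := h₁₂.2.epi_g
  dsimp at *
  have h₁₃ : (ShortComplex.mk (f.hom ≫ g.hom) (cokernel.π _)
      (cokernel.condition _)).ShortExact :=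
    { exact := ShortComplex.exact_cokernel _
      mono_f := inferInstance
      epi_g := inferInstance }
  obtain ⟨m₁, hm₁⟩ := shortExact_exists_desc h₁₂.2 (g.hom ≫ cokernel.π (f.hom ≫ g.hom))
    (by rw [← Category.assoc, cokernel.condition])
  obtain ⟨m₃, hm₃⟩ := shortExact_exists_desc h₁₃ v₂₃.hom (by rw [Category.assoc, h₂₃.1, comp_zero])
  have zero : m₁ ≫ m₃ = 0 := by
    rw [← cancel_epi v₁₂.hom, reassoc_of% hm₁, hm₃, h₂₃.1, comp_zero]
  -- The cokernel of the composition is an extension of `Z₂₃` by `Z₁₂`, so it lies in `P`. The same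
  -- sequence will be the fourth triangle of the octahedron.
  have hm := shortExact_cokernels h₁₂.2 h₂₃.2 h₁₃ hm₁ hm₃ zero
  exact ⟨⟨_, P.prop_X₂_of_shortExact hm Z₁₂.2 Z₂₃.2⟩, ObjectProperty.homMk (cokernel.π _),
    ObjectProperty.homMk m₁, ObjectProperty.homMk m₃, ⟨_, h₁₃⟩, ⟨_, hm⟩,
    ObjectProperty.hom_ext _ hm₁, ObjectProperty.hom_ext _ hm₃⟩

end Conflation

/-! ### The suspension of a stable category -/

section Suspension

variable {C : Type u} [Category.{v} C] [Abelian C] {P : ObjectProperty C}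

section

variable [P.ContainsZero] [P.IsClosedUnderExtensions]

instance : (toSt P).Additive := CategoryTheory.Quotient.functor_additive (stableRel P) _

lemma toSt_map_eq_iff {X Y : P.FullSubcategory} (f g : X ⟶ Y) :
    (toSt P).map f = (toSt P).map g ↔ FactorsThroughProjective P (f - g) :=
  CategoryTheory.Quotient.functor_map_eq_iff _ _ _

lemma toSt_map_eq_zero_iff {X Y : P.FullSubcategory} (f : X ⟶ Y) :
    (toSt P).map f = 0 ↔ FactorsThroughProjective P f := by
  rw [← (toSt P).map_zero, toSt_map_eq_iff, sub_zero]

lemma toSt_isZero {Q : P.FullSubcategory} (hQ : IsProjective P Q) : IsZero ((toSt P).obj Q) := by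
  rw [IsZero.iff_id_eq_zero, ← (toSt P).map_id, toSt_map_eq_zero_iff]
  exact ⟨Q, 𝟙 _, 𝟙 _, hQ, Category.id_comp _⟩

/-- The projection of a direct sum with a projective object is invertible in the stable
category. -/
@[simps]
def biprodProjIso (X : P.FullSubcategory) {Q : P.FullSubcategory} (hQ : IsProjective P Q) :
    (toSt P).obj (biprodObj X Q) ≅ (toSt P).obj X where
  hom := (toSt P).map (ObjectProperty.homMk biprod.fst)
  inv := (toSt P).map (ObjectProperty.homMk biprod.inl)
  hom_inv_id := by
    rw [← Functor.map_comp, ← (toSt P).map_id, toSt_map_eq_iff]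
    refine ⟨Q, ObjectProperty.homMk biprod.snd, -ObjectProperty.homMk biprod.inr, hQ, ?_⟩
    apply ObjectProperty.hom_ext
    have := biprod.total (X := X.obj) (Y := Q.obj)
    change (biprod.snd : X.obj ⊞ Q.obj ⟶ _) ≫ (-biprod.inr) = biprod.fst ≫ biprod.inl - 𝟙 _
    rw [← this, Preadditive.comp_neg, sub_add_cancel_left]
  inv_hom_id := by
    rw [← Functor.map_comp, ← (toSt P).map_id]
    congr 1
    exact ObjectProperty.hom_ext _ biprod.inl_fst

instance : HasBinaryBiproducts (St P) where
  has_binary_biproduct X Y :=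
    ⟨⟨(toSt P).mapBinaryBicone (X := X.as) (Y := Y.as)
        { pt := biprodObj X.as Y.as
          fst := ObjectProperty.homMk biprod.fst
          snd := ObjectProperty.homMk biprod.snd
          inl := ObjectProperty.homMk biprod.inl
          inr := ObjectProperty.homMk biprod.inr
          inl_fst := ObjectProperty.hom_ext _ biprod.inl_fst
          inl_snd := ObjectProperty.hom_ext _ biprod.inl_snd
          inr_fst := ObjectProperty.hom_ext _ biprod.inr_fst
          inr_snd := ObjectProperty.hom_ext _ biprod.inr_snd },
      isBinaryBilimitOfTotal _ (by
        have h : (ObjectProperty.homMk biprod.fst : biprodObj X.as Y.as ⟶ _) ≫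
              ObjectProperty.homMk biprod.inl +
            (ObjectProperty.homMk biprod.snd : biprodObj X.as Y.as ⟶ _) ≫
              ObjectProperty.homMk biprod.inr = 𝟙 (biprodObj X.as Y.as) :=
          ObjectProperty.hom_ext _ biprod.total
        have := congrArg (toSt P).map h
        rw [Functor.map_add, Functor.map_comp, Functor.map_comp, CategoryTheory.Functor.map_id] at this
        exact this)⟩⟩

instance : HasFiniteProducts (St P) :=
  hasFiniteProducts_of_has_binary_and_terminal

end

lemma exists_connecting {X Y Z X' J W : P.FullSubcategory} {f : X ⟶ Y} {g : Y ⟶ Z} {i : X' ⟶ J}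
    {p : J ⟶ W} (h : IsConflation P f g) (hip : IsConflation P i p) (hJ : IsInjective P J)
    (a : X ⟶ X') : ∃ (c : Z ⟶ W) (b : Y ⟶ J), f ≫ b = a ≫ i ∧ g ≫ c = b ≫ p := by
  obtain ⟨b, hb⟩ := hJ f g h (a ≫ i)
  obtain ⟨c, hc⟩ := h.exists_desc (b ≫ p) (by
    rw [← Category.assoc, hb, Category.assoc, hip.w, comp_zero])
  exact ⟨c, b, hb, hc⟩

variable [IsFrobenius P]

lemma IsInjective.isProjective {J : P.FullSubcategory} (h : IsInjective P J) :
    IsProjective P J :=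
  (IsFrobenius.projective_iff_injective J).2 h

lemma IsProjective.isInjective {J : P.FullSubcategory} (h : IsProjective P J) :
    IsInjective P J :=
  (IsFrobenius.projective_iff_injective J).1 h

/-- The morphism `Z ⟶ W` of the stable category defined by a short exact sequence
`0 ⟶ X ⟶ Y ⟶ Z ⟶ 0`, a short exact sequence `0 ⟶ X' ⟶ J ⟶ W ⟶ 0` with `J` injective and a
morphism `X ⟶ X'`. -/
def connecting {X Y Z X' J W : P.FullSubcategory} {f : X ⟶ Y} {g : Y ⟶ Z} {i : X' ⟶ J}
    {p : J ⟶ W} (h : IsConflation P f g) (hip : IsConflation P i p) (hJ : IsInjective P J)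
    (a : X ⟶ X') : (toSt P).obj Z ⟶ (toSt P).obj W :=
  (toSt P).map (exists_connecting h hip hJ a).choose

/-- Write a - a' as a morphism through a projective, hence injective, `Q`. Its first half extends
along `f`, and after subtracting this extension b - b' vanishes on `X` and factors as `k` through
`g`. Then c - c' = k ≫ p factors through `J`. So the connecting morphism depends only on the stable
class of `a`. -/
lemma toSt_map_eq_of_conflation {X Y Z X' J W : P.FullSubcategory} {f : X ⟶ Y} {g : Y ⟶ Z}
    {i : X' ⟶ J} {p : J ⟶ W} (h : IsConflation P f g) (hip : IsConflation P i p)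
    (hJ : IsInjective P J) {a a' : X ⟶ X'} (haa' : (toSt P).map a = (toSt P).map a')
    {b b' : Y ⟶ J} {c c' : Z ⟶ W} (hb : f ≫ b = a ≫ i) (hc : g ≫ c = b ≫ p)
    (hb' : f ≫ b' = a' ≫ i) (hc' : g ≫ c' = b' ≫ p) : (toSt P).map c = (toSt P).map c' := by
  rw [toSt_map_eq_iff] at haa' ⊢
  obtain ⟨Q, s, t, hQ, hst⟩ := haa'
  obtain ⟨s', rfl⟩ := hQ.isInjective f g h s
  obtain ⟨k, hk⟩ := h.exists_desc (b - b' - s' ≫ t ≫ i) (by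
    rw [Category.assoc] at hst
    rw [Preadditive.comp_sub, Preadditive.comp_sub, hb, hb', ← Preadditive.sub_comp, ← hst]
    simp)
  refine ⟨J, k, p, hJ.isProjective, ?_⟩
  have := h.epi
  rw [← cancel_epi g, reassoc_of% hk]
  simp only [Preadditive.sub_comp, Preadditive.comp_sub, Category.assoc, hip.w, hc, hc', comp_zero,
    sub_zero]

lemma connecting_eq {X Y Z X' J W : P.FullSubcategory} {f : X ⟶ Y} {g : Y ⟶ Z} {i : X' ⟶ J}
    {p : J ⟶ W} (h : IsConflation P f g) (hip : IsConflation P i p) (hJ : IsInjective P J)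
    (a : X ⟶ X') (b : Y ⟶ J) (c : Z ⟶ W) (hb : f ≫ b = a ≫ i) (hc : g ≫ c = b ≫ p) :
    connecting h hip hJ a = (toSt P).map c := by
  obtain ⟨b', hb', hc'⟩ := (exists_connecting h hip hJ a).choose_spec
  exact toSt_map_eq_of_conflation h hip hJ rfl hb' hc' hb hc

lemma connecting_congr {X Y Z X' J W : P.FullSubcategory} {f : X ⟶ Y} {g : Y ⟶ Z} {i : X' ⟶ J}
    {p : J ⟶ W} (h : IsConflation P f g) (hip : IsConflation P i p) (hJ : IsInjective P J)
    {a a' : X ⟶ X'} (haa' : (toSt P).map a = (toSt P).map a') :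
    connecting h hip hJ a = connecting h hip hJ a' := by
  obtain ⟨b, hb, hc⟩ := (exists_connecting h hip hJ a).choose_spec
  obtain ⟨b', hb', hc'⟩ := (exists_connecting h hip hJ a').choose_spec
  exact toSt_map_eq_of_conflation h hip hJ haa' hb hc hb' hc'

lemma connecting_id {X J W : P.FullSubcategory} {i : X ⟶ J} {p : J ⟶ W}
    (hip : IsConflation P i p) (hJ : IsInjective P J) : connecting hip hip hJ (𝟙 X) = 𝟙 _ := by
  rw [connecting_eq hip hip hJ (𝟙 X) (𝟙 J) (𝟙 W) (by simp) (by simp), CategoryTheory.Functor.map_id]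

/-- Stacked morphisms of short exact sequences compose; independence of the extensions does the
rest. -/
lemma connecting_comp {X Y Z X' J W X'' J' W' : P.FullSubcategory} {f : X ⟶ Y} {g : Y ⟶ Z}
    {i : X' ⟶ J} {p : J ⟶ W} {i' : X'' ⟶ J'} {p' : J' ⟶ W'} (h : IsConflation P f g)
    (hip : IsConflation P i p) (hJ : IsInjective P J) (hip' : IsConflation P i' p')
    (hJ' : IsInjective P J') (a : X ⟶ X') (a' : X' ⟶ X'') :
    connecting h hip hJ a ≫ connecting hip hip' hJ' a' = connecting h hip' hJ' (a ≫ a') := by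
  obtain ⟨c, b, hb, hc⟩ := exists_connecting h hip hJ a
  obtain ⟨c', b', hb', hc'⟩ := exists_connecting hip hip' hJ' a'
  rw [connecting_eq h hip hJ a b c hb hc, connecting_eq hip hip' hJ' a' b' c' hb' hc',
    connecting_eq h hip' hJ' (a ≫ a') (b ≫ b') (c ≫ c') (by rw [reassoc_of% hb, hb', Category.assoc])
    (by rw [reassoc_of% hc, hc', Category.assoc]), Functor.map_comp]

lemma map_comp_connecting {X Y Z X' Y' Z' X'' J W : P.FullSubcategory} {f : X ⟶ Y} {g : Y ⟶ Z}
    {f' : X' ⟶ Y'} {g' : Y' ⟶ Z'} {i : X'' ⟶ J} {p : J ⟶ W} (h : IsConflation P f g)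
    (h' : IsConflation P f' g') (hip : IsConflation P i p) (hJ : IsInjective P J)
    {a : X ⟶ X'} {b : Y ⟶ Y'} {c : Z ⟶ Z'} (hb : f ≫ b = a ≫ f') (hc : g ≫ c = b ≫ g')
    (a' : X' ⟶ X'') :
    (toSt P).map c ≫ connecting h' hip hJ a' = connecting h hip hJ (a ≫ a') := by
  obtain ⟨c', b', hb', hc'⟩ := exists_connecting h' hip hJ a'
  rw [connecting_eq h' hip hJ a' b' c' hb' hc',
    connecting_eq h hip hJ (a ≫ a') (b ≫ b') (c ≫ c') (by rw [reassoc_of% hb, hb', Category.assoc])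
    (by rw [reassoc_of% hc, hc', Category.assoc]), Functor.map_comp]

variable (P) in
/-- A short exact sequence `0 ⟶ X ⟶ J ⟶ W ⟶ 0` with `J` injective. -/
structure Hull (X : P.FullSubcategory) where
  (J W : P.FullSubcategory)
  (i : X ⟶ J)
  (p : J ⟶ W)
  conflation : IsConflation P i p
  injective : IsInjective P J

/-- A choice of inflation of each object into an injective object. -/
def hull (X : P.FullSubcategory) : Hull P X :=
  Nonempty.some (by
    obtain ⟨J, W, i, p, h, hJ⟩ := IsFrobenius.enough_injectives X
    exact ⟨⟨J, W, i, p, h, hJ⟩⟩)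

variable (P) in
/-- The suspension functor. -/
def suspension : St P ⥤ St P :=
  CategoryTheory.Quotient.lift (stableRel P)
    { obj X := (toSt P).obj (hull X).W
      map {X Y} f := connecting (hull X).conflation (hull Y).conflation (hull Y).injective f
      map_id _ := connecting_id _ _
      map_comp _ _ := (connecting_comp _ _ _ _ _ _ _).symm }
    (fun X Y _ _ h => connecting_congr (hull X).conflation (hull Y).conflation
      (hull Y).injective (CategoryTheory.Quotient.sound _ h))

lemma suspension_map {X Y : P.FullSubcategory} (f : X ⟶ Y) :
    (suspension P).map ((toSt P).map f) =
      connecting (hull X).conflation (hull Y).conflation (hull Y).injective f := rfl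

/-- The connecting morphism `Z ⟶ ΣX` of a short exact sequence `0 ⟶ X ⟶ Y ⟶ Z ⟶ 0`. -/
def IsConflation.δ {X Y Z : P.FullSubcategory} {f : X ⟶ Y} {g : Y ⟶ Z}
    (h : IsConflation P f g) : (toSt P).obj Z ⟶ (suspension P).obj ((toSt P).obj X) :=
  connecting h (hull X).conflation (hull X).injective (𝟙 X)

lemma IsConflation.δ_naturality {X Y Z X' Y' Z' : P.FullSubcategory} {f : X ⟶ Y} {g : Y ⟶ Z}
    {f' : X' ⟶ Y'} {g' : Y' ⟶ Z'} (h : IsConflation P f g) (h' : IsConflation P f' g')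
    {a : X ⟶ X'} {b : Y ⟶ Y'} {c : Z ⟶ Z'} (hb : f ≫ b = a ≫ f') (hc : g ≫ c = b ≫ g') :
    (toSt P).map c ≫ h'.δ = h.δ ≫ (suspension P).map ((toSt P).map a) := by
  refine (map_comp_connecting h h' _ _ hb hc _).trans (Eq.trans ?_
    (connecting_comp h (hull X).conflation (hull X).injective (hull X').conflation
      (hull X').injective (𝟙 X) a).symm)
  rw [Category.comp_id, Category.id_comp]

/-- The middle term of the short exact sequence being injective, the connecting morphism is
invertible. -/
def suspensionIso {X J W : P.FullSubcategory} {i : X ⟶ J} {p : J ⟶ W}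
    (h : IsConflation P i p) (hJ : IsInjective P J) :
    (toSt P).obj W ≅ (suspension P).obj ((toSt P).obj X) where
  hom := h.δ
  inv := connecting (hull X).conflation h hJ (𝟙 X)
  hom_inv_id := by
    refine (connecting_comp _ _ _ _ _ _ _).trans ?_
    rw [Category.comp_id, connecting_id]
  inv_hom_id := by
    refine (connecting_comp _ _ _ _ _ _ _).trans ?_
    rw [Category.comp_id]
    exact connecting_id _ _

instance : (suspension P).Additive where
  map_add {X Y f g} := by
    obtain ⟨f, rfl⟩ := (toSt P).map_surjective f
    obtain ⟨g, rfl⟩ := (toSt P).map_surjective g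
    rw [← Functor.map_add, suspension_map, suspension_map, suspension_map]
    obtain ⟨c, b, hb, hc⟩ := exists_connecting (hull X.as).conflation (hull Y.as).conflation
      (hull Y.as).injective f
    obtain ⟨c', b', hb', hc'⟩ := exists_connecting (hull X.as).conflation (hull Y.as).conflation
      (hull Y.as).injective g
    rw [connecting_eq _ _ _ f b c hb hc, connecting_eq _ _ _ g b' c' hb' hc',
      connecting_eq _ _ _ (f + g) (b + b') (c + c') (by simp [hb, hb']) (by simp [hc, hc'])]
    exact (toSt P).map_add

/-- If the induced `c` factors through a projective, its second half lifts along the deflation of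
the hull of `Y`. Correcting `b` by this lift makes it land in `Y`, and `a` then factors through the
injective hull of `X`. -/
instance : (suspension P).Faithful where
  map_injective {X Y f g} h := by
    obtain ⟨f, rfl⟩ := (toSt P).map_surjective f
    obtain ⟨g, rfl⟩ := (toSt P).map_surjective g
    rw [← sub_eq_zero, ← Functor.map_sub, ← Functor.map_sub] at h
    rw [← sub_eq_zero, ← Functor.map_sub]
    generalize f - g = a at h ⊢
    rw [suspension_map] at h
    obtain ⟨c, b, hb, hc⟩ := exists_connecting (hull X.as).conflation (hull Y.as).conflation
      (hull Y.as).injective a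
    rw [connecting_eq _ _ _ a b c hb hc] at h
    obtain ⟨Q, s, t, hQ, rfl⟩ := (toSt_map_eq_zero_iff c).1 h
    obtain ⟨t', rfl⟩ := hQ _ _ (hull Y.as).conflation t
    obtain ⟨l, hl⟩ := (hull Y.as).conflation.exists_lift (b - (hull X.as).p ≫ s ≫ t') (by
      simp [hc])
    refine (toSt_map_eq_zero_iff a).2 ⟨_, (hull X.as).i, l, (hull X.as).injective.isProjective, ?_⟩
    have := (hull Y.as).conflation.mono
    rw [← cancel_mono (hull Y.as).i, Category.assoc, hl, Preadditive.comp_sub, hb,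
      ← Category.assoc, (hull X.as).conflation.w, zero_comp, sub_zero]

/-- Injective hulls are projective, so `c` lifts to a morphism between the hulls, which restricts to
the kernels. -/
instance : (suspension P).Full where
  map_surjective {X Y} c := by
    obtain ⟨c, rfl⟩ := (toSt P).map_surjective (X := (hull X.as).W) (Y := (hull Y.as).W) c
    obtain ⟨b, hb⟩ := (hull X.as).injective.isProjective _ _ (hull Y.as).conflation
      ((hull X.as).p ≫ c)
    obtain ⟨a, ha⟩ := (hull Y.as).conflation.exists_lift ((hull X.as).i ≫ b) (by
      rw [Category.assoc, hb, ← Category.assoc, (hull X.as).conflation.w, zero_comp])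
    exact ⟨(toSt P).map a, connecting_eq (hull X.as).conflation (hull Y.as).conflation
      (hull Y.as).injective a b c ha.symm hb.symm⟩

/-- A projective cover has injective middle term, so its target is the suspension of its kernel. -/
instance : (suspension P).EssSurj where
  mem_essImage X := by
    obtain ⟨K, Q, f, g, h, hQ⟩ := IsFrobenius.enough_projectives X.as
    exact ⟨(toSt P).obj K, ⟨(suspensionIso h hQ.isInjective).symm⟩⟩

instance : (suspension P).IsEquivalence where

end Suspension

/-! ### The triangulation of a stable category -/

section Triangulation

open Pretriangulated

variable {C : Type u} [Category.{v} C] [Abelian C] {P : ObjectProperty C} [IsFrobenius P]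

lemma shiftFunctor_additive [HasShift (St P) ℤ] (n : ℤ) : (shiftFunctor (St P) n).Additive :=
  Functor.additive_of_preserves_binary_products _

variable [HasShift (St P) ℤ] (e : suspension P ≅ shiftFunctor (St P) (1 : ℤ))

/-- The connecting morphism of a short exact sequence, with values in the shift by `1`. -/
def shiftδ {X Y Z : P.FullSubcategory} {f : X ⟶ Y} {g : Y ⟶ Z} (h : IsConflation P f g) :
    (toSt P).obj Z ⟶ ((toSt P).obj X)⟦(1 : ℤ)⟧ :=
  h.δ ≫ e.hom.app ((toSt P).obj X)

lemma shiftδ_naturality {X Y Z X' Y' Z' : P.FullSubcategory} {f : X ⟶ Y} {g : Y ⟶ Z}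
    {f' : X' ⟶ Y'} {g' : Y' ⟶ Z'} (h : IsConflation P f g) (h' : IsConflation P f' g')
    {a : X ⟶ X'} {b : Y ⟶ Y'} {c : Z ⟶ Z'} (hb : f ≫ b = a ≫ f') (hc : g ≫ c = b ≫ g') :
    (toSt P).map c ≫ shiftδ e h' = shiftδ e h ≫ ((toSt P).map a)⟦(1 : ℤ)⟧' := by
  rw [shiftδ, shiftδ, ← Category.assoc, h.δ_naturality h' hb hc, Category.assoc, Category.assoc,
    e.hom.naturality]

/-- Connecting morphisms can be computed with any comparison sequence starting at `X`, not only the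
chosen hull. -/
lemma shiftδ_eq {X Y Z J W : P.FullSubcategory} {f : X ⟶ Y} {g : Y ⟶ Z} {i : X ⟶ J} {p : J ⟶ W}
    (h : IsConflation P f g) (hip : IsConflation P i p) {b : Y ⟶ J} {c : Z ⟶ W} (hb : f ≫ b = i)
    (hc : g ≫ c = b ≫ p) : shiftδ e h = (toSt P).map c ≫ shiftδ e hip := by
  rw [shiftδ_naturality e h hip (a := 𝟙 X) (by rw [hb, Category.id_comp]) hc,
    CategoryTheory.Functor.map_id, CategoryTheory.Functor.map_id, Category.comp_id]

/-- The isomorphism between the cokernel of an inflation into an injective object and the shift. -/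
def shiftδIso {X J W : P.FullSubcategory} {i : X ⟶ J} {p : J ⟶ W} (h : IsConflation P i p)
    (hJ : IsInjective P J) : (toSt P).obj W ≅ ((toSt P).obj X)⟦(1 : ℤ)⟧ :=
  suspensionIso h hJ ≪≫ e.app ((toSt P).obj X)

@[simp]
lemma shiftδIso_hom {X J W : P.FullSubcategory} {i : X ⟶ J} {p : J ⟶ W} (h : IsConflation P i p)
    (hJ : IsInjective P J) : (shiftδIso e h hJ).hom = shiftδ e h := rfl

/-- The triangle defined by a short exact sequence. -/
abbrev conflationTriangle {X Y Z : P.FullSubcategory} {f : X ⟶ Y} {g : Y ⟶ Z}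
    (h : IsConflation P f g) : Triangle (St P) :=
  Triangle.mk ((toSt P).map f) ((toSt P).map g) (shiftδ e h)

/-- The triangles isomorphic to those defined by short exact sequences. -/
def IsStandardTriangle (T : Triangle (St P)) : Prop :=
  ∃ (X Y Z : P.FullSubcategory) (f : X ⟶ Y) (g : Y ⟶ Z) (h : IsConflation P f g),
    Nonempty (T ≅ conflationTriangle e h)

lemma isStandardTriangle_conflationTriangle {X Y Z : P.FullSubcategory} {f : X ⟶ Y} {g : Y ⟶ Z}
    (h : IsConflation P f g) : IsStandardTriangle e (conflationTriangle e h) :=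
  ⟨_, _, _, _, _, h, ⟨Iso.refl _⟩⟩

variable {e} in
lemma IsStandardTriangle.of_iso {T T' : Triangle (St P)} (h : IsStandardTriangle e T)
    (φ : T' ≅ T) : IsStandardTriangle e T' := by
  obtain ⟨X, Y, Z, f, g, h, ⟨ψ⟩⟩ := h
  exact ⟨X, Y, Z, f, g, h, ⟨φ ≪≫ ψ⟩⟩

variable {e} in
lemma IsStandardTriangle.exists_iso {T : Triangle (St P)} (hT : IsStandardTriangle e T) :
    ∃ (X Y Z : P.FullSubcategory) (f : X ⟶ Y) (g : Y ⟶ Z) (h : IsConflation P f g)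
      (α : T.obj₁ ≅ (toSt P).obj X) (β : T.obj₂ ≅ (toSt P).obj Y) (γ : T.obj₃ ≅ (toSt P).obj Z),
      T.mor₁ ≫ β.hom = α.hom ≫ (toSt P).map f ∧ T.mor₂ ≫ γ.hom = β.hom ≫ (toSt P).map g ∧
        T.mor₃ ≫ α.hom⟦(1 : ℤ)⟧' = γ.hom ≫ shiftδ e h := by
  obtain ⟨X, Y, Z, f, g, h, ⟨φ⟩⟩ := hT
  exact ⟨X, Y, Z, f, g, h, Triangle.π₁.mapIso φ, Triangle.π₂.mapIso φ, Triangle.π₃.mapIso φ,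
    φ.hom.comm₁, φ.hom.comm₂, φ.hom.comm₃⟩

omit [HasShift (St P) ℤ] in
-- Adding an injective summand to the target is invisible stably and turns any morphism into an
-- inflation.
lemma exists_conflation_of_hom {X : P.FullSubcategory} {Y : St P} (f : (toSt P).obj X ⟶ Y) :
    ∃ (Y' Z : P.FullSubcategory) (f' : X ⟶ Y') (g : Y' ⟶ Z) (φ : Y ≅ (toSt P).obj Y'),
      IsConflation P f' g ∧ f ≫ φ.hom = (toSt P).map f' := by
  obtain ⟨f, rfl⟩ := (toSt P).map_surjective (Y := Y.as) f
  obtain ⟨E, g, h⟩ := exists_isConflation_lift (hull X).conflation f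
  refine ⟨_, E, _, g, (biprodProjIso Y.as (hull X).injective.isProjective).symm, h, ?_⟩
  rw [← Iso.eq_comp_inv, Iso.symm_inv, biprodProjIso_hom, ← Functor.map_comp]
  congr 1
  exact ObjectProperty.hom_ext _ (biprod.lift_fst _ _).symm

lemma isStandardTriangle_contractible (X : St P) :
    IsStandardTriangle e (contractibleTriangle X) := by
  obtain ⟨Z, hZ⟩ := HasZeroObject.zero (C := P.FullSubcategory)
  have h : IsConflation P (𝟙 X.as) (0 : X.as ⟶ Z) := by
    refine ⟨by simp, shortExact_of_refinements _ _ _ (fun T t ht => by simpa using ht)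
      (fun T t _ => ⟨T, 𝟙 _, inferInstance, t, by simp⟩)
      (fun T t => ⟨T, 𝟙 _, inferInstance, 0, (P.ι.map_isZero hZ).eq_of_tgt _ _⟩)⟩
  have hZ' : IsZero ((toSt P).obj Z) := (toSt P).map_isZero hZ
  exact ⟨_, _, _, _, _, h, ⟨Triangle.isoMk _ _ (Iso.refl X) (Iso.refl X)
    ((isZero_zero _).iso hZ') (by simp; rfl) (hZ'.eq_of_tgt _ _)
    ((isZero_zero (St P)).eq_of_src _ _)⟩⟩

/-- The sequence Y → Z ⊕ J → W represents the rotation, with W identified with ΣX; the sign on `f`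
comes from the sign on `p` in the second map. -/
lemma isStandardTriangle_rotate {X Y Z : P.FullSubcategory} {f : X ⟶ Y} {g : Y ⟶ Z}
    (h : IsConflation P f g) : IsStandardTriangle e (conflationTriangle e h).rotate := by
  obtain ⟨J, W, i, p, hip, hJ⟩ := hull X
  obtain ⟨J', W', i', p', hip', hJ'⟩ := hull Y
  obtain ⟨c, b, hb, hc⟩ := exists_connecting h hip hJ (𝟙 X)
  rw [Category.id_comp] at hb
  obtain ⟨c', b', hb', hc'⟩ := exists_connecting hip hip' hJ' f
  have h' := isConflation_lift_desc h hip hb hc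
  -- Both b ≫ b' and i' restrict to f ≫ i' on `X`, so they differ by a morphism from `Z`; (-k, b')
  -- is then an extension of i' to Z ⊕ J.
  obtain ⟨k, hk⟩ := h.exists_desc (b ≫ b' - i') (by
    rw [Preadditive.comp_sub, reassoc_of% hb, hb', sub_self])
  have hδ : shiftδ e h' = -((toSt P).map c' ≫ shiftδ e hip') := by
    rw [shiftδ_eq e h' hip' (b := ObjectProperty.homMk (biprod.desc (-k.hom) b'.hom)) (c := -c'),
      Functor.map_neg, Preadditive.neg_comp]
    · ext
      have := congrArg InducedCategory.Hom.hom hk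
      change g.hom ≫ k.hom = b.hom ≫ b'.hom - i'.hom at this
      change biprod.lift g.hom b.hom ≫ biprod.desc (-k.hom) b'.hom = i'.hom
      rw [biprod.lift_desc, Preadditive.comp_neg, this]
      abel
    · apply ObjectProperty.hom_ext
      have h1 : p.hom ≫ c'.hom = b'.hom ≫ p'.hom := congrArg InducedCategory.Hom.hom hc'
      have h2 : g.hom ≫ k.hom = b.hom ≫ b'.hom - i'.hom := congrArg InducedCategory.Hom.hom hk
      have h3 : g.hom ≫ c.hom = b.hom ≫ p.hom := congrArg InducedCategory.Hom.hom hc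
      have := h.2.epi_g
      dsimp at this
      change biprod.desc c.hom (-p.hom) ≫ (-c'.hom) = biprod.desc (-k.hom) b'.hom ≫ p'.hom
      apply biprod.hom_ext'
      · rw [← cancel_epi g.hom]
        simp only [biprod.inl_desc_assoc, Preadditive.comp_neg, Preadditive.neg_comp,
          reassoc_of% h3, reassoc_of% h2, Preadditive.sub_comp, h1, hip'.1, Category.assoc,
          sub_zero]
      · simp [h1]
  let φ := biprodProjIso Z hJ.isProjective
  refine (isStandardTriangle_conflationTriangle e h').of_iso (Iso.symm (Triangle.isoMk _ _
    (Iso.refl _) φ (shiftδIso e hip hJ) ?_ ?_ ?_))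
  · change (toSt P).map _ ≫ (toSt P).map _ = 𝟙 _ ≫ (toSt P).map g
    rw [← Functor.map_comp, Category.id_comp]
    congr 1
    exact ObjectProperty.hom_ext _ (biprod.lift_fst _ _)
  · change (toSt P).map _ ≫ shiftδ e hip = φ.hom ≫ shiftδ e h
    rw [← Iso.inv_comp_eq, shiftδ_eq e h hip hb hc]
    change (toSt P).map _ ≫ (toSt P).map _ ≫ shiftδ e hip = _
    rw [← Functor.map_comp_assoc]
    congr 2
    exact ObjectProperty.hom_ext _ (biprod.inl_desc _ _)
  · change shiftδ e h' ≫ (𝟙 _)⟦(1 : ℤ)⟧' = shiftδ e hip ≫ (-((toSt P).map f)⟦(1 : ℤ)⟧')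
    rw [CategoryTheory.Functor.map_id, Category.comp_id, hδ, shiftδ_naturality e hip hip' hb' hc',
      Preadditive.comp_neg]

/-- Pull back along a projective cover K → Q → Z: the sequence K → X ⊕ Q → Y represents the original
triangle, `K` being the desuspension of `Z`. -/
lemma isStandardTriangle_of_rotate (T : Triangle (St P)) (hT : IsStandardTriangle e T.rotate) :
    IsStandardTriangle e T := by
  obtain ⟨X, Y, Z, f, g, h, φ₁, φ₂, (φ₃ : T.obj₁⟦(1 : ℤ)⟧ ≅ (toSt P).obj Z), c₁, c₂, c₃⟩ :=
    hT.exists_iso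
  replace c₃ : (-T.mor₁⟦(1 : ℤ)⟧') ≫ φ₁.hom⟦(1 : ℤ)⟧' = φ₃.hom ≫ shiftδ e h := c₃
  dsimp only [Triangle.rotate, Triangle.mk] at φ₁ φ₂ c₁ c₂ c₃
  obtain ⟨K, Q, i, p, hip, hQ⟩ := IsFrobenius.enough_projectives Z
  obtain ⟨s, hs⟩ := hQ f g h p
  obtain ⟨t, ht⟩ := h.exists_lift (i ≫ s) (by rw [Category.assoc, hs, hip.w])
  have h' := isConflation_lift_desc' h hip hs ht
  have hδ : shiftδ e h' = -((toSt P).map g ≫ shiftδ e hip) := by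
    rw [shiftδ_eq e h' hip (b := ObjectProperty.homMk biprod.snd) (c := -g),
      Functor.map_neg, Preadditive.neg_comp]
    · exact ObjectProperty.hom_ext _ (biprod.lift_snd _ _)
    · apply ObjectProperty.hom_ext
      have h1 : f.hom ≫ g.hom = 0 := h.1
      have h2 : s.hom ≫ g.hom = p.hom := congrArg InducedCategory.Hom.hom hs
      change biprod.desc f.hom (-s.hom) ≫ (-g.hom) = biprod.snd ≫ p.hom
      apply biprod.hom_ext' <;> simp [h1, h2]
  have hδ' : shiftδ e h = shiftδ e hip ≫ ((toSt P).map t)⟦(1 : ℤ)⟧' := by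
    rw [← shiftδ_naturality e hip h (c := 𝟙 Z) ht.symm (by rw [hs, Category.comp_id]),
      CategoryTheory.Functor.map_id, Category.id_comp]
  -- The minus sign cancels the one carried by the last morphism of the rotated triangle.
  let α : T.obj₁ ≅ (toSt P).obj K :=
    (shiftFunctor (St P) (1 : ℤ)).preimageIso (-(φ₃ ≪≫ shiftδIso e hip hQ.isInjective))
  have hα : α.hom⟦(1 : ℤ)⟧' = -(φ₃.hom ≫ shiftδ e hip) := by
    simp [α]
  let ψ := biprodProjIso X hQ
  refine (isStandardTriangle_conflationTriangle e h').of_iso (Triangle.isoMk _ _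
    α (φ₁ ≪≫ ψ.symm) φ₂ ?_ ?_ ?_)
  · change T.mor₁ ≫ φ₁.hom ≫ ψ.inv = α.hom ≫ (toSt P).map _
    rw [← Category.assoc, Iso.comp_inv_eq, Category.assoc]
    have : (toSt P).map (ObjectProperty.homMk (biprod.lift t.hom i.hom)) ≫ ψ.hom =
        (toSt P).map t := by
      change (toSt P).map _ ≫ (toSt P).map _ = _
      rw [← Functor.map_comp]
      congr 1
      exact ObjectProperty.hom_ext _ (biprod.lift_fst _ _)
    rw [this]
    apply (shiftFunctor (St P) (1 : ℤ)).map_injective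
    rw [Functor.map_comp, Functor.map_comp, hα, Preadditive.neg_comp, Category.assoc, ← hδ', ← c₃,
      Preadditive.neg_comp, neg_neg]
  · change T.mor₂ ≫ φ₂.hom = (φ₁.hom ≫ ψ.inv) ≫ (toSt P).map _
    rw [c₁, Category.assoc]
    congr 1
    change _ = (toSt P).map _ ≫ (toSt P).map _
    rw [← Functor.map_comp]
    congr 1
    exact ObjectProperty.hom_ext _ (biprod.inl_desc _ _).symm
  · change T.mor₃ ≫ α.hom⟦(1 : ℤ)⟧' = φ₂.hom ≫ shiftδ e h'
    rw [hα, hδ, Preadditive.comp_neg, Preadditive.comp_neg, reassoc_of% c₂]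

/-- A square commuting stably can be made to commute strictly: the error factors through an
injective, so it extends along `f` and can be subtracted from `b` without changing its class.
Cokernels then give the third morphism. -/
lemma exists_morphism_conflationTriangle {X Y Z X' Y' Z' : P.FullSubcategory} {f : X ⟶ Y}
    {g : Y ⟶ Z} {f' : X' ⟶ Y'} {g' : Y' ⟶ Z'} (h : IsConflation P f g)
    (h' : IsConflation P f' g') (a : (toSt P).obj X ⟶ (toSt P).obj X')
    (b : (toSt P).obj Y ⟶ (toSt P).obj Y') (hab : (toSt P).map f ≫ b = a ≫ (toSt P).map f') :
    ∃ c : (toSt P).obj Z ⟶ (toSt P).obj Z', (toSt P).map g ≫ c = b ≫ (toSt P).map g' ∧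
      shiftδ e h ≫ a⟦(1 : ℤ)⟧' = c ≫ shiftδ e h' := by
  obtain ⟨a, rfl⟩ := (toSt P).map_surjective a
  obtain ⟨b, rfl⟩ := (toSt P).map_surjective b
  rw [← Functor.map_comp, ← Functor.map_comp, toSt_map_eq_iff] at hab
  obtain ⟨Q, s, t, hQ, hst⟩ := hab
  obtain ⟨s, rfl⟩ := hQ.isInjective f g h s
  have hb : (toSt P).map (b - s ≫ t) = (toSt P).map b := by
    rw [toSt_map_eq_iff]
    exact ⟨Q, s, -t, hQ, by simp⟩
  have hab : f ≫ (b - s ≫ t) = a ≫ f' := by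
    rw [Preadditive.comp_sub, ← Category.assoc f, hst, sub_sub_cancel]
  obtain ⟨c, hc⟩ := h.exists_desc ((b - s ≫ t) ≫ g') (by
    rw [reassoc_of% hab, h'.w, comp_zero])
  refine ⟨(toSt P).map c, ?_, (shiftδ_naturality e h h' hab hc).symm⟩
  rw [← hb, ← Functor.map_comp, hc, Functor.map_comp]

variable [∀ n : ℤ, (shiftFunctor (St P) n).Additive]

/-- The pretriangulated structure of the stable category of a Frobenius category. -/
@[reducible]
def stPretriangulated : Pretriangulated (St P) where
  distinguishedTriangles := { T | IsStandardTriangle e T }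
  isomorphic_distinguished _ h _ φ := h.of_iso φ
  contractible_distinguished := isStandardTriangle_contractible e
  distinguished_cocone_triangle {X Y} f := by
    obtain ⟨Y', Z, f', g, φ, h, hf⟩ := exists_conflation_of_hom (X := X.as) f
    refine ⟨(toSt P).obj Z, φ.hom ≫ (toSt P).map g, shiftδ e h,
      (isStandardTriangle_conflationTriangle e h).of_iso
        (Triangle.isoMk _ _ (Iso.refl X) φ (Iso.refl _) ?_ ?_ ?_)⟩
    · exact hf.trans (Category.id_comp _).symm
    · exact Category.comp_id _
    · change shiftδ e h ≫ (𝟙 _)⟦(1 : ℤ)⟧' = 𝟙 _ ≫ shiftδ e h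
      rw [CategoryTheory.Functor.map_id, Category.comp_id, Category.id_comp]
  rotate_distinguished_triangle T := by
    refine ⟨?_, isStandardTriangle_of_rotate e T⟩
    rintro ⟨X, Y, Z, f, g, h, ⟨φ⟩⟩
    exact (isStandardTriangle_rotate e h).of_iso ((Pretriangulated.rotate (St P)).mapIso φ)
  complete_distinguished_triangle_morphism := by
    intro T T' hT hT' a b hab
    obtain ⟨X, Y, Z, f, g, h, α, β, γ, h1, h2, h3⟩ := hT.exists_iso
    obtain ⟨X', Y', Z', f', g', h', α', β', γ', h1', h2', h3'⟩ := hT'.exists_iso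
    obtain ⟨c, hc, hc'⟩ := exists_morphism_conflationTriangle e h h'
      (α.inv ≫ a ≫ α'.hom) (β.inv ≫ b ≫ β'.hom) (by
        rw [← cancel_epi α.hom, ← reassoc_of% h1, Iso.hom_inv_id_assoc, reassoc_of% hab, h1']
        simp)
    refine ⟨γ.hom ≫ c ≫ γ'.inv, ?_, ?_⟩
    · rw [reassoc_of% h2, reassoc_of% hc, ← cancel_mono γ'.hom]
      simp [h2']
    · rw [← cancel_mono (α'.hom⟦(1 : ℤ)⟧'), Category.assoc, Category.assoc, Category.assoc,
        Category.assoc, h3', Iso.inv_hom_id_assoc, ← hc', ← reassoc_of% h3]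
      simp only [← Functor.map_comp]
      simp

/-- Up to isomorphism the two composable morphisms are inflations, and the octahedron is the diagram
of the cokernels of `f`, `g` and f ≫ g. -/
lemma st_isTriangulated :
    letI := stPretriangulated e
    IsTriangulated (St P) := by
  let := stPretriangulated e
  refine IsTriangulated.mk' fun X₁ X₂ X₃ u₁₂ u₂₃ => ?_
  obtain ⟨X₂', Z₁₂, f, v₁₂, φ₂, h₁₂, hf⟩ := exists_conflation_of_hom (X := X₁.as) u₁₂
  obtain ⟨X₃', Z₂₃, g, v₂₃, φ₃, h₂₃, hg⟩ := exists_conflation_of_hom (φ₂.inv ≫ u₂₃)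
  obtain ⟨Z₁₃, v₁₃, m₁, m₃, h₁₃, hm, hm₁, hm₃⟩ := exists_isConflation_comp h₁₂ h₂₃
  refine ⟨_, _, _, _, _, _, (toSt P).map f, (toSt P).map g, Iso.refl _, φ₂, φ₃,
    hf.trans (Category.id_comp _).symm, by rw [← hg, Category.assoc, Iso.hom_inv_id_assoc],
    (toSt P).map v₁₂, shiftδ e h₁₂, isStandardTriangle_conflationTriangle e h₁₂,
    (toSt P).map v₂₃, shiftδ e h₂₃, isStandardTriangle_conflationTriangle e h₂₃,
    (toSt P).map v₁₃, shiftδ e h₁₃, ?_,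
    ⟨{ m₁ := (toSt P).map m₁
       m₃ := (toSt P).map m₃
       comm₁ := ?_
       comm₂ := ?_
       comm₃ := ?_
       comm₄ := ?_
       mem := ?_ }⟩⟩
  · rw [← Functor.map_comp]
    exact isStandardTriangle_conflationTriangle e h₁₃
  · rw [← Functor.map_comp, ← Functor.map_comp, hm₁]
  · exact (shiftδ_naturality e h₁₂ h₁₃ (a := 𝟙 _) (by simp) hm₁).trans (by simp)
  · rw [← Functor.map_comp, hm₃]
  · exact (shiftδ_naturality e h₁₃ h₂₃ (b := 𝟙 _) (by simp) (by simp [hm₃])).symm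
  · rw [← shiftδ_naturality e h₂₃ hm (c := 𝟙 _) hm₁.symm (by simp [hm₃]),
      CategoryTheory.Functor.map_id, Category.id_comp]
    exact isStandardTriangle_conflationTriangle e hm

end Triangulation

section

variable {C : Type u} [Category.{v} C] [Abelian C] (P : ObjectProperty C) [IsFrobenius P]

/-- The standard triangulated structure of the stable category of a Frobenius category. -/
@[reducible]
def stableTriangulation : StableTriangulation P :=
  letI := shiftOfEquivalence (suspension P)
  have hs : ∀ n : ℤ, (shiftFunctor (St P) n).Additive := shiftFunctor_additive
  let e : suspension P ≅ shiftFunctor (St P) (1 : ℤ) := shiftOfEquivalenceOneIso (suspension P)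
  { shift_additive := hs
    pretriangulated := stPretriangulated e
    isTriangulated := st_isTriangulated e
    susp _ _ hip hJ := shiftδIso e hip hJ
    susp_naturality _ _ _ _ h _ h' _ _ _ _ hb hc := shiftδ_naturality e h h' hb hc
    distinguished_iff T := by
      constructor
      · rintro ⟨X, Y, Z, f, g, h, hT⟩
        obtain ⟨c, b, hb, hc⟩ := exists_connecting h (hull X).conflation (hull X).injective (𝟙 X)
        rw [Category.id_comp] at hb
        refine ⟨X, Y, Z, _, _, f, g, _, _, b, c, h, (hull X).conflation, (hull X).injective, hb,
          hc, ?_⟩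
        rw [shiftδIso_hom, ← shiftδ_eq e h _ hb hc]
        exact hT
      · rintro ⟨X, Y, Z, J, W, f, g, i, p, b, c, h, hip, hJ, hb, hc, hT⟩
        rw [shiftδIso_hom, ← shiftδ_eq e h _ hb hc] at hT
        exact ⟨X, Y, Z, f, g, h, hT⟩ }

end

/-! ### Functors between stable categories -/

section StableFunctor

variable {C : Type u} [Category.{v} C] [Abelian C] {P : ObjectProperty C}
  {D : Type u₁} [Category.{v₁} D] [Abelian D] {P' : ObjectProperty D}

/-- The functor takes short exact sequences to short exact sequences. -/
def PreservesConflations (F : P.FullSubcategory ⥤ P'.FullSubcategory) : Prop :=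
  ∀ ⦃X Y Z : P.FullSubcategory⦄ (f : X ⟶ Y) (g : Y ⟶ Z), IsConflation P f g →
    IsConflation P' (F.map f) (F.map g)

/-- The functor takes projective objects to projective objects. -/
def PreservesProjectives (F : P.FullSubcategory ⥤ P'.FullSubcategory) : Prop :=
  ∀ ⦃Q : P.FullSubcategory⦄, IsProjective P Q → IsProjective P' (F.obj Q)

/-- The functor takes injective objects to injective objects. -/
def PreservesInjectives (F : P.FullSubcategory ⥤ P'.FullSubcategory) : Prop :=
  ∀ ⦃Q : P.FullSubcategory⦄, IsInjective P Q → IsInjective P' (F.obj Q)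

/-- A lifting problem for `F.obj Q` transposes to one for `Q`, against a sequence that is still
exact. -/
lemma preservesProjectives_of_adjunction {F : P.FullSubcategory ⥤ P'.FullSubcategory}
    {G : P'.FullSubcategory ⥤ P.FullSubcategory} (adj : F ⊣ G) (hG : PreservesConflations G) :
    PreservesProjectives F := by
  intro Q hQ X Y Z f g h t
  obtain ⟨s, hs⟩ := hQ _ _ (hG f g h) (adj.homEquiv _ _ t)
  exact ⟨(adj.homEquiv _ _).symm s, by
    rw [← adj.homEquiv_naturality_right_symm, hs, Equiv.symm_apply_apply]⟩

lemma preservesInjectives_of_adjunction {F : P.FullSubcategory ⥤ P'.FullSubcategory}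
    {G : P'.FullSubcategory ⥤ P.FullSubcategory} (adj : F ⊣ G) (hF : PreservesConflations F) :
    PreservesInjectives G := by
  intro Q hQ X Y Z f g h t
  obtain ⟨s, hs⟩ := hQ _ _ (hF f g h) ((adj.homEquiv _ _).symm t)
  exact ⟨adj.homEquiv _ _ s, by
    rw [← adj.homEquiv_naturality_left, hs, Equiv.apply_symm_apply]⟩

lemma PreservesInjectives.preservesProjectives [IsFrobenius P] [IsFrobenius P']
    {F : P.FullSubcategory ⥤ P'.FullSubcategory} (hF : PreservesInjectives F) :
    PreservesProjectives F :=
  fun _ hQ => (hF hQ.isInjective).isProjective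

lemma PreservesProjectives.preservesInjectives [IsFrobenius P] [IsFrobenius P']
    {F : P.FullSubcategory ⥤ P'.FullSubcategory} (hF : PreservesProjectives F) :
    PreservesInjectives F :=
  fun _ hQ => (hF hQ.isProjective).isInjective

section

variable [P.ContainsZero] [P.IsClosedUnderExtensions] [P'.ContainsZero]
  [P'.IsClosedUnderExtensions]

/-- The functor between stable categories induced by an additive functor which preserves projective
objects. -/
def stFunctor (F : P.FullSubcategory ⥤ P'.FullSubcategory) [F.Additive]
    (hF : PreservesProjectives F) : St P ⥤ St P' :=
  CategoryTheory.Quotient.lift (stableRel P) (F ⋙ toSt P') (by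
    rintro X Y f g ⟨Q, a, b, hQ, hab⟩
    refine (toSt_map_eq_iff _ _).2 ⟨F.obj Q, F.map a, F.map b, hF hQ, ?_⟩
    rw [← F.map_comp, hab, F.map_sub])

omit [P.ContainsZero] [P.IsClosedUnderExtensions] in
lemma induces_stFunctor (F : P.FullSubcategory ⥤ P'.FullSubcategory) [F.Additive]
    (hF : PreservesProjectives F) : Induces F (stFunctor F hF) :=
  CategoryTheory.Quotient.lift_spec _ _ _

/-- Adjunctions descend to stable categories. -/
def stAdjunction {F : P.FullSubcategory ⥤ P'.FullSubcategory} [F.Additive]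
    {G : P'.FullSubcategory ⥤ P.FullSubcategory} [G.Additive] (adj : F ⊣ G)
    (hF : PreservesProjectives F) (hG : PreservesProjectives G) :
    stFunctor F hF ⊣ stFunctor G hG :=
  Adjunction.mkOfUnitCounit
    { unit :=
        { app X := (toSt P).map (adj.unit.app X.as)
          naturality X Y f := by
            obtain ⟨f, rfl⟩ := (toSt P).map_surjective f
            exact congrArg (toSt P).map (adj.unit.naturality f) }
      counit :=
        { app X := (toSt P').map (adj.counit.app X.as)
          naturality X Y f := by
            obtain ⟨f, rfl⟩ := (toSt P').map_surjective f
            exact congrArg (toSt P').map (adj.counit.naturality f) }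
      left_triangle := by
        ext X
        have := congrArg (toSt P').map (adj.left_triangle_components X.as)
        refine Eq.trans ?_ this
        exact (congrArg (_ ≫ ·) (Category.id_comp _)).trans ((toSt P').map_comp _ _).symm
      right_triangle := by
        ext X
        have := congrArg (toSt P).map (adj.right_triangle_components X.as)
        refine Eq.trans ?_ this
        exact (congrArg (_ ≫ ·) (Category.id_comp _)).trans ((toSt P).map_comp _ _).symm }

end

section

open Pretriangulated StableTriangulation

variable [IsFrobenius P] [IsFrobenius P'] [StableTriangulation P] [StableTriangulation P']
  (F : P.FullSubcategory ⥤ P'.FullSubcategory) [F.Additive] (hF : PreservesConflations F)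
  (hF' : PreservesProjectives F)

omit [Abelian C] [Abelian D] in
-- The diagram chase behind naturality of the commutation with the shift, in arbitrary categories.
lemma map_comp_conj_hom (S : C ⥤ D) {A A' B B' : C} {E E' : D} (σ : A ≅ B) (σ' : A' ≅ B')
    (c : A ⟶ A') (g : B ⟶ B') (h : c ≫ σ'.hom = σ.hom ≫ g) (τ : S.obj A ≅ E) (τ' : S.obj A' ≅ E')
    (k : E ⟶ E') (h' : S.map c ≫ τ'.hom = τ.hom ≫ k) :
    S.map g ≫ (S.mapIso σ'.symm ≪≫ τ').hom = (S.mapIso σ.symm ≪≫ τ).hom ≫ k := by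
  have hg : g = σ.inv ≫ c ≫ σ'.hom := by rw [h, Iso.inv_hom_id_assoc]
  rw [hg, Iso.trans_hom, Iso.trans_hom, Functor.mapIso_hom, Functor.mapIso_hom, Iso.symm_hom,
    Iso.symm_hom, ← S.map_comp_assoc, Category.assoc, Category.assoc, Iso.hom_inv_id,
    Category.comp_id, S.map_comp, Category.assoc, Category.assoc, h']

omit [Abelian C] [Abelian D] in
lemma map_comp_conj_hom' (S : C ⥤ D) {A A' B : C} {E : D} (σ : A ≅ B) (c : A' ⟶ A)
    (τ : S.obj A ≅ E) :
    S.map (c ≫ σ.hom) ≫ (S.mapIso σ.symm ≪≫ τ).hom = S.map c ≫ τ.hom := by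
  rw [Iso.trans_hom, Functor.mapIso_hom, Iso.symm_hom, ← S.map_comp_assoc, Category.assoc,
    Iso.hom_inv_id, Category.comp_id]

/-- The commutation with the shift by `1` of the functor induced by an exact functor. -/
def stFunctorShiftIso : shiftFunctor (St P) (1 : ℤ) ⋙ stFunctor F hF' ≅
    stFunctor F hF' ⋙ shiftFunctor (St P') (1 : ℤ) :=
  NatIso.ofComponents (fun X =>
    (stFunctor F hF').mapIso (susp _ _ (hull X.as).conflation (hull X.as).injective).symm ≪≫
      susp _ _ (hF _ _ (hull X.as).conflation)
        (hF'.preservesInjectives (hull X.as).injective)) (by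
    intro X Y f
    obtain ⟨f, rfl⟩ := (toSt P).map_surjective f
    obtain ⟨c, b, hb, hc⟩ := exists_connecting (hull X.as).conflation (hull Y.as).conflation
      (hull Y.as).injective f
    exact map_comp_conj_hom (stFunctor F hF') _ _ _ _
      (susp_naturality _ _ _ _ (hull X.as).conflation (hull X.as).injective
        (hull Y.as).conflation (hull Y.as).injective f b c hb hc) _ _ _
      (susp_naturality _ _ _ _ (hF _ _ (hull X.as).conflation)
        (hF'.preservesInjectives (hull X.as).injective) (hF _ _ (hull Y.as).conflation)
        (hF'.preservesInjectives (hull Y.as).injective) (F.map f) (F.map b) (F.map c)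
        (by rw [← F.map_comp, hb, F.map_comp]) (by rw [← F.map_comp, hc, F.map_comp])))

/-- The commutation isomorphism is defined with chosen hulls, while a distinguished triangle comes
with an arbitrary injective inflation; naturality of `susp` bridges the two. -/
lemma stFunctor_map_susp {X J W : P.FullSubcategory} {i : X ⟶ J} {p : J ⟶ W}
    (h : IsConflation P i p) (hJ : IsInjective P J) :
    (stFunctor F hF').map (susp i p h hJ).hom ≫
        (stFunctorShiftIso F hF hF').hom.app ((toSt P).obj X) =
      (susp _ _ (hF i p h) (hF'.preservesInjectives hJ)).hom := by
  obtain ⟨c, b, hb, hc⟩ := exists_connecting h (hull X).conflation (hull X).injective (𝟙 X)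
  have h₁ := susp_naturality _ _ _ _ h hJ (hull X).conflation (hull X).injective (𝟙 X) b c hb hc
  have h₂ := susp_naturality _ _ _ _ (hF _ _ h) (hF'.preservesInjectives hJ)
    (hF _ _ (hull X).conflation) (hF'.preservesInjectives (hull X).injective)
    (F.map (𝟙 X)) (F.map b) (F.map c) (by rw [← F.map_comp, hb, F.map_comp])
    (by rw [← F.map_comp, hc, F.map_comp])
  rw [CategoryTheory.Functor.map_id, CategoryTheory.Functor.map_id, Category.comp_id] at h₁
  rw [CategoryTheory.Functor.map_id, CategoryTheory.Functor.map_id, CategoryTheory.Functor.map_id,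
    Category.comp_id] at h₂
  rw [← h₁, ← h₂]
  exact map_comp_conj_hom' (stFunctor F hF') _ _ _

include hF in
-- The functor carries the whole diagram defining a standard triangle to another such diagram, since
-- it preserves injectives as well; only the third morphism needs the commutation isomorphism.
lemma isTriangulatedFunctor_stFunctor : IsTriangulatedFunctor (stFunctor F hF') := by
  let := commShiftOfOne (stFunctorShiftIso F hF hF')
  refine ⟨inferInstance, ⟨fun T hT => ?_⟩⟩
  obtain ⟨X, Y, Z, J, W, f, g, i, p, b, c, h, hip, hJ, hb, hc, ⟨φ⟩⟩ :=
    (distinguished_iff T).1 hT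
  refine (distinguished_iff _).2 ⟨_, _, _, _, _, F.map f, F.map g, F.map i, F.map p, F.map b,
    F.map c, hF _ _ h, hF _ _ hip, hF'.preservesInjectives hJ, by rw [← F.map_comp, hb],
    by rw [← F.map_comp, hc, F.map_comp], ⟨(stFunctor F hF').mapTriangle.mapIso φ ≪≫
      Triangle.isoMk _ _ (Iso.refl _) (Iso.refl _) (Iso.refl _) ?_ ?_ ?_⟩⟩
  · exact (Category.comp_id _).trans (Category.id_comp _).symm
  · exact (Category.comp_id _).trans (Category.id_comp _).symm
  · have key : (stFunctor F hF').map ((toSt P).map c ≫ (susp i p hip hJ).hom) ≫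
        (commShiftIsoOfOne (stFunctorShiftIso F hF hF') 1).hom.app ((toSt P).obj X) =
          (toSt P').map (F.map c) ≫ (susp _ _ (hF i p hip) (hF'.preservesInjectives hJ)).hom := by
      rw [commShiftIsoOfOne_one, Functor.map_comp, Category.assoc, stFunctor_map_susp]
      rfl
    refine (congrArg (_ ≫ ·) (CategoryTheory.Functor.map_id _ _)).trans ?_
    exact (Category.comp_id _).trans (key.trans (Category.id_comp _).symm)

end

end StableFunctor

/-! ### Exactness in the category of triples -/

section Rep

open scoped ZeroObject

lemma map_exists_lift {C : Type u} [Category.{v} C] [Abelian C] {D : Type u₁} [Category.{v₁} D]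
    [Abelian D] (F : C ⥤ D) [F.Additive] [PreservesFiniteLimits F] {X Y Z : C} {f : X ⟶ Y}
    {g : Y ⟶ Z} {zero : f ≫ g = 0} (h : (ShortComplex.mk f g zero).ShortExact) {T : D}
    (t : T ⟶ F.obj Y) (ht : t ≫ F.map g = 0) : ∃ s : T ⟶ F.obj X, s ≫ F.map f = t := by
  have := h.mono_f
  have he := h.exact.map_of_mono_of_preservesKernel F inferInstance inferInstance
  have hm : Mono ((ShortComplex.mk f g zero).map F).f := F.map_mono f
  exact ⟨he.lift t ht, he.lift_f t ht⟩

variable {A B M : Type w} [Ring A] [Ring B] [AddCommGroup M] [Module A M] [Module Bᵐᵒᵖ M]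
  [SMulCommClass A Bᵐᵒᵖ M]

/-- The morphism `(X, Y)_φ ⟶ (X', Hom_A(M, X'))_1` given by a morphism `X ⟶ X'`. -/
abbrev toTripleP (U : RepH A B M) {X : ModuleCat.{w} A} (f : U.right ⟶ X) :
    U ⟶ triple X _ (𝟙 _) where
  left := U.hom ≫ (homFunctor A B M).map f
  right := f

/-- The morphism `(X, Y)_φ ⟶ (0, Y')_0` given by a morphism `Y ⟶ Y'`. -/
abbrev toTripleQ (U : RepH A B M) {Y : ModuleCat.{w} B} (g : U.left ⟶ Y) :
    U ⟶ triple 0 Y 0 where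
  left := g
  right := 0

variable (A B M) in
/-- The functor `X ↦ (X, Hom_A(M, X))_1`. -/
def tripleP : ModuleCat.{w} A ⥤ RepH A B M where
  obj X := triple X _ (𝟙 _)
  map f := { left := (homFunctor A B M).map f, right := f }

variable (A B M) in
/-- The functor `Y ↦ (0, Y)_0`. -/
def tripleQ : ModuleCat.{w} B ⥤ RepH A B M where
  obj Y := triple 0 Y 0
  map g := { left := g, right := 𝟙 0 }

variable {U V W : RepH A B M} {f : U ⟶ V} {g : V ⟶ W}

/-- The first component is left adjoint to X ↦ (X, Hom_A(M, X))_1, so it preserves epimorphisms;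
likewise the second component with Y ↦ (0, Y)_0. -/
lemma epi_right [Epi g] : Epi g.right where
  left_cancellation a b hab := by
    have : toTripleP _ a = toTripleP _ b := by
      rw [← cancel_epi g]
      ext : 1
      · change g.left ≫ W.hom ≫ (homFunctor A B M).map a =
          g.left ≫ W.hom ≫ (homFunctor A B M).map b
        have hg : g.left ≫ W.hom = V.hom ≫ (homFunctor A B M).map g.right := g.w
        rw [reassoc_of% hg, reassoc_of% hg, ← Functor.map_comp, hab, Functor.map_comp]
      · exact hab
    exact congrArg CommaMorphism.right this

lemma epi_left [Epi g] : Epi g.left where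
  left_cancellation a b hab := by
    have : toTripleQ _ a = toTripleQ _ b := by
      rw [← cancel_epi g]
      ext : 1
      · exact hab
      · exact (isZero_zero _).eq_of_tgt _ _
    exact congrArg CommaMorphism.left this

lemma shortExact_right {zero : f ≫ g = 0} (h : (ShortComplex.mk f g zero).ShortExact) :
    (ShortComplex.mk f.right g.right (congrArg CommaMorphism.right zero)).ShortExact := by
  have := h.mono_f
  have := h.epi_g
  exact
    { exact := h.exact.map_of_mono_of_preservesKernel (Comma.snd _ _) inferInstance inferInstance
      mono_f := (Comma.snd _ _).map_mono f
      epi_g := epi_right (g := g) }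

lemma shortExact_left {zero : f ≫ g = 0} (h : (ShortComplex.mk f g zero).ShortExact) :
    (ShortComplex.mk f.left g.left (congrArg CommaMorphism.left zero)).ShortExact := by
  have := h.mono_f
  have := h.epi_g
  exact
    { exact := h.exact.map_of_mono_of_preservesKernel (Comma.fst _ _) inferInstance inferInstance
      mono_f := (Comma.fst _ _).map_mono f
      epi_g := epi_left (g := g) }

lemma mono_of_components (hl : Mono f.left) (hr : Mono f.right) : Mono f where
  right_cancellation a b hab := by
    ext : 1
    · exact (cancel_mono f.left).1 (congrArg CommaMorphism.left hab)
    · exact (cancel_mono f.right).1 (congrArg CommaMorphism.right hab)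

lemma epi_of_components (hl : Epi g.left) (hr : Epi g.right) : Epi g where
  left_cancellation a b hab := by
    ext : 1
    · exact (cancel_epi g.left).1 (congrArg CommaMorphism.left hab)
    · exact (cancel_epi g.right).1 (congrArg CommaMorphism.right hab)

lemma shortExact_of_components {zl : f.left ≫ g.left = 0} {zr : f.right ≫ g.right = 0}
    (hl : (ShortComplex.mk f.left g.left zl).ShortExact)
    (hr : (ShortComplex.mk f.right g.right zr).ShortExact) :
    ∃ zero : f ≫ g = 0, (ShortComplex.mk f g zero).ShortExact := by
  refine ⟨CommaMorphism.ext zl zr,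
    { exact := (ShortComplex.exact_iff_exact_up_to_refinements _).2 fun T t ht => ?_
      mono_f := mono_of_components hl.mono_f hr.mono_f
      epi_g := epi_of_components hl.epi_g hr.epi_g }⟩
  obtain ⟨a, ha⟩ := shortExact_exists_lift hl t.left (congrArg CommaMorphism.left ht)
  obtain ⟨b, hb⟩ := shortExact_exists_lift hr t.right (congrArg CommaMorphism.right ht)
  refine ⟨T, 𝟙 _, inferInstance, { left := a, right := b, w := ?_ }, ?_⟩
  -- The componentwise lifts form a morphism of triples because Hom_A(M, -) preserves the
  -- monomorphism `f.right`.
  · have := hr.mono_f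
    have hm : Mono ((homFunctor A B M).map f.right) := (homFunctor A B M).map_mono f.right
    have hf : f.left ≫ V.hom = U.hom ≫ (homFunctor A B M).map f.right := f.w
    have ht' : t.left ≫ V.hom = T.hom ≫ (homFunctor A B M).map t.right := t.w
    rw [← cancel_mono ((homFunctor A B M).map f.right)]
    change (a ≫ U.hom) ≫ _ = (T.hom ≫ (homFunctor A B M).map b) ≫ _
    rw [Category.assoc, ← hf, reassoc_of% ha, ht', Category.assoc, ← Functor.map_comp, hb]
  · rw [Category.id_comp]
    exact (CommaMorphism.ext ha hb).symm

/-- The morphism between the kernels of the structure morphisms of two triples. -/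
abbrev kernelMap (f : U ⟶ V) : kernel U.hom ⟶ kernel V.hom :=
  kernel.map U.hom V.hom f.left ((homFunctor A B M).map f.right) f.w.symm

/-- Part of the snake lemma. A lift `y` of an element of the last kernel need not lie in the kernel
of `V.hom`, but left exactness puts its image in Hom_A(M, U.right). Since `U.hom` is epi that image
comes from `U.left`, and `y` can be corrected. -/
lemma shortExact_kernelMap {zero : f ≫ g = 0} (h : (ShortComplex.mk f g zero).ShortExact)
    (hU : Epi U.hom) : ∃ zero' : kernelMap f ≫ kernelMap g = 0,
      (ShortComplex.mk (kernelMap f) (kernelMap g) zero').ShortExact := by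
  have hl := shortExact_left h
  have hr := shortExact_right h
  have := hl.mono_f
  have := hr.mono_f
  have hm : Mono ((homFunctor A B M).map f.right) := (homFunctor A B M).map_mono f.right
  have hf : f.left ≫ V.hom = U.hom ≫ (homFunctor A B M).map f.right := f.w
  have hg : g.left ≫ W.hom = V.hom ≫ (homFunctor A B M).map g.right := g.w
  refine ⟨?_, shortExact_of_refinements _ _ _ (fun T t ht => ?_) (fun T t ht => ?_)
    (fun T t => ?_)⟩
  · rw [← cancel_mono (kernel.ι W.hom)]
    simpa using congrArg (kernel.ι U.hom ≫ ·) (congrArg CommaMorphism.left zero)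
  · rw [← cancel_mono (kernel.ι U.hom), ← cancel_mono f.left]
    simpa using ht =≫ kernel.ι V.hom
  · obtain ⟨s, hs⟩ := shortExact_exists_lift hl (t ≫ kernel.ι V.hom) (by
      simpa using ht =≫ kernel.ι W.hom)
    have hs0 : s ≫ U.hom = 0 := by
      rw [← cancel_mono ((homFunctor A B M).map f.right), Category.assoc, ← hf, reassoc_of% hs]
      simp
    refine ⟨T, 𝟙 _, inferInstance, kernel.lift _ s hs0, ?_⟩
    rw [← cancel_mono (kernel.ι V.hom)]
    simp [hs]
  · obtain ⟨T₁, r₁, _, y, hy⟩ := shortExact_surjective hl (t ≫ kernel.ι W.hom)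
    obtain ⟨x, hx⟩ := map_exists_lift (homFunctor A B M) hr (y ≫ V.hom) (by
      rw [Category.assoc, ← hg, ← reassoc_of% hy]
      simp)
    obtain ⟨T₂, r₂, _, z, hz⟩ := surjective_up_to_refinements_of_epi U.hom x
    have hyz : (r₂ ≫ y - z ≫ f.left) ≫ V.hom = 0 := by
      rw [Preadditive.sub_comp, Category.assoc, Category.assoc, hf, ← hx, reassoc_of% hz, sub_self]
    refine ⟨T₂, r₂ ≫ r₁, inferInstance, kernel.lift _ _ hyz, ?_⟩
    rw [← cancel_mono (kernel.ι W.hom)]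
    have h0 : f.left ≫ g.left = 0 := congrArg CommaMorphism.left zero
    simp [hy, h0]

/-! ### Injective triples -/

/-- A right adjoint of the exact functor (X, Y)_φ ↦ X preserves injectives. -/
instance injective_tripleP (J : ModuleCat.{w} A) [Injective J] :
    Injective (triple J _ (𝟙 _) : RepH A B M) where
  factors {U V} t f _ := by
    have : Mono f.right := (Comma.snd _ _).map_mono f
    refine ⟨toTripleP V (Injective.factorThru t.right f.right), ?_⟩
    have hf : f.left ≫ V.hom = U.hom ≫ (homFunctor A B M).map f.right := f.w
    have ht : t.left ≫ 𝟙 _ = U.hom ≫ (homFunctor A B M).map t.right := t.w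
    ext : 1
    · change f.left ≫ V.hom ≫ _ = t.left
      rw [reassoc_of% hf, ← Functor.map_comp, Injective.comp_factorThru, ← ht, Category.comp_id]
    · exact Injective.comp_factorThru _ _

instance injective_tripleQ (K : ModuleCat.{w} B) [Injective K] :
    Injective (triple 0 K 0 : RepH A B M) where
  factors {U V} t f _ := by
    have : Mono f.left := (Comma.fst _ _).map_mono f
    refine ⟨toTripleQ V (Injective.factorThru t.left f.left), ?_⟩
    ext : 1
    · exact Injective.comp_factorThru _ _
    · exact (isZero_zero _).eq_of_tgt _ _

instance : EnoughInjectives (RepH A B M) where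
  presentation U := ⟨
    { J := (triple (Injective.under U.right) _ (𝟙 _) : RepH A B M) ⊞
        triple 0 (Injective.under U.left) 0
      f := biprod.lift (toTripleP U (Injective.ι U.right)) (toTripleQ U (Injective.ι U.left))
      mono := Preadditive.mono_of_cancel_zero _ fun t ht => by
        have h₁ := congrArg CommaMorphism.right (ht =≫ biprod.fst)
        have h₂ := congrArg CommaMorphism.left (ht =≫ biprod.snd)
        rw [Category.assoc, biprod.lift_fst, zero_comp] at h₁
        rw [Category.assoc, biprod.lift_snd, zero_comp] at h₂
        exact CommaMorphism.ext (zero_of_comp_mono _ h₂) (zero_of_comp_mono _ h₁) }⟩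

/-- The first component of an injective triple is injective. -/
lemma injective_right {U : RepH A B M} (hU : Injective U) : Injective U.right where
  factors {X X'} t f _ := by
    -- Lifting problems in modules are embedded as problems on triples (X, 0)_0, where compatibility
    -- is automatic.
    let f' : (triple X 0 0 : RepH A B M) ⟶ triple X' 0 0 := { left := 𝟙 _, right := f }
    let t' : (triple X 0 0 : RepH A B M) ⟶ U :=
      { left := 0, right := t, w := (isZero_zero _).eq_of_src _ _ }
    have : Mono f' := mono_of_components (by dsimp [f']; infer_instance) (by dsimp [f']; infer_instance)
    exact ⟨(Injective.factorThru t' f').right,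
      congrArg CommaMorphism.right (Injective.comp_factorThru t' f')⟩

end Rep

/-! ### Co-resolving subcategories -/

section Coresolving

open scoped ZeroObject

variable {C : Type u} [Category.{v} C] [Abelian C] {P : ObjectProperty C}

namespace IsCoresolving

variable (hP : IsCoresolving P)

include hP

lemma containsZero : P.ContainsZero where
  exists_zero := ⟨0, isZero_zero _, hP.injective_mem _ inferInstance⟩

lemma isClosedUnderExtensions : P.IsClosedUnderExtensions where
  prop_X₂_of_shortExact hS h₁ h₃ := hP.extension_mem _ hS h₁ h₃

variable [EnoughInjectives C]

lemma exists_injective_conflation (X : P.FullSubcategory) :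
    ∃ (J W : P.FullSubcategory) (f : X ⟶ J) (g : J ⟶ W), IsConflation P f g ∧ Injective J.obj := by
  have h : (ShortComplex.mk (Injective.ι X.obj) (cokernel.π _)
      (cokernel.condition _)).ShortExact :=
    { exact := ShortComplex.exact_cokernel _
      mono_f := by dsimp; infer_instance
      epi_g := by dsimp; infer_instance }
  have hJ : P (Injective.under X.obj) := hP.injective_mem _ inferInstance
  exact ⟨⟨_, hJ⟩, ⟨_, hP.cokernel_mem _ h X.2 hJ⟩, ObjectProperty.homMk (Injective.ι X.obj),
    ObjectProperty.homMk (cokernel.π _), ⟨_, h⟩, inferInstanceAs (Injective (Injective.under _))⟩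

/-- An embedding into an ambient injective has its cokernel in `P`, so a relatively injective object
is a direct summand of an ambient injective. -/
lemma isInjective_iff (J : P.FullSubcategory) : IsInjective P J ↔ Injective J.obj := by
  constructor
  · intro hJ
    obtain ⟨I, W, f, g, h, hI⟩ := hP.exists_injective_conflation J
    obtain ⟨s, hs⟩ := hJ f g h (𝟙 J)
    exact Retract.injective (Y := I.obj)
      { i := f.hom, r := s.hom, retract := congrArg InducedCategory.Hom.hom hs }
  · intro hJ X Y Z f g h t
    have := h.2.mono_f
    dsimp at this
    exact ⟨ObjectProperty.homMk (Injective.factorThru t.hom f.hom),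
      ObjectProperty.hom_ext _ (Injective.comp_factorThru _ _)⟩

/-- A criterion for a co-resolving subcategory to be a Frobenius category. -/
lemma isFrobenius
    (h₁ : ∀ X : P.FullSubcategory, ∃ (K Q : P.FullSubcategory) (f : K ⟶ Q) (g : Q ⟶ X),
      IsConflation P f g ∧ IsProjective P Q)
    (h₂ : ∀ X : P.FullSubcategory, ∃ (K Q : P.FullSubcategory) (f : K ⟶ Q) (g : Q ⟶ X),
      IsConflation P f g ∧ IsInjective P Q)
    (h₃ : ∀ X : P.FullSubcategory, IsInjective P X → IsProjective P X) : IsFrobenius P where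
  toContainsZero := hP.containsZero
  toIsClosedUnderExtensions := hP.isClosedUnderExtensions
  enough_projectives := h₁
  enough_injectives X := by
    obtain ⟨J, W, f, g, h, hJ⟩ := hP.exists_injective_conflation X
    exact ⟨J, W, f, g, h, (hP.isInjective_iff J).2 hJ⟩
  projective_iff_injective X := by
    refine ⟨fun hX => ?_, h₃ X⟩
    -- A projective object splits off its injective cover, hence is injective.
    obtain ⟨K, Q, f, g, h, hQ⟩ := h₂ X
    obtain ⟨s, hs⟩ := hX f g h (𝟙 X)
    intro X' Y Z f' g' h' t
    obtain ⟨t', ht'⟩ := hQ f' g' h' (t ≫ s)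
    exact ⟨t' ≫ g, by rw [← Category.assoc, ht', Category.assoc, hs, Category.comp_id]⟩

end IsCoresolving

/-- Extensions of projective objects are projective. -/
lemma IsConflation.isProjective {X Y Z : P.FullSubcategory} {f : X ⟶ Y} {g : Y ⟶ Z}
    (h : IsConflation P f g) (hX : IsProjective P X) (hZ : IsProjective P Z) :
    IsProjective P Y := by
  intro X' Y' Z' f' g' h' t
  obtain ⟨s, hs⟩ := hZ f g h (𝟙 Z)
  obtain ⟨r, hr⟩ := h.exists_lift (𝟙 Y - g ≫ s) (by simp [hs])
  obtain ⟨a, ha⟩ := hX f' g' h' (f ≫ t)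
  obtain ⟨b, hb⟩ := hZ f' g' h' (s ≫ t)
  refine ⟨r ≫ a + g ≫ b, ?_⟩
  rw [Preadditive.add_comp, Category.assoc, Category.assoc, ha, hb, reassoc_of% hr]
  simp

/-- The direct sum of covers of the outer terms of a short exact sequence covers the middle
term. -/
lemma exists_conflation_of_covers [P.IsClosedUnderExtensions]
    {K U Z A₁ A₀ B₁ B₀ : P.FullSubcategory} {f : K ⟶ U} {g : U ⟶ Z} {i : A₁ ⟶ A₀} {p : A₀ ⟶ K}
    {j : B₁ ⟶ B₀} {q : B₀ ⟶ Z} (h : IsConflation P f g) (hA : IsConflation P i p)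
    (hB : IsConflation P j q) (a : B₀ ⟶ U) (ha : a ≫ g = q) :
    ∃ (N : P.FullSubcategory) (n : N ⟶ biprodObj A₀ B₀) (d : biprodObj A₀ B₀ ⟶ U),
      IsConflation P n d := by
  let d : A₀.obj ⊞ B₀.obj ⟶ U.obj := biprod.desc (p.hom ≫ f.hom) a.hom
  have ha' : a.hom ≫ g.hom = q.hom := congrArg InducedCategory.Hom.hom ha
  have := hA.2.mono_f
  have := hB.2.mono_f
  have := h.2.mono_f
  dsimp at *
  have hd : (ShortComplex.mk (kernel.ι d) d (kernel.condition d)).ShortExact :=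
    { exact := ShortComplex.exact_kernel _
      mono_f := by dsimp; infer_instance
      epi_g := by
        refine (epi_iff_surjective_up_to_refinements _).2 fun T t => ?_
        obtain ⟨T₁, r₁, _, b, hb⟩ := shortExact_surjective hB.2 (t ≫ g.hom)
        obtain ⟨x, hx⟩ := shortExact_exists_lift h.2 (r₁ ≫ t - b ≫ a.hom) (by simp [hb, ha'])
        obtain ⟨T₂, r₂, _, y, hy⟩ := shortExact_surjective hA.2 x
        refine ⟨T₂, r₂ ≫ r₁, inferInstance, biprod.lift y (r₂ ≫ b), ?_⟩
        simp [d, ← reassoc_of% hy, hx] }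
  have hdesc : kernel.ι d ≫ biprod.fst ≫ p.hom ≫ f.hom + kernel.ι d ≫ biprod.snd ≫ a.hom = 0 := by
    have hd' : d = biprod.fst ≫ p.hom ≫ f.hom + biprod.snd ≫ a.hom := biprod.desc_eq
    rw [← Preadditive.comp_add, ← hd', kernel.condition]
  obtain ⟨m, hm⟩ := shortExact_exists_lift hB.2 (kernel.ι d ≫ biprod.snd) (by
    have := hdesc =≫ g.hom
    rw [Preadditive.add_comp] at this
    simpa [h.1, ha'] using this)
  -- As in the horseshoe lemma, the kernel is an extension of `B₁` by `A₁`, which puts it in `P`.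
  have hN : (ShortComplex.mk (kernel.lift d (i.hom ≫ biprod.inl) (by simp [d, reassoc_of% hA.1]))
      m (by rw [← cancel_mono j.hom]; simp [hm])).ShortExact := by
    refine shortExact_of_refinements _ _ _ (fun T t ht => ?_) (fun T t ht => ?_) (fun T t => ?_)
    · have := ht =≫ (kernel.ι d ≫ biprod.fst)
      exact zero_of_comp_mono i.hom (by simpa using this)
    · have h₂ : t ≫ kernel.ι d ≫ biprod.snd = 0 := by
        rw [← hm, ← Category.assoc, ht, zero_comp]
      have h₁ : (t ≫ kernel.ι d ≫ biprod.fst) ≫ p.hom = 0 := by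
        rw [← cancel_mono f.hom]
        have := t ≫= hdesc
        rw [Preadditive.comp_add, reassoc_of% h₂] at this
        simpa using this
      obtain ⟨s, hs⟩ := shortExact_exists_lift hA.2 _ h₁
      refine ⟨T, 𝟙 _, inferInstance, s, ?_⟩
      rw [← cancel_mono (kernel.ι d)]
      apply biprod.hom_ext
      · simp [hs]
      · simp [h₂]
    · obtain ⟨x, hx⟩ := shortExact_exists_lift h.2 ((t ≫ j.hom) ≫ a.hom) (by
        simp [ha', hB.1])
      obtain ⟨T₁, r₁, _, y, hy⟩ := shortExact_surjective hA.2 x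
      refine ⟨T₁, r₁, inferInstance,
        kernel.lift d (biprod.lift (-y) (r₁ ≫ t ≫ j.hom)) (by
          simp only [Category.assoc] at hx
          simp [d, ← reassoc_of% hy, hx]), ?_⟩
      rw [← cancel_mono j.hom]
      simp [hm]
  exact ⟨⟨_, P.prop_X₂_of_shortExact hN A₁.2 B₁.2⟩, ObjectProperty.homMk (kernel.ι d),
    ObjectProperty.homMk d, _, hd⟩

end Coresolving

/-! ### The functors between `𝒳`, `𝒴` and `ℰ(𝒳, M, 𝒴)` -/

section Triples

open scoped ZeroObject

variable {A B M : Type w} [Ring A] [Ring B] [AddCommGroup M] [Module A M] [Module Bᵐᵒᵖ M]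
  [SMulCommClass A Bᵐᵒᵖ M]

instance : (tripleP A B M).Additive where
  map_add := CommaMorphism.ext (homFunctor A B M).map_add rfl

instance : (tripleQ A B M).Additive where
  map_add := CommaMorphism.ext rfl ((isZero_zero _).eq_of_tgt _ _)

lemma shortExact_tripleQ {S : ShortComplex (ModuleCat.{w} B)} (hS : S.ShortExact) :
    (S.map (tripleQ A B M)).ShortExact := by
  have h₀ : (ShortComplex.mk (𝟙 (0 : ModuleCat.{w} A)) (𝟙 (0 : ModuleCat.{w} A))
      ((isZero_zero _).eq_of_tgt _ _)).ShortExact :=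
    { exact := ShortComplex.exact_of_isZero_X₂ _ (isZero_zero _)
      mono_f := by dsimp; infer_instance
      epi_g := by dsimp; infer_instance }
  exact (shortExact_of_components (U := (tripleQ A B M).obj S.X₁) (V := (tripleQ A B M).obj S.X₂)
    (W := (tripleQ A B M).obj S.X₃) (f := (tripleQ A B M).map S.f) (g := (tripleQ A B M).map S.g)
    (zl := S.zero) hS h₀).2

lemma shortExact_tripleP {S : ShortComplex (ModuleCat.{w} A)} (hS : S.ShortExact)
    (h : Epi ((homFunctor A B M).map S.g)) : (S.map (tripleP A B M)).ShortExact := by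
  have := hS.mono_f
  have h₁ : (S.map (homFunctor A B M)).ShortExact :=
    { exact := hS.exact.map_of_mono_of_preservesKernel _ inferInstance inferInstance
      mono_f := (homFunctor A B M).map_mono S.f
      epi_g := h }
  exact (shortExact_of_components (U := (tripleP A B M).obj S.X₁) (V := (tripleP A B M).obj S.X₂)
    (W := (tripleP A B M).obj S.X₃) (f := (tripleP A B M).map S.f) (g := (tripleP A B M).map S.g)
    (zr := S.zero) h₁ hS).2

variable {𝒳 : ObjectProperty (ModuleCat.{w} A)} {𝒴 : ObjectProperty (ModuleCat.{w} B)}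

lemma tripleProp.epi {U : RepH A B M} (hU : tripleProp M 𝒳 𝒴 U) : Epi U.hom :=
  (ModuleCat.epi_iff_surjective _).2 hU.2.2

lemma preservesConflations_projX : PreservesConflations (projX M 𝒳 𝒴) :=
  fun _ _ _ _ _ h => ⟨_, shortExact_right h.2⟩

lemma preservesConflations_projY [𝒴.IsClosedUnderExtensions]
    (hHom : ∀ X, 𝒳 X → 𝒴 ((homFunctor A B M).obj X)) :
    PreservesConflations (projY M 𝒳 𝒴 hHom) :=
  fun _ _ _ _ _ h => ⟨_, shortExact_left h.2⟩

lemma preservesConflations_kerY : PreservesConflations (kerY M 𝒳 𝒴) :=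
  fun U _ _ _ _ h => shortExact_kernelMap h.2 U.2.epi

variable [𝒴.IsClosedUnderIsomorphisms]

lemma prop_of_tripleProp_q {Y : ModuleCat.{w} B} (h : tripleProp M 𝒳 𝒴 (triple 0 Y 0)) : 𝒴 Y :=
  𝒴.prop_of_iso kernelZeroIsoSource h.2.1

/-- Embed (X, Hom_A(M, X)) into (J, Hom_A(M, J)), an injective triple. The cokernel is in ℰ, so its
structure morphism is surjective; composed with the projection from Hom_A(M, J) it is Hom_A(M, r).
-/
lemma exists_injective_epi_homFunctor_map [𝒴.ContainsZero]
    (hco : IsCoresolving (tripleProp M 𝒳 𝒴)) {X : ModuleCat.{w} A} (hX : 𝒳 X) :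
    ∃ (J V : ModuleCat.{w} A) (i : X ⟶ J) (r : J ⟶ V) (zero : i ≫ r = 0),
      (ShortComplex.mk i r zero).ShortExact ∧ Injective J ∧ Epi ((homFunctor A B M).map r) := by
  let i := (tripleP A B M).map (Injective.ι X)
  have : Mono i := mono_of_components ((homFunctor A B M).map_mono _)
    (inferInstanceAs (Mono (Injective.ι X)))
  have hV : (ShortComplex.mk i (cokernel.π i) (cokernel.condition i)).ShortExact :=
    { exact := ShortComplex.exact_cokernel _
      mono_f := by dsimp; infer_instance
      epi_g := by dsimp; infer_instance }
  have : Epi (cokernel i).hom := (hco.cokernel_mem _ hV (tripleProp_p hX)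
    (hco.injective_mem _ (injective_tripleP (Injective.under X)))).epi
  have hl : Epi (cokernel.π i).left := (shortExact_left hV).epi_g
  have hw : (homFunctor A B M).map (cokernel.π i).right =
      (cokernel.π i).left ≫ (cokernel i).hom :=
    (Category.id_comp _).symm.trans (cokernel.π i).w.symm
  have he : Epi ((homFunctor A B M).map (cokernel.π i).right) := by
    rw [hw]
    exact epi_comp' hl this
  exact ⟨Injective.under X, _, Injective.ι X, _, _, shortExact_right hV, inferInstance, he⟩

/-- Vanishing of the connecting morphism to `Ext¹_A(M, X)` for `X` in `𝒳`. -/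
lemma epi_homFunctor_map [𝒴.ContainsZero] (hco : IsCoresolving (tripleProp M 𝒳 𝒴))
    {S : ShortComplex (ModuleCat.{w} A)} (hS : S.ShortExact) (h : 𝒳 S.X₁) :
    Epi ((homFunctor A B M).map S.g) := by
  obtain ⟨J, V, i, r, zero, hr, _, _⟩ := exists_injective_epi_homFunctor_map hco h
  have := hS.mono_f
  obtain ⟨b, hb⟩ : ∃ b, S.f ≫ b = i := ⟨_, Injective.comp_factorThru _ _⟩
  obtain ⟨c, hc⟩ := shortExact_exists_desc hS (b ≫ r) (by rw [reassoc_of% hb, zero])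
  -- An element `t` of Hom_A(M, S.X₃), paired with a lift `y` to Hom_A(M, J) of its image in
  -- Hom_A(M, V), is killed by the second map of this sequence, hence comes from Hom_A(M, S.X₂).
  have hE := shortExact_lift_desc hS hr hb hc
  refine (epi_iff_surjective_up_to_refinements _).2 fun T t => ?_
  obtain ⟨T₁, r₁, _, y, hy⟩ := surjective_up_to_refinements_of_epi
    ((homFunctor A B M).map r) (t ≫ (homFunctor A B M).map c)
  obtain ⟨s, hs⟩ := map_exists_lift (homFunctor A B M) hE
    (r₁ ≫ t ≫ (homFunctor A B M).map biprod.inl + y ≫ (homFunctor A B M).map biprod.inr) (by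
      rw [Preadditive.add_comp, Category.assoc, Category.assoc, Category.assoc, ← Functor.map_comp,
        ← Functor.map_comp, biprod.inl_desc, biprod.inr_desc, Functor.map_neg, Preadditive.comp_neg,
        hy, add_neg_cancel])
  refine ⟨T₁, r₁, inferInstance, s, ?_⟩
  have := hs =≫ (homFunctor A B M).map biprod.fst
  rw [Category.assoc, ← Functor.map_comp, biprod.lift_fst, Preadditive.add_comp, Category.assoc,
    Category.assoc, Category.assoc, ← Functor.map_comp, ← Functor.map_comp, biprod.inl_fst,
    biprod.inr_fst, Functor.map_zero, comp_zero, add_zero, CategoryTheory.Functor.map_id,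
    Category.comp_id] at this
  exact this.symm

/-- The embedding Y ↦ (0, Y)_0 is exact, preserves injectives and detects membership in 𝒴. -/
lemma isCoresolving_left [𝒳.IsClosedUnderIsomorphisms] [𝒳.ContainsZero]
    (hco : IsCoresolving (tripleProp M 𝒳 𝒴)) : IsCoresolving 𝒴 where
  injective_mem J _ := prop_of_tripleProp_q (hco.injective_mem _ (injective_tripleQ J))
  summand_mem r h :=
    prop_of_tripleProp_q (hco.summand_mem (r.map (tripleQ A B M)) (tripleProp_q h))
  extension_mem _ hS h₁ h₃ := prop_of_tripleProp_q
    (hco.extension_mem _ (shortExact_tripleQ hS) (tripleProp_q h₁) (tripleProp_q h₃))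
  cokernel_mem _ hS h₁ h₂ := prop_of_tripleProp_q
    (hco.cokernel_mem _ (shortExact_tripleQ hS) (tripleProp_q h₁) (tripleProp_q h₂))

/-- Same argument with X ↦ (X, Hom_A(M, X))_1, which is exact on the sequences needed because their
left term is in 𝒳. -/
lemma isCoresolving_right [𝒴.ContainsZero] (hco : IsCoresolving (tripleProp M 𝒳 𝒴)) :
    IsCoresolving 𝒳 where
  injective_mem J _ := (hco.injective_mem _ (injective_tripleP J)).1
  summand_mem r h := (hco.summand_mem (r.map (tripleP A B M)) (tripleProp_p h)).1
  extension_mem _ hS h₁ h₃ := (hco.extension_mem _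
    (shortExact_tripleP hS (epi_homFunctor_map hco hS h₁)) (tripleProp_p h₁) (tripleProp_p h₃)).1
  cokernel_mem _ hS h₁ h₂ := (hco.cokernel_mem _
    (shortExact_tripleP hS (epi_homFunctor_map hco hS h₁)) (tripleProp_p h₁) (tripleProp_p h₂)).1

lemma preservesConflations_functorQ [𝒳.IsClosedUnderIsomorphisms] [𝒳.ContainsZero] :
    PreservesConflations (functorQ M 𝒳 𝒴) :=
  fun _ _ _ _ _ h => ⟨_, shortExact_tripleQ h.2⟩

lemma preservesConflations_functorP [𝒴.ContainsZero]
    (hco : IsCoresolving (tripleProp M 𝒳 𝒴)) : PreservesConflations (functorP M 𝒳 𝒴) :=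
  fun X _ _ _ _ h => ⟨_, shortExact_tripleP h.2 (epi_homFunctor_map hco h.2 X.2)⟩

instance : (projX M 𝒳 𝒴).Additive where
  map_add := rfl

instance [𝒴.IsClosedUnderExtensions] (hHom : ∀ X, 𝒳 X → 𝒴 ((homFunctor A B M).obj X)) :
    (projY M 𝒳 𝒴 hHom).Additive where
  map_add := rfl

instance : (kerY M 𝒳 𝒴).Additive where
  map_add {U V f g} := by
    apply ObjectProperty.hom_ext
    apply (cancel_mono (kernel.ι V.obj.hom)).1
    change kernelMap (f.hom + g.hom) ≫ kernel.ι V.obj.hom =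
      (kernelMap f.hom + kernelMap g.hom) ≫ kernel.ι V.obj.hom
    rw [Preadditive.add_comp, kernel.lift_ι, kernel.lift_ι, kernel.lift_ι]
    exact Preadditive.comp_add _ _ _ _ _ _

instance [𝒳.IsClosedUnderIsomorphisms] [𝒳.ContainsZero] : (functorQ M 𝒳 𝒴).Additive where
  map_add := ObjectProperty.hom_ext _ (tripleQ A B M).map_add

instance [𝒴.ContainsZero] : (functorP M 𝒳 𝒴).Additive where
  map_add := ObjectProperty.hom_ext _ (tripleP A B M).map_add

variable (M 𝒳 𝒴)

/-- `𝐏` is left adjoint to `𝐩`. -/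
def projXAdjunction [𝒴.ContainsZero] : projX M 𝒳 𝒴 ⊣ functorP M 𝒳 𝒴 :=
  Adjunction.mkOfUnitCounit
    { unit :=
        { app U := ObjectProperty.homMk (toTripleP U.obj (𝟙 U.obj.right))
          naturality U V f := by
            apply ObjectProperty.hom_ext
            apply CommaMorphism.ext
            · change f.hom.left ≫ V.obj.hom ≫ (homFunctor A B M).map (𝟙 _) =
                (U.obj.hom ≫ (homFunctor A B M).map (𝟙 _)) ≫ (homFunctor A B M).map f.hom.right
              rw [CategoryTheory.Functor.map_id, CategoryTheory.Functor.map_id, Category.comp_id,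
                Category.comp_id]
              exact f.hom.w
            · exact (Category.comp_id _).trans (Category.id_comp _).symm }
      counit :=
        { app X := 𝟙 X
          naturality X Y f := (Category.comp_id _).trans (Category.id_comp _).symm }
      left_triangle := by
        refine NatTrans.ext (funext fun U => ?_)
        apply ObjectProperty.hom_ext
        change 𝟙 _ ≫ 𝟙 _ ≫ 𝟙 _ = 𝟙 _
        simp
      right_triangle := by
        refine NatTrans.ext (funext fun X => ?_)
        apply ObjectProperty.hom_ext
        apply CommaMorphism.ext
        · change (𝟙 _ ≫ (homFunctor A B M).map (𝟙 _)) ≫ 𝟙 _ ≫ (homFunctor A B M).map (𝟙 _) = 𝟙 _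
          simp
        · change 𝟙 _ ≫ 𝟙 _ ≫ 𝟙 _ = 𝟙 _
          simp }

/-- `𝐐` is left adjoint to `𝐪`. -/
def projYAdjunction [𝒳.IsClosedUnderIsomorphisms] [𝒳.ContainsZero] [𝒴.IsClosedUnderExtensions]
    (hHom : ∀ X, 𝒳 X → 𝒴 ((homFunctor A B M).obj X)) :
    projY M 𝒳 𝒴 hHom ⊣ functorQ M 𝒳 𝒴 :=
  Adjunction.mkOfUnitCounit
    { unit :=
        { app U := ObjectProperty.homMk (toTripleQ U.obj (𝟙 U.obj.left))
          naturality U V f := by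
            apply ObjectProperty.hom_ext
            apply CommaMorphism.ext
            · exact (Category.comp_id _).trans (Category.id_comp _).symm
            · exact (isZero_zero _).eq_of_tgt _ _ }
      counit :=
        { app Y := 𝟙 Y
          naturality X Y f := (Category.comp_id _).trans (Category.id_comp _).symm }
      left_triangle := by
        refine NatTrans.ext (funext fun U => ?_)
        apply ObjectProperty.hom_ext
        change 𝟙 _ ≫ 𝟙 _ ≫ 𝟙 _ = 𝟙 _
        simp
      right_triangle := by
        refine NatTrans.ext (funext fun Y => ?_)
        apply ObjectProperty.hom_ext
        apply CommaMorphism.ext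
        · change 𝟙 _ ≫ 𝟙 _ ≫ 𝟙 _ = 𝟙 _
          simp
        · exact (isZero_zero _).eq_of_tgt _ _ }

/-- The kernel of the structure morphism as a subobject of a triple. -/
abbrev kernelTripleι (U : RepH A B M) : triple 0 (kernel U.hom) 0 ⟶ U where
  left := kernel.ι U.hom
  right := 0
  w := by
    change kernel.ι U.hom ≫ U.hom = 0 ≫ _
    rw [kernel.condition, zero_comp]

lemma kernel_lift_zero_naturality {C : Type u} [Category.{v} C] [Abelian C] {X Y Z W : C}
    (f : X ⟶ Y) (g : Z ⟶ W) (w : 0 ≫ g = f ≫ 0) :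
    f ≫ kernel.lift (0 : Y ⟶ W) (𝟙 Y) comp_zero =
      kernel.lift (0 : X ⟶ Z) (𝟙 X) comp_zero ≫ kernel.map 0 0 f g w := by
  rw [← cancel_mono (kernel.ι _)]
  simp

/-- `𝐪` is left adjoint to `ℚ`. -/
def kerYAdjunction [𝒳.IsClosedUnderIsomorphisms] [𝒳.ContainsZero] :
    functorQ M 𝒳 𝒴 ⊣ kerY M 𝒳 𝒴 :=
  Adjunction.mkOfUnitCounit
    { unit :=
        { app Y := ObjectProperty.homMk (kernel.lift 0 (𝟙 Y.obj) comp_zero)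
          naturality X Y f := by
            apply ObjectProperty.hom_ext
            exact kernel_lift_zero_naturality f.hom ((homFunctor A B M).map (𝟙 0))
              (zero_comp.trans comp_zero.symm) }
      counit :=
        { app U := ObjectProperty.homMk (kernelTripleι M U.obj)
          naturality U V f := by
            apply ObjectProperty.hom_ext
            apply CommaMorphism.ext
            · exact kernel.lift_ι _ _ _
            · exact (isZero_zero _).eq_of_src _ _ }
      left_triangle := by
        refine NatTrans.ext (funext fun Y => ?_)
        apply ObjectProperty.hom_ext
        apply CommaMorphism.ext
        · exact (congrArg (_ ≫ ·) (Category.id_comp _)).trans (kernel.lift_ι _ _ comp_zero)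
        · exact (isZero_zero _).eq_of_src _ _
      right_triangle := by
        refine NatTrans.ext (funext fun U => ?_)
        apply ObjectProperty.hom_ext
        apply (cancel_mono (kernel.ι U.obj.hom)).1
        change (kernel.lift _ (𝟙 _) comp_zero ≫ 𝟙 _ ≫ kernelMap (kernelTripleι M U.obj)) ≫
          kernel.ι _ = 𝟙 _ ≫ kernel.ι _
        rw [Category.id_comp, Category.assoc, kernel.lift_ι, kernel.lift_ι_assoc]
        exact (Category.id_comp _).trans (Category.id_comp _).symm }

variable {M 𝒳 𝒴}

lemma shortExact_kernelTripleι (U : RepH A B M) (h : Epi U.hom) :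
    ∃ zero, (ShortComplex.mk (kernelTripleι M U) (toTripleP U (𝟙 U.right)) zero).ShortExact := by
  have : Epi (U.hom ≫ (homFunctor A B M).map (𝟙 U.right)) := by
    rw [CategoryTheory.Functor.map_id, Category.comp_id]
    exact h
  refine shortExact_of_components (zl := ?_) (zr := (isZero_zero _).eq_of_src _ _)
    (shortExact_of_refinements _ _ _ (fun T t ht => ?_) (fun T t ht => ?_) (fun T t => ?_))
    (shortExact_of_refinements _ _ _ (fun T t ht => ?_) (fun T t ht => ?_) (fun T t => ?_))
  · change kernel.ι U.hom ≫ U.hom ≫ (homFunctor A B M).map (𝟙 U.right) = 0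
    rw [kernel.condition_assoc, zero_comp]
  · exact zero_of_comp_mono (kernel.ι U.hom) ht
  · have ht : t ≫ U.hom ≫ (homFunctor A B M).map (𝟙 U.right) = 0 := ht
    rw [CategoryTheory.Functor.map_id, Category.comp_id] at ht
    exact ⟨T, 𝟙 _, inferInstance, kernel.lift _ t ht,
      (Category.id_comp _).trans (kernel.lift_ι _ _ _).symm⟩
  · exact (epi_iff_surjective_up_to_refinements _).1 this t
  · exact (isZero_zero _).eq_of_tgt _ _
  · have ht : t ≫ 𝟙 _ = 0 := ht
    rw [Category.comp_id] at ht
    exact ⟨T, 𝟙 _, inferInstance, 0, by rw [ht, comp_zero, zero_comp]⟩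
  · exact ⟨T, 𝟙 _, inferInstance, t, (Category.id_comp _).trans (Category.comp_id _).symm⟩

/-- The short exact sequence `0 ⟶ 𝐪ℚU ⟶ U ⟶ 𝐩𝐏U ⟶ 0`. -/
lemma isConflation_counit_unit [𝒳.IsClosedUnderIsomorphisms] [𝒳.ContainsZero] [𝒴.ContainsZero]
    (U : (tripleProp M 𝒳 𝒴).FullSubcategory) :
    IsConflation (tripleProp M 𝒳 𝒴) (X := (functorQ M 𝒳 𝒴).obj ((kerY M 𝒳 𝒴).obj U)) (Y := U)
      (Z := (functorP M 𝒳 𝒴).obj ((projX M 𝒳 𝒴).obj U)) ((kerYAdjunction M 𝒳 𝒴).counit.app U)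
      ((projXAdjunction M 𝒳 𝒴).unit.app U) :=
  shortExact_kernelTripleι U.obj U.2.epi

end Triples

/-! ### Transfer of the Frobenius property -/

section Projective

variable {C : Type u} [Category.{v} C] [Abelian C] {P : ObjectProperty C}

lemma IsConflation.comp_isIso {X Y Z Z' : P.FullSubcategory} {f : X ⟶ Y} {g : Y ⟶ Z}
    (h : IsConflation P f g) (e : Z.obj ≅ Z'.obj) :
    IsConflation P f (g ≫ ObjectProperty.homMk e.hom) := by
  have zero : f.hom ≫ g.hom ≫ e.hom = 0 := by rw [reassoc_of% h.1, zero_comp]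
  exact ⟨zero, ShortComplex.shortExact_of_iso
    (ShortComplex.isoMk (S₁ := ShortComplex.mk f.hom g.hom h.1)
      (S₂ := ShortComplex.mk f.hom (g.hom ≫ e.hom) zero) (Iso.refl _) (Iso.refl _) e
      (by simp) (by simp)) h.2⟩

lemma IsProjective.biprodObj [P.IsClosedUnderExtensions] {Q Q' : P.FullSubcategory}
    (hQ : IsProjective P Q) (hQ' : IsProjective P Q') : IsProjective P (biprodObj Q Q') :=
  IsConflation.isProjective
    (f := (ObjectProperty.homMk biprod.inl : Q ⟶ StableRecollement.biprodObj Q Q'))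
    (g := (ObjectProperty.homMk biprod.snd : StableRecollement.biprodObj Q Q' ⟶ Q'))
    ⟨biprod.inl_snd, (ShortComplex.Splitting.ofHasBinaryBiproduct Q.obj Q'.obj).shortExact⟩ hQ hQ'

end Projective

section Triples

open scoped ZeroObject

variable {A B M : Type w} [Ring A] [Ring B] [AddCommGroup M] [Module A M] [Module Bᵐᵒᵖ M]
  [SMulCommClass A Bᵐᵒᵖ M]
  {𝒳 : ObjectProperty (ModuleCat.{w} A)} {𝒴 : ObjectProperty (ModuleCat.{w} B)}
  [𝒳.IsClosedUnderIsomorphisms] [𝒳.ContainsZero]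
  [𝒴.IsClosedUnderIsomorphisms] [𝒴.ContainsZero]
  (hHom : ∀ X, 𝒳 X → 𝒴 ((homFunctor A B M).obj X))
  (hco : IsCoresolving (tripleProp M 𝒳 𝒴))

omit [𝒴.ContainsZero] in
include hHom hco in
-- A projective cover of 𝐪Y gives a cover of Y by a projective through 𝐐, and by an injective
-- through ℚ, since 𝐐𝐪 = 1 and ℚ𝐪 ≅ 1. If Y is injective, 𝐪Y is injective, thus projective, and so
-- is 𝐐𝐪Y.
lemma isFrobenius_left [IsFrobenius (tripleProp M 𝒳 𝒴)] : IsFrobenius 𝒴 := by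
  have hY := isCoresolving_left hco
  have := hY.isClosedUnderExtensions
  have hQ := preservesProjectives_of_adjunction (projYAdjunction M 𝒳 𝒴 hHom)
    preservesConflations_functorQ
  refine hY.isFrobenius (fun Y => ?_) (fun Y => ?_) (fun Y h => ?_)
  · obtain ⟨U₁, U₀, f, g, h, hU⟩ :=
      IsFrobenius.enough_projectives ((functorQ M 𝒳 𝒴).obj Y)
    exact ⟨_, _, _, _, preservesConflations_projY hHom _ _ h, hQ hU⟩
  · obtain ⟨U₁, U₀, f, g, h, hU⟩ :=
      IsFrobenius.enough_projectives ((functorQ M 𝒳 𝒴).obj Y)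
    exact ⟨_, _, _, _, (preservesConflations_kerY _ _ h).comp_isIso kernelZeroIsoSource,
      preservesInjectives_of_adjunction (kerYAdjunction M 𝒳 𝒴) preservesConflations_functorQ
        hU.isInjective⟩
  · have := (hY.isInjective_iff Y).1 h
    have hq : IsInjective _ ((functorQ M 𝒳 𝒴).obj Y) :=
      (hco.isInjective_iff _).2 (injective_tripleQ Y.obj)
    exact hQ hq.isProjective

omit [𝒳.IsClosedUnderIsomorphisms] [𝒳.ContainsZero] in
include hco in
-- Here 𝐏 alone suffices, applied to a cover of 𝐩X: it preserves projectives as a left adjoint, and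
-- injectives by `injective_right`.
lemma isFrobenius_right [IsFrobenius (tripleProp M 𝒳 𝒴)] : IsFrobenius 𝒳 := by
  have hX := isCoresolving_right hco
  have hP := preservesProjectives_of_adjunction (projXAdjunction M 𝒳 𝒴)
    (preservesConflations_functorP hco)
  refine hX.isFrobenius (fun X => ?_) (fun X => ?_) (fun X h => ?_)
  · obtain ⟨U₁, U₀, f, g, h, hU⟩ :=
      IsFrobenius.enough_projectives ((functorP M 𝒳 𝒴).obj X)
    exact ⟨_, _, _, _, preservesConflations_projX _ _ h, hP hU⟩
  · obtain ⟨U₁, U₀, f, g, h, hU⟩ :=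
      IsFrobenius.enough_projectives ((functorP M 𝒳 𝒴).obj X)
    exact ⟨_, _, _, _, preservesConflations_projX _ _ h, (hX.isInjective_iff _).2
      (injective_right ((hco.isInjective_iff _).1 hU.isInjective))⟩
  · have := (hX.isInjective_iff X).1 h
    have hp : IsInjective _ ((functorP M 𝒳 𝒴).obj X) :=
      (hco.isInjective_iff _).2 (injective_tripleP X.obj)
    exact hP hp.isProjective

omit [𝒳.IsClosedUnderIsomorphisms] [𝒳.ContainsZero] [𝒴.IsClosedUnderIsomorphisms]
  [𝒴.ContainsZero] in
/-- The short exact sequence `0 ⟶ ker φ ⟶ Y ⟶ Hom_A(M, X) ⟶ 0`. -/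
lemma isConflation_kernel_hom [𝒴.IsClosedUnderExtensions]
    (U : (tripleProp M 𝒳 𝒴).FullSubcategory) :
    IsConflation 𝒴 (X := (kerY M 𝒳 𝒴).obj U) (Y := (projY M 𝒳 𝒴 hHom).obj U)
      (Z := ⟨(homFunctor A B M).obj U.obj.right, hHom _ U.2.1⟩)
      (ObjectProperty.homMk (kernel.ι U.obj.hom)) (ObjectProperty.homMk U.obj.hom) := by
  have h : (ShortComplex.mk (kernel.ι U.obj.hom) U.obj.hom (kernel.condition _)).ShortExact :=
    { exact := ShortComplex.exact_kernel _
      mono_f := inferInstance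
      epi_g := U.2.epi }
  exact ⟨_, h⟩

omit [𝒳.IsClosedUnderIsomorphisms] [𝒳.ContainsZero] in
-- Lift the two components separately, as `s` and `l`. Their incompatibility lies in Hom_A(M,
-- U.right), and projectivity of Hom_A(M, X) lifts it along `U.obj.hom`; subtracting the result from
-- `l` restores compatibility.
lemma isProjective_functorP [𝒴.IsClosedUnderExtensions] {X : 𝒳.FullSubcategory}
    (hX : IsProjective 𝒳 X)
    (hX' : IsProjective 𝒴 ⟨(homFunctor A B M).obj X.obj, hHom X.obj X.property⟩) :
    IsProjective (tripleProp M 𝒳 𝒴) ((functorP M 𝒳 𝒴).obj X) := by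
  intro U V W f g h t
  obtain ⟨s, hs⟩ : ∃ s : X.obj ⟶ V.obj.right, s ≫ g.hom.right = t.hom.right := by
    obtain ⟨s, hs⟩ := hX _ _ (preservesConflations_projX _ _ h)
      (ObjectProperty.homMk t.hom.right)
    exact ⟨s.hom, congrArg InducedCategory.Hom.hom hs⟩
  obtain ⟨l, hl⟩ : ∃ l : (homFunctor A B M).obj X.obj ⟶ V.obj.left,
      l ≫ g.hom.left = t.hom.left := by
    obtain ⟨l, hl⟩ := hX' _ _ (preservesConflations_projY hHom _ _ h)
      (ObjectProperty.homMk t.hom.left)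
    exact ⟨l.hom, congrArg InducedCategory.Hom.hom hl⟩
  have hf : f.hom.left ≫ V.obj.hom = U.obj.hom ≫ (homFunctor A B M).map f.hom.right := f.hom.w
  have hg : g.hom.left ≫ W.obj.hom = V.obj.hom ≫ (homFunctor A B M).map g.hom.right := g.hom.w
  have ht : t.hom.left ≫ W.obj.hom = (homFunctor A B M).map t.hom.right :=
    t.hom.w.trans (Category.id_comp _)
  have h0 : f.hom.left ≫ g.hom.left = 0 := congrArg CommaMorphism.left h.1
  obtain ⟨k, hk⟩ := map_exists_lift (homFunctor A B M) (shortExact_right h.2)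
    (l ≫ V.obj.hom - (homFunctor A B M).map s) (by
      rw [Preadditive.sub_comp, Category.assoc, ← hg, ← Functor.map_comp, hs, ← Category.assoc, hl]
      exact sub_eq_zero_of_eq ht)
  obtain ⟨k', hk'⟩ : ∃ k' : (homFunctor A B M).obj X.obj ⟶ U.obj.left, k' ≫ U.obj.hom = k := by
    obtain ⟨k', hk'⟩ := hX' _ _ (isConflation_kernel_hom hHom U) (ObjectProperty.homMk k)
    have := congrArg InducedCategory.Hom.hom hk'
    exact ⟨k'.hom, this⟩
  refine ⟨ObjectProperty.homMk
    { left := l - k' ≫ f.hom.left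
      right := s
      w := ?_ }, ?_⟩
  · refine Eq.trans ?_ (Category.id_comp _).symm
    change (l - k' ≫ f.hom.left) ≫ V.obj.hom = (homFunctor A B M).map s
    rw [Preadditive.sub_comp, Category.assoc, hf, reassoc_of% hk', hk, sub_sub_cancel]
  · apply ObjectProperty.hom_ext
    apply CommaMorphism.ext
    · change (l - k' ≫ f.hom.left) ≫ g.hom.left = t.hom.left
      rw [Preadditive.sub_comp, Category.assoc, h0, comp_zero, sub_zero, hl]
    · exact hs

omit [𝒳.ContainsZero] [𝒴.ContainsZero] in
include hco in
-- Covers of the ends of 0 → 𝐪ℚU → U → 𝐩𝐏U → 0 combine into a cover of U that is both projective and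
-- injective. If U is injective, so are ℚU and 𝐏U; both ends are then projective, and so is U.
lemma isFrobenius_tripleProp [IsFrobenius 𝒳] [IsFrobenius 𝒴]
    (hp : ∀ X : 𝒳.FullSubcategory, IsProjective 𝒳 X →
      IsProjective 𝒴 ⟨(homFunctor A B M).obj X.obj, hHom X.obj X.property⟩) :
    IsFrobenius (tripleProp M 𝒳 𝒴) := by
  have hX := isCoresolving_right hco
  have hY := isCoresolving_left hco
  have := hco.isClosedUnderExtensions
  have hq : PreservesProjectives (functorQ M 𝒳 𝒴) :=
    preservesProjectives_of_adjunction (kerYAdjunction M 𝒳 𝒴) preservesConflations_kerY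
  have cover (U : (tripleProp M 𝒳 𝒴).FullSubcategory) :
      ∃ (K Q : (tripleProp M 𝒳 𝒴).FullSubcategory) (f : K ⟶ Q) (g : Q ⟶ U),
        IsConflation (tripleProp M 𝒳 𝒴) f g ∧ IsProjective (tripleProp M 𝒳 𝒴) Q ∧
          IsInjective (tripleProp M 𝒳 𝒴) Q := by
    obtain ⟨K₁, K₀, i, p, hK, hK₀⟩ := IsFrobenius.enough_projectives ((kerY M 𝒳 𝒴).obj U)
    obtain ⟨X₁, X₀, j, q, hX', hX₀⟩ := IsFrobenius.enough_projectives ((projX M 𝒳 𝒴).obj U)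
    have hpX₀ := isProjective_functorP hHom hX₀ (hp X₀ hX₀)
    have hU := isConflation_counit_unit U
    obtain ⟨a, ha⟩ := hpX₀ _ _ hU ((functorP M 𝒳 𝒴).map q)
    obtain ⟨N, n, d, hd⟩ := exists_conflation_of_covers hU
      (preservesConflations_functorQ _ _ hK) (preservesConflations_functorP hco _ _ hX') a ha
    have hK₀' : Injective K₀.obj := (hY.isInjective_iff _).1 hK₀.isInjective
    have hX₀' : Injective X₀.obj := (hX.isInjective_iff _).1 hX₀.isInjective
    refine ⟨_, _, n, d, hd, (hq hK₀).biprodObj hpX₀, (hco.isInjective_iff _).2 ?_⟩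
    have h₁ : Injective ((functorQ M 𝒳 𝒴).obj K₀).obj := injective_tripleQ K₀.obj
    have h₂ : Injective ((functorP M 𝒳 𝒴).obj X₀).obj := injective_tripleP X₀.obj
    infer_instance
  refine hco.isFrobenius (fun U => ?_) (fun U => ?_) (fun U hU => ?_)
  · obtain ⟨K, Q, f, g, h, hQ, -⟩ := cover U
    exact ⟨K, Q, f, g, h, hQ⟩
  · obtain ⟨K, Q, f, g, h, -, hQ⟩ := cover U
    exact ⟨K, Q, f, g, h, hQ⟩
  · have h₁ : IsProjective 𝒳 ((projX M 𝒳 𝒴).obj U) :=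
      ((hX.isInjective_iff _).2 (injective_right ((hco.isInjective_iff _).1 hU))).isProjective
    have h₂ := preservesInjectives_of_adjunction (kerYAdjunction M 𝒳 𝒴)
      preservesConflations_functorQ hU
    exact (isConflation_counit_unit U).isProjective (hq h₂.isProjective)
      (isProjective_functorP hHom h₁ (hp _ h₁))

end Triples

/-! ### Distinguished triangles of a stable category -/

section Distinguished

open Pretriangulated StableTriangulation

variable {C : Type u} [Category.{v} C] [Abelian C] {P : ObjectProperty C} [IsFrobenius P]
  [StableTriangulation P]

lemma IsConflation.exists_distinguished {X Y Z : P.FullSubcategory} {f : X ⟶ Y} {g : Y ⟶ Z}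
    (h : IsConflation P f g) :
    ∃ δ, Triangle.mk ((toSt P).map f) ((toSt P).map g) δ ∈ distTriang (St P) := by
  obtain ⟨J, W, i, p, hip, hJ⟩ := IsFrobenius.enough_injectives X
  obtain ⟨c, b, hb, hc⟩ := exists_connecting h hip hJ (𝟙 X)
  exact ⟨_, (distinguished_iff _).2 ⟨X, Y, Z, J, W, f, g, i, p, b, c, h, hip, hJ,
    hb.trans (Category.id_comp _), hc, ⟨Iso.refl _⟩⟩⟩

/-- A projective summand of the middle term is stably zero and can be dropped from the triangle. -/
lemma IsConflation.exists_distinguished_of_isProjective {X Y Z Q : P.FullSubcategory}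
    {f : X ⟶ biprodObj Y Q} {g : biprodObj Y Q ⟶ Z} (h : IsConflation P f g)
    (hQ : IsProjective P Q) {f' : X ⟶ Y} {g' : Y ⟶ Z}
    (hf : f ≫ ObjectProperty.homMk biprod.fst = f')
    (hg : (ObjectProperty.homMk biprod.inl : Y ⟶ biprodObj Y Q) ≫ g = g') :
    ∃ δ, Triangle.mk ((toSt P).map f') ((toSt P).map g') δ ∈ distTriang (St P) := by
  subst hf hg
  obtain ⟨δ, hδ⟩ := h.exists_distinguished
  refine ⟨δ, isomorphic_distinguished _ hδ _ (Triangle.isoMk _ _ (Iso.refl _)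
    (biprodProjIso Y hQ).symm (Iso.refl _) ?_ ?_ ?_)⟩
  · refine Eq.trans ?_ (Category.id_comp _).symm
    refine (congrArg (· ≫ (biprodProjIso Y hQ).inv) ((toSt P).map_comp _ _)).trans ?_
    exact (Category.assoc _ _ _).trans ((congrArg (_ ≫ ·) (biprodProjIso Y hQ).hom_inv_id).trans
      (Category.comp_id _))
  · exact (Category.comp_id _).trans ((toSt P).map_comp _ _)
  · exact (congrArg (δ ≫ ·) (CategoryTheory.Functor.map_id _ _)).trans
      ((Category.comp_id _).trans (Category.id_comp _).symm)

end Distinguished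

/-! ### Exact sequences and lifting of morphisms for the first triangle -/

section Triples

open scoped ZeroObject

variable {A B M : Type w} [Ring A] [Ring B] [AddCommGroup M] [Module A M] [Module Bᵐᵒᵖ M]
  [SMulCommClass A Bᵐᵒᵖ M]

/-- On second components the sequence is W.left → U.left ⊕ W.left → U.left, the graph of `c.left`;
on first components it reduces to the isomorphism `c.right`. -/
lemma shortExact_biprod_tripleQ {W U : RepH A B M} (c : W ⟶ U) [IsIso c.right] :
    ∃ zero, (ShortComplex.mk (biprod.lift c (toTripleQ W (𝟙 W.left)))
      (biprod.desc (toTripleQ U (𝟙 U.left)) (-toTripleQ (triple 0 W.left 0) c.left)) zero).ShortExact := by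
  have hη {T : RepH A B M} (t : T ⟶ U) :
      (t ≫ toTripleQ U (𝟙 U.left)).left = t.left := Category.comp_id _
  have hc : c.left ≫ U.hom = W.hom ≫ (homFunctor A B M).map c.right := c.w
  have zero : biprod.lift c (toTripleQ W (𝟙 W.left)) ≫
      biprod.desc (toTripleQ U (𝟙 U.left)) (-toTripleQ (triple 0 W.left 0) c.left) = 0 := by
    rw [biprod.lift_desc, Preadditive.comp_neg, ← sub_eq_add_neg, sub_eq_zero]
    apply CommaMorphism.ext
    · exact (Category.comp_id _).trans (Category.id_comp _).symm
    · exact (isZero_zero _).eq_of_tgt _ _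
  refine ⟨zero, shortExact_of_refinements _ _ _ (fun T t ht => ?_) (fun T t ht => ?_)
    (fun T t => ?_)⟩
  · have h₁ : t ≫ c = 0 := by simpa using ht =≫ biprod.fst
    have h₂ : t ≫ toTripleQ W (𝟙 W.left) = 0 := by simpa using ht =≫ biprod.snd
    apply CommaMorphism.ext
    · exact (Category.comp_id _).symm.trans (congrArg CommaMorphism.left h₂)
    · exact zero_of_comp_mono c.right (congrArg CommaMorphism.right h₁)
  · have h : (t ≫ biprod.fst) ≫ toTripleQ U (𝟙 U.left) =
        (t ≫ biprod.snd) ≫ toTripleQ (triple 0 W.left 0) c.left := by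
      rw [biprod.desc_eq, Preadditive.comp_add, Preadditive.comp_neg, Preadditive.comp_neg,
        ← sub_eq_add_neg, sub_eq_zero] at ht
      simpa using ht
    have hl : (t ≫ biprod.fst).left = (t ≫ biprod.snd).left ≫ c.left :=
      (hη _).symm.trans (congrArg CommaMorphism.left h)
    have hu : (t ≫ biprod.fst).left ≫ U.hom =
      T.hom ≫ (homFunctor A B M).map (t ≫ biprod.fst).right := (t ≫ biprod.fst).w
    let s : T ⟶ W :=
      { left := (t ≫ biprod.snd).left
        right := (t ≫ biprod.fst).right ≫ inv c.right
        w := by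
          change (t ≫ biprod.snd).left ≫ W.hom =
            T.hom ≫ (homFunctor A B M).map ((t ≫ biprod.fst).right ≫ inv c.right)
          rw [← cancel_mono ((homFunctor A B M).map c.right), Category.assoc, ← hc,
            Category.assoc, ← Functor.map_comp, Category.assoc, IsIso.inv_hom_id,
            Category.comp_id, ← hu, hl]
          exact (Category.assoc _ _ _).symm }
    have h₁ : s ≫ c = t ≫ biprod.fst := by
      apply CommaMorphism.ext
      · exact hl.symm
      · exact (Category.assoc _ _ _).trans ((congrArg (_ ≫ ·) (IsIso.inv_hom_id _)).trans
          (Category.comp_id _))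
    have h₂ : s ≫ toTripleQ W (𝟙 W.left) = t ≫ biprod.snd := by
      apply CommaMorphism.ext
      · exact Category.comp_id _
      · exact (isZero_zero _).eq_of_tgt _ _
    refine ⟨T, 𝟙 _, inferInstance, s, ?_⟩
    apply biprod.hom_ext
    · simp [h₁]
    · simp [h₂]
  · have : Epi (toTripleQ U (𝟙 U.left)) := epi_of_components (inferInstanceAs (Epi (𝟙 _)))
      ⟨fun _ _ _ => (isZero_zero _).eq_of_src _ _⟩
    obtain ⟨T', r, _, y, hy⟩ := surjective_up_to_refinements_of_epi (toTripleQ U (𝟙 U.left)) t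
    exact ⟨T', r, inferInstance, y ≫ biprod.inl, by simpa using hy⟩

variable {𝒳 : ObjectProperty (ModuleCat.{w} A)} {𝒴 : ObjectProperty (ModuleCat.{w} B)}
  [𝒳.IsClosedUnderIsomorphisms] [𝒴.IsClosedUnderIsomorphisms] [IsFrobenius 𝒳] [IsFrobenius 𝒴]
  [IsFrobenius (tripleProp M 𝒳 𝒴)]
  (hHom : ∀ X, 𝒳 X → 𝒴 ((homFunctor A B M).obj X))
  (hco : IsCoresolving (tripleProp M 𝒳 𝒴))

omit [IsFrobenius (tripleProp M 𝒳 𝒴)] in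
lemma preservesProjectives_projY : PreservesProjectives (projY M 𝒳 𝒴 hHom) :=
  preservesProjectives_of_adjunction (projYAdjunction M 𝒳 𝒴 hHom) preservesConflations_functorQ

omit [IsFrobenius (tripleProp M 𝒳 𝒴)] [IsFrobenius 𝒴] in
lemma preservesProjectives_functorQ : PreservesProjectives (functorQ M 𝒳 𝒴) :=
  preservesProjectives_of_adjunction (kerYAdjunction M 𝒳 𝒴) preservesConflations_kerY

lemma preservesProjectives_kerY : PreservesProjectives (kerY M 𝒳 𝒴) :=
  (preservesInjectives_of_adjunction (kerYAdjunction M 𝒳 𝒴)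
    preservesConflations_functorQ).preservesProjectives

omit [𝒳.IsClosedUnderIsomorphisms] in
lemma preservesProjectives_functorP : PreservesProjectives (functorP M 𝒳 𝒴) :=
  (preservesInjectives_of_adjunction (projXAdjunction M 𝒳 𝒴)
    preservesConflations_projX).preservesProjectives

omit [𝒳.IsClosedUnderIsomorphisms] [IsFrobenius 𝒳] [IsFrobenius (tripleProp M 𝒳 𝒴)] in
include hco in
lemma preservesProjectives_projX : PreservesProjectives (projX M 𝒳 𝒴) :=
  preservesProjectives_of_adjunction (projXAdjunction M 𝒳 𝒴) (preservesConflations_functorP hco)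

/-! Triples whose second component is projective. -/

section

variable {U V : (tripleProp M 𝒳 𝒴).FullSubcategory}
  (hU : IsProjective 𝒴 ((projY M 𝒳 𝒴 hHom).obj U))

omit [𝒳.IsClosedUnderIsomorphisms] [𝒴.IsClosedUnderIsomorphisms] [IsFrobenius 𝒳]
  [IsFrobenius (tripleProp M 𝒳 𝒴)] in
include hU in
-- Second components lift because `V.obj.hom` is a deflation in 𝒴 and that of `U` is projective.
lemma exists_projX_map_eq (f : (projX M 𝒳 𝒴).obj U ⟶ (projX M 𝒳 𝒴).obj V) :
    ∃ φ : U ⟶ V, (projX M 𝒳 𝒴).map φ = f := by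
  obtain ⟨g, hg⟩ : ∃ g : U.obj.left ⟶ V.obj.left,
      g ≫ V.obj.hom = U.obj.hom ≫ (homFunctor A B M).map f.hom := by
    obtain ⟨g, hg⟩ := hU _ _ (isConflation_kernel_hom hHom V)
      (ObjectProperty.homMk (U.obj.hom ≫ (homFunctor A B M).map f.hom))
    have := congrArg InducedCategory.Hom.hom hg
    exact ⟨g.hom, this⟩
  exact ⟨ObjectProperty.homMk { left := g, right := f.hom, w := hg }, rfl⟩

include hU in
-- Subtracting a morphism through 𝐩X₀ kills the first component, so the rest lands in 𝐪ℚV. A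
-- morphism to an object in the image of 𝐪 factors through 𝐪𝐐U, which is projective.
lemma factorsThroughProjective_of_projX_map {φ : U ⟶ V}
    (hφ : FactorsThroughProjective 𝒳 ((projX M 𝒳 𝒴).map φ)) :
    FactorsThroughProjective (tripleProp M 𝒳 𝒴) φ := by
  obtain ⟨X₀, a, b, hX₀, hab⟩ := hφ
  have hV := isConflation_counit_unit V
  obtain ⟨β, hβ⟩ := preservesProjectives_functorP hX₀ _ _ hV ((functorP M 𝒳 𝒴).map b)
  let α : U ⟶ (functorP M 𝒳 𝒴).obj X₀ :=
    (projXAdjunction M 𝒳 𝒴).unit.app U ≫ (functorP M 𝒳 𝒴).map a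
  have h : (φ - α ≫ β) ≫ (projXAdjunction M 𝒳 𝒴).unit.app V = 0 := by
    rw [Preadditive.sub_comp, Category.assoc, hβ, Category.assoc, ← Functor.map_comp, hab]
    exact sub_eq_zero_of_eq ((projXAdjunction M 𝒳 𝒴).unit.naturality φ)
  obtain ⟨γ, hγ⟩ := hV.exists_lift _ h
  have hγ' : (projYAdjunction M 𝒳 𝒴 hHom).unit.app U ≫
      (functorQ M 𝒳 𝒴).map (ObjectProperty.homMk γ.hom.left) = γ := by
    apply ObjectProperty.hom_ext
    apply CommaMorphism.ext
    · exact Category.id_comp _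
    · exact (isZero_zero _).eq_of_tgt _ _
  rw [← sub_add_cancel φ (α ≫ β), ← hγ, ← hγ']
  exact (FactorsThroughProjective.postcomp _
    ⟨_, _, _, preservesProjectives_functorQ hU, rfl⟩).add
      ⟨_, α, β, preservesProjectives_functorP hX₀, rfl⟩

end

end Triples

/-! ### The recollement -/

/-- The left adjoint of a triangulated functor is triangulated. -/
lemma IsTriangulatedFunctor.leftAdjoint {C : Type u₁} {D : Type u₂} [Category.{v₁} C]
    [Category.{v₂} D] [HasZeroObject C] [HasZeroObject D] [Preadditive C] [Preadditive D]
    [HasShift C ℤ] [HasShift D ℤ]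
    [∀ n : ℤ, (shiftFunctor C n).Additive] [∀ n : ℤ, (shiftFunctor D n).Additive]
    [Pretriangulated C] [Pretriangulated D] {F : C ⥤ D} {G : D ⥤ C} (adj : F ⊣ G)
    (hG : IsTriangulatedFunctor G) : IsTriangulatedFunctor F := by
  obtain ⟨_, _⟩ := hG
  let := adj.leftAdjointCommShift ℤ
  have := adj.commShift_of_rightAdjoint ℤ
  exact ⟨inferInstance, adj.isTriangulated_leftAdjoint⟩

section Triples

open scoped ZeroObject

variable {A B M : Type w} [Ring A] [Ring B] [AddCommGroup M] [Module A M] [Module Bᵐᵒᵖ M]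
  [SMulCommClass A Bᵐᵒᵖ M] {𝒳 : ObjectProperty (ModuleCat.{w} A)}
  {𝒴 : ObjectProperty (ModuleCat.{w} B)}
  [𝒴.IsClosedUnderIsomorphisms] [IsFrobenius 𝒴]
  (hHom : ∀ X, 𝒳 X → 𝒴 ((homFunctor A B M).obj X))

/-- Every object of `𝒳` is the first component of a triple in `ℰ(𝒳, M, 𝒴)` whose second component
is projective. -/
lemma exists_triple_isProjective (X : 𝒳.FullSubcategory) :
    ∃ (Q : ModuleCat.{w} B) (ψ : Q ⟶ (homFunctor A B M).obj X.obj)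
      (h : tripleProp M 𝒳 𝒴 (triple X.obj Q ψ)),
      IsProjective 𝒴 ⟨Q, tripleProp_left hHom h⟩ := by
  obtain ⟨K, Q, f, g, h, hQ⟩ := IsFrobenius.enough_projectives
    (⟨(homFunctor A B M).obj X.obj, hHom _ X.2⟩ : 𝒴.FullSubcategory)
  have := h.2.mono_f
  exact ⟨Q.obj, g.hom, ⟨X.2, 𝒴.prop_of_iso
    (IsLimit.conePointUniqueUpToIso h.2.exact.fIsKernel (limit.isLimit _)) K.2,
    (ModuleCat.epi_iff_surjective _).1 h.2.epi_g⟩, hQ⟩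

/-- A triple with first component `X` and projective second component. -/
def projectiveTriple (X : 𝒳.FullSubcategory) : (tripleProp M 𝒳 𝒴).FullSubcategory :=
  ⟨triple X.obj (exists_triple_isProjective hHom X).choose
    (exists_triple_isProjective hHom X).choose_spec.choose,
    (exists_triple_isProjective hHom X).choose_spec.choose_spec.choose⟩

lemma isProjective_projectiveTriple (X : 𝒳.FullSubcategory) :
    IsProjective 𝒴 ((projY M 𝒳 𝒴 hHom).obj (projectiveTriple hHom X)) :=
  (exists_triple_isProjective hHom X).choose_spec.choose_spec.choose_spec

variable [𝒳.IsClosedUnderIsomorphisms] [IsFrobenius 𝒳] [IsFrobenius (tripleProp M 𝒳 𝒴)]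
  (hco : IsCoresolving (tripleProp M 𝒳 𝒴))

variable (M 𝒳 𝒴) in
/-- The functor between stable categories induced by `𝐩`. -/
abbrev stP : St 𝒳 ⥤ St (tripleProp M 𝒳 𝒴) :=
  stFunctor (functorP M 𝒳 𝒴) preservesProjectives_functorP

variable (M 𝒳 𝒴) in
/-- The functor between stable categories induced by `𝐪`. -/
abbrev stQ : St 𝒴 ⥤ St (tripleProp M 𝒳 𝒴) :=
  stFunctor (functorQ M 𝒳 𝒴) preservesProjectives_functorQ

variable (M 𝒳 𝒴) in
/-- The functor between stable categories induced by `ℚ`. -/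
abbrev stKerY : St (tripleProp M 𝒳 𝒴) ⥤ St 𝒴 :=
  stFunctor (kerY M 𝒳 𝒴) preservesProjectives_kerY

/-- The functor between stable categories induced by `𝐐`. -/
abbrev stProjY : St (tripleProp M 𝒳 𝒴) ⥤ St 𝒴 :=
  stFunctor (projY M 𝒳 𝒴 hHom) (preservesProjectives_projY hHom)

/-- The functor between stable categories induced by `𝐏`. -/
abbrev stProjX : St (tripleProp M 𝒳 𝒴) ⥤ St 𝒳 :=
  stFunctor (projX M 𝒳 𝒴) (preservesProjectives_projX hco)

/-- Such triples corepresent stable morphisms between first components, which produces the left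
adjoint 𝐣. -/
lemma stProjX_map_bijective {U : (tripleProp M 𝒳 𝒴).FullSubcategory}
    (hU : IsProjective 𝒴 ((projY M 𝒳 𝒴 hHom).obj U)) (V : St (tripleProp M 𝒳 𝒴)) :
    Function.Bijective ((stProjX hco).map : ((toSt _).obj U ⟶ V) → _) := by
  refine ⟨fun a b hab => ?_, fun f => ?_⟩
  · obtain ⟨a, rfl⟩ := (toSt _).map_surjective a
    obtain ⟨b, rfl⟩ := (toSt _).map_surjective b
    refine (toSt_map_eq_iff _ _).2 (factorsThroughProjective_of_projX_map hHom hU ?_)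
    rw [Functor.map_sub]
    exact (toSt_map_eq_iff _ _).1 hab
  · obtain ⟨f, rfl⟩ := (toSt _).map_surjective
      (X := (projX M 𝒳 𝒴).obj U) (Y := (projX M 𝒳 𝒴).obj V.as) f
    obtain ⟨φ, rfl⟩ := exists_projX_map_eq hHom hU f
    exact ⟨(toSt _).map φ, rfl⟩

/-- Morphisms of the stable category from a triple with projective second component. -/
def projectiveTripleHomEquiv (X : St 𝒳) (V : St (tripleProp M 𝒳 𝒴)) :
    ((toSt _).obj (projectiveTriple hHom X.as) ⟶ V) ≃ (X ⟶ (stProjX hco).obj V) :=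
  Equiv.ofBijective (fun φ => (stProjX hco).map φ)
    (stProjX_map_bijective hHom hco (isProjective_projectiveTriple hHom X.as) V)

/-- The left adjoint `𝐣` of the functor between stable categories induced by `𝐏`. -/
def stJ : St 𝒳 ⥤ St (tripleProp M 𝒳 𝒴) :=
  Adjunction.leftAdjointOfEquiv (projectiveTripleHomEquiv hHom hco)
    (fun _ _ _ _ _ => (stProjX hco).map_comp _ _)

/-- `𝐣` is left adjoint to the functor between stable categories induced by `𝐏`. -/
def stJAdjunction : stJ hHom hco ⊣ stProjX hco :=
  Adjunction.adjunctionOfEquivLeft (projectiveTripleHomEquiv hHom hco)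
    (fun _ _ _ _ _ => (stProjX hco).map_comp _ _)

/-- The chosen triple has first component exactly `X`, so the unit is the identity. -/
lemma isIso_stJAdjunction_unit : IsIso (stJAdjunction hHom hco).unit := by
  have (X : St 𝒳) : IsIso ((stJAdjunction hHom hco).unit.app X) := by
    have h : (stJAdjunction hHom hco).unit.app X = 𝟙 X := by
      refine (Adjunction.adjunctionOfEquivLeft_unit_app _ _ _).trans ?_
      exact (stProjX hco).map_id _
    rw [h]
    exact inferInstanceAs (IsIso (𝟙 X))
  exact NatIso.isIso_of_isIso_app _

lemma isIso_stAdjunction_projY_counit : IsIso (stAdjunction (projYAdjunction M 𝒳 𝒴 hHom)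
    (preservesProjectives_projY hHom) preservesProjectives_functorQ).counit := by
  have (Y : St 𝒴) : IsIso ((stAdjunction (projYAdjunction M 𝒳 𝒴 hHom)
      (preservesProjectives_projY hHom) preservesProjectives_functorQ).counit.app Y) :=
    inferInstanceAs (IsIso (𝟙 Y))
  exact NatIso.isIso_of_isIso_app _

omit [𝒳.IsClosedUnderIsomorphisms] in
lemma isIso_stAdjunction_projX_counit : IsIso (stAdjunction (projXAdjunction M 𝒳 𝒴)
    (preservesProjectives_projX hco) preservesProjectives_functorP).counit := by
  have (X : St 𝒳) : IsIso ((stAdjunction (projXAdjunction M 𝒳 𝒴)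
      (preservesProjectives_projX hco) preservesProjectives_functorP).counit.app X) :=
    inferInstanceAs (IsIso (𝟙 X))
  exact NatIso.isIso_of_isIso_app _

lemma stProjX_map_stJAdjunction_counit_app (V : St (tripleProp M 𝒳 𝒴)) :
    (stProjX hco).map ((stJAdjunction hHom hco).counit.app V) = 𝟙 ((stProjX hco).obj V) := by
  have h := Adjunction.adjunctionOfEquivLeft_counit_app (projectiveTripleHomEquiv hHom hco)
    (fun _ _ _ _ _ => (stProjX hco).map_comp _ _) V
  exact (congrArg (stProjX hco).map h).trans
    ((projectiveTripleHomEquiv hHom hco ((stProjX hco).obj V) V).apply_symm_apply (𝟙 _))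

variable {hHom} in
-- The extra summand 𝐪𝐐W of the middle term is projective, since 𝐐W is and 𝐪 preserves projectives.
lemma exists_distinguished_unit [StableTriangulation (tripleProp M 𝒳 𝒴)]
    {W U : (tripleProp M 𝒳 𝒴).FullSubcategory} (c : W ⟶ U) [IsIso c.hom.right]
    (hW : IsProjective 𝒴 ((projY M 𝒳 𝒴 hHom).obj W)) :
    ∃ δ, Pretriangulated.Triangle.mk ((toSt _).map c)
      ((toSt _).map ((projYAdjunction M 𝒳 𝒴 hHom).unit.app U)) δ ∈
        Pretriangulated.distinguishedTriangles := by
  have h : IsConflation (tripleProp M 𝒳 𝒴)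
      (Y := biprodObj U ((functorQ M 𝒳 𝒴).obj ((projY M 𝒳 𝒴 hHom).obj W)))
      (Z := (functorQ M 𝒳 𝒴).obj ((projY M 𝒳 𝒴 hHom).obj U))
      (ObjectProperty.homMk (biprod.lift c.hom (toTripleQ W.obj (𝟙 _))))
      (ObjectProperty.homMk (biprod.desc (toTripleQ U.obj (𝟙 _))
        (-toTripleQ (triple 0 W.obj.left 0) c.hom.left))) :=
    shortExact_biprod_tripleQ c.hom
  exact h.exists_distinguished_of_isProjective (preservesProjectives_functorQ hW)
    (ObjectProperty.hom_ext _ (biprod.lift_fst c.hom (toTripleQ W.obj (𝟙 _))))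
    (ObjectProperty.hom_ext _ (biprod.inl_desc (toTripleQ U.obj (𝟙 _)) _))

variable [StableTriangulation 𝒳] [StableTriangulation 𝒴] [StableTriangulation (tripleProp M 𝒳 𝒴)]

/-- The recollement of the stable categories of `𝒴`, `ℰ(𝒳, M, 𝒴)` and `𝒳`. -/
def stableRecollement : Recollement (stProjY hHom) (stQ M 𝒳 𝒴) (stKerY M 𝒳 𝒴) (stJ hHom hco)
    (stProjX hco) (stP M 𝒳 𝒴) where
  iUpperStar_triangulated := isTriangulatedFunctor_stFunctor _ (preservesConflations_projY hHom) _
  iLowerStar_triangulated := isTriangulatedFunctor_stFunctor _ preservesConflations_functorQ _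
  iUpperShriek_triangulated := isTriangulatedFunctor_stFunctor _ preservesConflations_kerY _
  jLowerShriek_triangulated := IsTriangulatedFunctor.leftAdjoint (stJAdjunction hHom hco)
    (isTriangulatedFunctor_stFunctor _ preservesConflations_projX _)
  jUpperStar_triangulated := isTriangulatedFunctor_stFunctor _ preservesConflations_projX _
  jLowerStar_triangulated :=
    isTriangulatedFunctor_stFunctor _ (preservesConflations_functorP hco) _
  adj₁ := stAdjunction (projYAdjunction M 𝒳 𝒴 hHom) _ _
  adj₂ := stAdjunction (kerYAdjunction M 𝒳 𝒴) _ _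
  adj₃ := stJAdjunction hHom hco
  adj₄ := stAdjunction (projXAdjunction M 𝒳 𝒴) _ _
  iLowerStar_fullyFaithful :=
    have := isIso_stAdjunction_projY_counit (M := M) (𝒳 := 𝒳) hHom
    have h := (stAdjunction (projYAdjunction M 𝒳 𝒴 hHom) (preservesProjectives_projY hHom)
      preservesProjectives_functorQ).fullyFaithfulROfIsIsoCounit
    ⟨h.full, h.faithful⟩
  jLowerShriek_fullyFaithful :=
    have := isIso_stJAdjunction_unit hHom hco
    have h := (stJAdjunction hHom hco).fullyFaithfulLOfIsIsoUnit
    ⟨h.full, h.faithful⟩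
  jLowerStar_fullyFaithful :=
    have := isIso_stAdjunction_projX_counit hco
    have h := (stAdjunction (projXAdjunction M 𝒳 𝒴) (preservesProjectives_projX hco)
      preservesProjectives_functorP).fullyFaithfulROfIsIsoCounit
    ⟨h.full, h.faithful⟩
  comp_isZero Y := toSt_isZero (Q := (projX M 𝒳 𝒴).obj ((functorQ M 𝒳 𝒴).obj Y.as))
    fun _ _ _ _ _ _ _ => ⟨0, ObjectProperty.hom_ext _ ((isZero_zero _).eq_of_src _ _)⟩
  triangle₁ U := by
    -- A concrete representative of the counit: a morphism over the identity of the first component.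
    obtain ⟨c, hc⟩ := exists_projX_map_eq hHom (V := U.as)
      (isProjective_projectiveTriple hHom ((projX M 𝒳 𝒴).obj U.as)) (𝟙 _)
    have hc' : c.hom.right = 𝟙 _ := congrArg InducedCategory.Hom.hom hc
    have : IsIso c.hom.right := by
      rw [hc']
      exact inferInstanceAs (IsIso (𝟙 U.as.obj.right))
    -- Both sides go to the identity under the functor induced by 𝐏, which is injective on morphisms
    -- out of this triple.
    have hcounit : (stJAdjunction hHom hco).counit.app U = (toSt _).map c := by
      refine (stProjX_map_bijective hHom hco (isProjective_projectiveTriple hHom _) U).1 ?_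
      exact (stProjX_map_stJAdjunction_counit_app hHom hco U).trans
        (((toSt _).map_id _).symm.trans (congrArg (toSt _).map hc.symm))
    obtain ⟨δ, hδ⟩ := exists_distinguished_unit c (isProjective_projectiveTriple hHom _)
    rw [hcounit]
    exact ⟨δ, hδ⟩
  triangle₂ U := (isConflation_counit_unit U.as).exists_distinguished

end Triples

end StableRecollement

end

/-! ### The main theorem -/

open CategoryTheory StableRecollement

theorem mainTheorem2 {A B M : Type w} [Ring A] [Ring B] [AddCommGroup M] [Module A M]
    [Module Bᵐᵒᵖ M] [SMulCommClass A Bᵐᵒᵖ M]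
    (𝒳 : ObjectProperty (ModuleCat.{w} A)) (𝒴 : ObjectProperty (ModuleCat.{w} B))
    [𝒳.IsClosedUnderIsomorphisms] [𝒳.ContainsZero]
    [𝒴.IsClosedUnderIsomorphisms] [𝒴.ContainsZero]
    (hHom : ∀ X : ModuleCat.{w} A, 𝒳 X → 𝒴 ((homFunctor A B M).obj X))
    (hco : IsCoresolving (tripleProp M 𝒳 𝒴))
    (hFrob :
      IsFrobenius (tripleProp M 𝒳 𝒴) ∨
      (IsFrobenius 𝒳 ∧ IsFrobenius 𝒴 ∧
        ∀ X : 𝒳.FullSubcategory, IsInjective 𝒳 X →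
          IsInjective 𝒴 ⟨(homFunctor A B M).obj X.obj, hHom X.obj X.property⟩) ∨
      (IsFrobenius 𝒳 ∧ IsFrobenius 𝒴 ∧
        ∀ X : 𝒳.FullSubcategory, IsProjective 𝒳 X →
          IsProjective 𝒴 ⟨(homFunctor A B M).obj X.obj, hHom X.obj X.property⟩)) :
    ∃ (_ : IsFrobenius 𝒳) (_ : IsFrobenius 𝒴) (_ : IsFrobenius (tripleProp M 𝒳 𝒴))
      (_ : StableTriangulation 𝒴) (_ : StableTriangulation (tripleProp M 𝒳 𝒴))
      (_ : StableTriangulation 𝒳)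
      (Qbar : St (tripleProp M 𝒳 𝒴) ⥤ St 𝒴) (qbar : St 𝒴 ⥤ St (tripleProp M 𝒳 𝒴))
      (QQbar : St (tripleProp M 𝒳 𝒴) ⥤ St 𝒴) (jbar : St 𝒳 ⥤ St (tripleProp M 𝒳 𝒴))
      (Pbar : St (tripleProp M 𝒳 𝒴) ⥤ St 𝒳) (pbar : St 𝒳 ⥤ St (tripleProp M 𝒳 𝒴)),
      Induces (projY M 𝒳 𝒴 hHom) Qbar ∧ Induces (functorQ M 𝒳 𝒴) qbar ∧
      Induces (kerY M 𝒳 𝒴) QQbar ∧ Induces (projX M 𝒳 𝒴) Pbar ∧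
      Induces (functorP M 𝒳 𝒴) pbar ∧
      Nonempty (Recollement Qbar qbar QQbar jbar Pbar pbar) := by
  have hF : IsFrobenius 𝒳 ∧ IsFrobenius 𝒴 ∧ IsFrobenius (tripleProp M 𝒳 𝒴) := by
    obtain h | ⟨h₁, h₂, h⟩ | ⟨h₁, h₂, h⟩ := hFrob
    · exact ⟨isFrobenius_right hco, isFrobenius_left hHom hco, h⟩
    -- Projectives and injectives coincide in 𝒳 and in 𝒴, so hypothesis (2) is hypothesis (3).
    · exact ⟨h₁, h₂, isFrobenius_tripleProp hHom hco fun X hX =>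
        (h X hX.isInjective).isProjective⟩
    · exact ⟨h₁, h₂, isFrobenius_tripleProp hHom hco h⟩
  obtain ⟨h₁, h₂, h₃⟩ := hF
  let t₁ := stableTriangulation 𝒴
  let t₂ := stableTriangulation (tripleProp M 𝒳 𝒴)
  let t₃ := stableTriangulation 𝒳
  exact ⟨h₁, h₂, h₃, t₁, t₂, t₃, stProjY hHom, stQ M 𝒳 𝒴, stKerY M 𝒳 𝒴, stJ hHom hco,
    stProjX hco, stP M 𝒳 𝒴, induces_stFunctor _ _, induces_stFunctor _ _, induces_stFunctor _ _,
    induces_stFunctor _ _, induces_stFunctor _ _, ⟨stableRecollement hHom hco⟩⟩
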